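/- **Conventions.** $\mathbb B_r^k$ is the open ball of centre $0$ and radius $r$ in $\mathbb C^k$, $k\ge 1$; $\log^\star t:=1+|\log t|$; $dd^c=\frac i\pi\partial\overline\partial$. For a real function $g$ on a set $U$ in a metric space put $\Omega_U(g)=\sup_U g-\inf_U g$ and $m_U(g,r)=\sup\{|g(x)-g(y)|: x,y\in U,\ \mathrm{dist}(x,y)\le r\}$. Inequalities between $(1,1)$-currents mean that the difference is a positive current, and derivatives are taken in the sense of distributions. $\mathbb P^k$ carries the distance induced by the Fubini–Study form $\omega_{FS}$ (normalized by $\int\omega_{FS}^k=1$), and for $p>0$ and $g:\mathbb P^k\to\mathbb R$ $$\|g\|_{\log^p}:=\sup_{a,b\in\mathbb P^k}|g(a)-g(b)|\,(\log^\star \mathrm{dist}(a,b))^p .$$ **Proposition 2.4.** For every $k\ge1$ there is a constant $c>0$, depending only on $k$, with the following property. Let $u:\mathbb B^k_5\to\mathbb R$ be continuous with $\|\partial u\|_{L^2(\mathbb B^k_5)}<\infty$, and assume that $i\partial u\wedge\overline\partial u\le dd^c v$ on $\mathbb B_5^k$, where $v:\mathbb B^k_5\to\mathbb R$ is continuous,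 plurisubharmonic, and such that $$\int_0^1 m_{\mathbb B^k_4}(v,t)\,(\log\log^\star t)^4\,t^{-1}\,dt<+\infty .$$ Then for all $0<r\le 1/2$ $$m_{\mathbb B^k_1}(u,r)\le c\Big(\int_0^{r^{1/2}} m_{\mathbb B^k_4}(v,t)(\log\log^\star t)^2t^{-1}dt\Big)^{1/2}+c\,m_{\mathbb B^k_4}(v,r)^{1/3}\,\Omega_{\mathbb B^k_4}(v)^{1/6}(\log^\star r)^{1/2}+c\,\Omega_{\mathbb B^k_4}(v)^{1/2}r^{1/2}(\log^\star r)^{1/2}.$$ **Corollary 2.5.** Let $f$ be a holomorphic endomorphism of $\mathbb P^k$ of algebraic degree $d\ge2$, i.e. $f([z])=[F(z)]$ with $F=(F_0,\dots,F_k)$ homogeneous polynomials of degree $d$ whose only common zero is $0$, and let $T=\lim_n d^{-n}(f^n)^*\omega_{FS}$ be its Green $(1,1)$-current (in each affine chart, $T=dd^c$ of $\lim_n d^{-n}\log\|F^n\|$ composed with a holomorphic section of $\mathbb C^{k+1}\setminus\{0\}\to\mathbb P^k$). Let $p>3/2$. For a positive closed $(1,1)$-current $S_0$ of unit mass on $\mathbb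 P^k$, a dynamical potential of $S_0$ is a function $u_{S_0}$ with $S_0=T+dd^c u_{S_0}$ (it is unique up to an additive constant, which does not affect $\|\cdot\|_{\log^p}$). Let $\mathcal F(S_0)$ be the set of continuous functions $g:\mathbb P^k\to\mathbb R$ with $i\partial g\wedge\overline\partial g\le S_0$ (so that $\partial g$ is locally in $L^2$). Then: 1. for every $0<q<\frac p3-\frac12$ there is a constant $c>0$ (depending on $p$, $q$ and on $k,f$, but not on $S_0$) such that $\|g\|_{\log^q}\le c$ for every $S_0$ having a dynamical potential $u_{S_0}:\mathbb P^k\to\mathbb R$ with $\|u_{S_0}\|_{\log^p}\le1$ and every $g\in\mathcal F(S_0)$; 2. for every such $S_0$ the family $\mathcal F(S_0)$ is equicontinuous. -/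

import Mathlib

open scoped Distributions
open MeasureTheory

noncomputable section

namespace MixedModulus

/-! ### Elementary notions on metric spaces -/

/-- `log⋆ t = 1 + |log t|`. -/
def logStar (t : ℝ) : ℝ := 1 + |Real.log t|

/-- The oscillation `Ω_U(g) = sup_U g - inf_U g`. -/
def osc {X : Type*} (U : Set X) (g : X → ℝ) : ℝ :=
  sSup (g '' U) - sInf (g '' U)

/-- The modulus of continuity
`m_U(g, r) = sup {|g x - g y| : x, y ∈ U, dist x y ≤ r}`. -/
def modulus {X : Type*} [PseudoMetricSpace X] (U : Set X) (g : X → ℝ) (r : ℝ) : ℝ :=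
  sSup {a : ℝ | ∃ x ∈ U, ∃ y ∈ U, dist x y ≤ r ∧ a = |g x - g y|}

/-! ### Currents of bidegree `(1,1)` on open subsets of `ℂᵏ` -/

/-- `ℂᵏ` with its Euclidean norm. -/
abbrev Cn (k : ℕ) : Type := EuclideanSpace ℂ (Fin k)

/-- The open ball of centre `0` and radius `r` in `ℂᵏ`. -/
def ballC (k : ℕ) (r : ℝ) : TopologicalSpace.Opens (Cn k) :=
  ⟨Metric.ball 0 r, Metric.isOpen_ball⟩

/-- The `j`-th vector of the standard basis of `ℂᵏ`. -/
def basisVec {k : ℕ} (j : Fin k) : Cn k := EuclideanSpace.single j (1 : ℂ)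

/-- The distribution on `Ω` defined by a function which is locally integrable on `Ω` (with respect
to Lebesgue measure). -/
def distOf {k : ℕ} (Ω : TopologicalSpace.Opens (Cn k)) (h : Cn k → ℂ) : 𝓓'(Ω, ℂ) :=
  ContinuousLinearMap.toUniformConvergenceCLM _ _ _
    (TestFunction.integralAgainstBilinCLM (ContinuousLinearMap.lsmul ℝ ℝ) volume h)

/-- Multiplication of a complex valued distribution by a complex constant. -/
def cmul {k : ℕ} {Ω : TopologicalSpace.Opens (Cn k)} (a : ℂ) (D : 𝓓'(Ω, ℂ)) : 𝓓'(Ω, ℂ) :=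
  Distribution.mapCLM (ContinuousLinearMap.mul ℝ ℂ a) D

/-- `∂/∂z_j = (∂/∂x_j - i ∂/∂y_j) / 2` on distributions. -/
def dz {k : ℕ} {Ω : TopologicalSpace.Opens (Cn k)} (j : Fin k) (D : 𝓓'(Ω, ℂ)) : 𝓓'(Ω, ℂ) :=
  cmul (1 / 2) (Distribution.lineDerivCLM (basisVec j) D
    - cmul Complex.I (Distribution.lineDerivCLM (Complex.I • basisVec j) D))

/-- `∂/∂z̄_j = (∂/∂x_j + i ∂/∂y_j) / 2` on distributions. -/
def dzbar {k : ℕ} {Ω : TopologicalSpace.Opens (Cn k)} (j : Fin k) (D : 𝓓'(Ω, ℂ)) : 𝓓'(Ω, ℂ) :=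
  cmul (1 / 2) (Distribution.lineDerivCLM (basisVec j) D
    + cmul Complex.I (Distribution.lineDerivCLM (Complex.I • basisVec j) D))

/-- A `(1,1)`-current `R = i ∑ R_{jl} dz_j ∧ dz̄_l` on `Ω`, given by the matrix of its
coefficients `R_{jl}`, which are distributions on `Ω`. -/
abbrev Current11 {k : ℕ} (Ω : TopologicalSpace.Opens (Cn k)) : Type :=
  Matrix (Fin k) (Fin k) 𝓓'(Ω, ℂ)

/-- A `(1,1)`-current is positive if for every `ξ ∈ ℂᵏ` the distribution
`∑ R_{jl} ξ_j ξ̄_l` is positive, i.e. takes real non-negative values on non-negative test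
functions. -/
def Current11.IsPositive {k : ℕ} {Ω : TopologicalSpace.Opens (Cn k)} (R : Current11 Ω) : Prop :=
  ∀ (ξ : Cn k) (φ : 𝓓(Ω, ℝ)), (∀ x, 0 ≤ φ x) →
    0 ≤ (∑ j, ∑ l, R j l φ * ξ j * star (ξ l)).re ∧
      (∑ j, ∑ l, R j l φ * ξ j * star (ξ l)).im = 0

/-- A `(1,1)`-current is closed if `∂R = 0` and `∂̄R = 0`. -/
def Current11.IsClosed {k : ℕ} {Ω : TopologicalSpace.Opens (Cn k)} (R : Current11 Ω) : Prop :=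
  ∀ a j l : Fin k, dz a (R j l) = dz j (R a l) ∧ dzbar a (R j l) = dzbar l (R j a)

/-- The current `ddᶜ v = (i/π) ∂∂̄ v`. -/
def ddc {k : ℕ} (Ω : TopologicalSpace.Opens (Cn k)) (v : Cn k → ℝ) : Current11 Ω :=
  fun j l => cmul (1 / Real.pi : ℝ) (dz j (dzbar l (distOf Ω (fun z => (v z : ℂ)))))

/-- `G = (G_1, …, G_k)` represents `∂u = ∑ G_j dz_j` in the sense of distributions on `Ω`, with
each `G_j` locally square integrable on `Ω`. -/
def IsDel {k : ℕ} (Ω : TopologicalSpace.Opens (Cn k)) (u : Cn k → ℝ) (G : Fin k → Cn k → ℂ) :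
    Prop :=
  ∀ j, (∀ K ⊆ (Ω : Set (Cn k)), IsCompact K → MemLp (G j) 2 (volume.restrict K)) ∧
    dz j (distOf Ω (fun z => (u z : ℂ))) = distOf Ω (G j)

/-- The current `i ∂u ∧ ∂̄u = i ∑ G_j Ḡ_l dz_j ∧ dz̄_l`, for a real function `u` with
`∂u = ∑ G_j dz_j`. -/
def delWedge {k : ℕ} (Ω : TopologicalSpace.Opens (Cn k)) (G : Fin k → Cn k → ℂ) : Current11 Ω :=
  fun j l => distOf Ω (fun z => G j z * star (G l z))

/-- Plurisubharmonic functions (finite valued): upper semicontinuous, and satisfying the sub-mean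
value inequality on every closed complex disc contained in `Ω`. It is only used for functions which
are continuous on `Ω`, so that the circle averages make sense. -/
def IsPsh {k : ℕ} (Ω : TopologicalSpace.Opens (Cn k)) (v : Cn k → ℝ) : Prop :=
  UpperSemicontinuousOn v Ω ∧
    ∀ a ξ : Cn k, (∀ τ : ℂ, ‖τ‖ ≤ 1 → a + τ • ξ ∈ Ω) →
      v a ≤ Real.circleAverage (fun τ : ℂ => v (a + τ • ξ)) 0 1

/-! ### The projective space `ℙᵏ` -/

/-- The complex projective space `ℙᵏ`. -/
abbrev Pk (k : ℕ) : Type := Projectivization ℂ (Cn (k + 1))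

/-- The distance on `ℙᵏ` induced by the Fubini-Study form `ω = (i/2π) ∂∂̄ log ‖z‖²`, which is
normalized by `∫ ω^k = 1`. (The Hermitian metric attached to the form `(i/2) ∑ dz_j ∧ dz̄_j` is the
Euclidean one, so that in affine coordinates the metric of `ω` at the origin is `π⁻¹ |dw|²`.) -/
def fsDist {k : ℕ} (a b : Pk k) : ℝ :=
  Real.arccos (‖inner ℂ a.rep b.rep‖ / (‖a.rep‖ * ‖b.rep‖)) / Real.sqrt Real.pi

/-- The semi-norm `‖g‖_{log^p} = sup_{a,b} |g a - g b| (log⋆ dist(a,b))^p`, possibly infinite. -/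
def logSeminorm {k : ℕ} (p : ℝ) (g : Pk k → ℝ) : ENNReal :=
  ⨆ (a : Pk k) (b : Pk k), ENNReal.ofReal (|g a - g b| * logStar (fsDist a b) ^ p)

/-- Continuity of a function on `ℙᵏ` (for the quotient topology of `ℂᵏ⁺¹ ∖ {0}`). -/
def ContinuousOnPk {k : ℕ} (g : Pk k → ℝ) : Prop :=
  Continuous fun z : {z : Cn (k + 1) // z ≠ 0} => g (Projectivization.mk ℂ z.1 z.2)

/-- The section `w ↦ (w_0, …, w_{i-1}, 1, w_i, …, w_{k-1})` over the `i`-th affine chart. -/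
def affineLift {k : ℕ} (i : Fin (k + 1)) (w : Cn k) : Cn (k + 1) :=
  WithLp.toLp 2 (Fin.insertNth (α := fun _ => ℂ) i 1 w.ofLp)

theorem affineLift_ne_zero {k : ℕ} (i : Fin (k + 1)) (w : Cn k) : affineLift i w ≠ 0 := by
  intro h
  have h1 : (affineLift i w) i = (0 : Cn (k + 1)) i := by rw [h]
  simp [affineLift] at h1

/-- The inverse `ℂᵏ → ℙᵏ` of the `i`-th affine chart. -/
def affineChart {k : ℕ} (i : Fin (k + 1)) (w : Cn k) : Pk k :=
  Projectivization.mk ℂ (affineLift i w) (affineLift_ne_zero i w)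

/-- A `(1,1)`-current on `ℙᵏ`, given by its expressions in the `k + 1` standard affine charts. -/
abbrev CurrentPk (k : ℕ) : Type := Fin (k + 1) → Current11 (⊤ : TopologicalSpace.Opens (Cn k))

/-- Holomorphic endomorphisms of `ℙᵏ` of algebraic degree `d`: maps `[z] ↦ [F_0 z : … : F_k z]`,
where the `F_j` are homogeneous polynomials of degree `d` with no common zero except the origin. -/
structure HolEndo (k d : ℕ) where
  /-- The components of a homogeneous lift. -/
  F : Fin (k + 1) → MvPolynomial (Fin (k + 1)) ℂ
  homogeneous : ∀ j, (F j).IsHomogeneous d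
  eq_zero_of_eval : ∀ z : Fin (k + 1) → ℂ, (∀ j, MvPolynomial.eval z (F j) = 0) → z = 0

/-- The homogeneous lift of an endomorphism to `ℂᵏ⁺¹`. -/
def HolEndo.lift {k d : ℕ} (f : HolEndo k d) (z : Cn (k + 1)) : Cn (k + 1) :=
  WithLp.toLp 2 fun j => MvPolynomial.eval z.ofLp (f.F j)

/-- The Green function `lim d⁻ⁿ log ‖Fⁿ(z)‖` of the homogeneous lift `F` (the limit exists for
`z ≠ 0`, locally uniformly). -/
def HolEndo.green {k d : ℕ} (f : HolEndo k d) (z : Cn (k + 1)) : ℝ :=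
  Filter.limUnder Filter.atTop fun n : ℕ => Real.log ‖f.lift^[n] z‖ / (d : ℝ) ^ n

/-- The Green `(1,1)`-current `T = lim d⁻ⁿ (fⁿ)^* ω` of `f`: in every affine chart it is `ddᶜ` of
the Green function composed with the section over that chart. -/
def HolEndo.greenCurrent {k d : ℕ} (f : HolEndo k d) : CurrentPk k :=
  fun i => ddc ⊤ (fun w => f.green (affineLift i w))

/-- The current `ddᶜ u` of a function on `ℙᵏ`. -/
def ddcPk {k : ℕ} (u : Pk k → ℝ) : CurrentPk k :=
  fun i => ddc ⊤ (fun w => u (affineChart i w))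

/-- Positive closed `(1,1)`-currents `S` on `ℙᵏ` of unit mass with dynamical potential `u` (up to an
additive constant): `S` is positive and closed, and `S = T + ddᶜ u`, where `T` is the Green current
of `f`. The last identity forces the expressions of `S` in the charts to be compatible, and `S` to
be cohomologous to `T`, hence to have the same mass as `T`, which is one. -/
structure HasDynPotential {k d : ℕ} (f : HolEndo k d) (S : CurrentPk k) (u : Pk k → ℝ) :
    Prop where
  positive : ∀ i, (S i).IsPositive
  closed : ∀ i, (S i).IsClosed
  eq_add : ∀ i, S i = f.greenCurrent i + ddcPk u i

/-- The set `𝓕(S)` of continuous functions `g` on `ℙᵏ` with `i∂g ∧ ∂̄g ≤ S` (in particular `∂g` is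
locally square integrable in the charts). -/
def familyF {k : ℕ} (S : CurrentPk k) : Set (Pk k → ℝ) :=
  {g | ContinuousOnPk g ∧ ∀ i, ∃ G : Fin k → Cn k → ℂ,
    IsDel ⊤ (fun w => g (affineChart i w)) G ∧
      Current11.IsPositive (S i - delWedge ⊤ G)}

end MixedModulus

end

open MixedModulus

open scoped Distributions
open MeasureTheory

noncomputable section

namespace MixedModulus

section

/-! ### Weak formulation with real test functions -/

/-! The trace of `i∂u ∧ ∂̄u ≤ ddᶜ v` says that the energy density of `u` is at most the Laplacian of
`v` divided by `4π`, tested on nonnegative functions. This scalar inequality, together with the weak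
gradient of `u` (`EnergyBound`), is all that is used of the currents.

Let `A_h(t)` be the average of `h` around a point at scale `t` for the radial kernel `dens`. There
is a nonnegative radial bump `φ` with `∫ Δφ · h = t^(2k-2) (A_h(t) - A_h(t/2))` for every continuous
`h` (`integral_lap_rad_prof_mul`), and `|∇φ|² ≤ C φ / t²`. For `h = v` the identity bounds the
energy of `u` against `φ`. For `h = u`, one integration by parts and Cauchy-Schwarz then give
`(A_u(t) - A_u(t/2))² ≤ C (A_v(t) - A_v(t/2))` (`exists_avg_sub_sq_le`): squared increments of `u`
are dominated by increments of `v`, which telescope.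

To pass from the scale `t` down to the point, one sums over dyadic scales with increasing weights
`w_j`. Cauchy-Schwarz separates `∑ 1/w_j` from `∑ w_j (b_j - b_{j+1})`, where `b_j` is the deviation
of the averages of `v`; Abel summation turns the latter into `w_0 b_0 + ∑ (w_{j+1} - w_j) b_{j+1}`
up to a term of good sign, and `b_j` is at most a multiple of the modulus of `v`
(`sub_sq_le_of_weights`). At a fixed scale, the gradient of the average with respect to its centre
is controlled by the same energy (`exists_avg_sub_avg_sq_le`), so two nearby points can be compared.

With `x = log⋆` of the scale, the weight `x (log x)²` has summable inverses and increments of order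
`(log x)²`, so the Abel sum is a Riemann sum of the integral in the first term of the estimate. That
term alone bounds the modulus of `u`; the other two are nonnegative (`exists_modulus_le`).

For the corollary the potential in an affine chart is the Green function plus the dynamical
potential. The Green function is Hölder, hence has a modulus `(log⋆)^(-p)` like the other summand.
The weight `x^(1+ε)` with `ε = (p-1)/2` yields the exponent `(p-1)/2` for `g`, which exceeds `p/3 -
1/2`. Comparing the Fubini-Study distance with affine coordinates makes the bound global
(`exists_logSeminorm_le`), and a uniform logarithmic modulus is equicontinuity. -/

/-- Smooth functions with compact support contained in `Ω`. -/
structure IsTest {k : ℕ} (Ω : TopologicalSpace.Opens (Cn k)) (φ : Cn k → ℝ) : Prop where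
  contDiff : ContDiff ℝ ((⊤ : ℕ∞) : WithTop ℕ∞) φ
  hasCompactSupport : HasCompactSupport φ
  tsupport_subset : tsupport φ ⊆ Ω

/-- The bundled test function. -/
def IsTest.toTest {k : ℕ} {Ω : TopologicalSpace.Opens (Cn k)} {φ : Cn k → ℝ} (h : IsTest Ω φ) :
    𝓓(Ω, ℝ) := ⟨φ, h.contDiff, h.hasCompactSupport, h.tsupport_subset⟩

@[simp] theorem IsTest.coe_toTest {k : ℕ} {Ω : TopologicalSpace.Opens (Cn k)} {φ : Cn k → ℝ}
    (h : IsTest Ω φ) : (h.toTest : Cn k → ℝ) = φ := rfl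

theorem isTest_coe {k : ℕ} {Ω : TopologicalSpace.Opens (Cn k)} (φ : 𝓓(Ω, ℝ)) : IsTest Ω φ :=
  ⟨φ.contDiff, φ.hasCompactSupport, φ.tsupport_subset⟩

/-- The Laplacian on `ℂᵏ = ℝ²ᵏ`. -/
def lap {k : ℕ} (φ : Cn k → ℝ) (x : Cn k) : ℝ :=
  ∑ j : Fin k, (lineDeriv ℝ (fun y => lineDeriv ℝ φ y (basisVec j)) x (basisVec j)
    + lineDeriv ℝ (fun y => lineDeriv ℝ φ y (Complex.I • basisVec j)) x (Complex.I • basisVec j))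

variable {k : ℕ} {Ω : TopologicalSpace.Opens (Cn k)}

theorem coe_lineDerivCLM (φ : 𝓓(Ω, ℝ)) (w : Cn k) :
    ((TestFunction.lineDerivCLM ℝ w φ : 𝓓(Ω, ℝ)) : Cn k → ℝ) = fun x => lineDeriv ℝ φ x w := by
  ext x
  rw [TestFunction.lineDerivCLM_apply_of_le (by simp)]

theorem IsTest.lineDeriv {φ : Cn k → ℝ} (h : IsTest Ω φ) (w : Cn k) :
    IsTest Ω (fun x => lineDeriv ℝ φ x w) := by
  have := isTest_coe (TestFunction.lineDerivCLM ℝ w h.toTest : 𝓓(Ω, ℝ))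
  rwa [coe_lineDerivCLM, h.coe_toTest] at this

theorem distOf_apply {h : Cn k → ℂ} (hh : LocallyIntegrableOn h Ω volume) (φ : 𝓓(Ω, ℝ)) :
    distOf Ω h φ = ∫ x, (φ x : ℂ) * h x := by
  have := TestFunction.integralAgainstBilinCLM_eq_integral
    (B := ContinuousLinearMap.lsmul ℝ ℝ (E := ℂ)) (n := ⊤) hh (f := φ)
  change TestFunction.integralAgainstBilinCLM _ _ _ _ = _
  rw [this]
  simp

theorem cmul_apply (a : ℂ) (D : 𝓓'(Ω, ℂ)) (φ : 𝓓(Ω, ℝ)) : cmul a D φ = a * D φ := rfl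

/-- Each derivative moves to the test function with a minus sign, which turns the `-i` of `∂/∂z_j`
into `+i`. -/
theorem dz_apply (j : Fin k) (D : 𝓓'(Ω, ℂ)) (φ : 𝓓(Ω, ℝ)) :
    dz j D φ = 1 / 2 * (-D (TestFunction.lineDerivCLM ℝ (basisVec j) φ)
      + Complex.I * D (TestFunction.lineDerivCLM ℝ (Complex.I • basisVec j) φ)) := by
  have : dz j D φ = 1 / 2 * (-D (TestFunction.lineDerivCLM ℝ (basisVec j) φ)
      - Complex.I * -D (TestFunction.lineDerivCLM ℝ (Complex.I • basisVec j) φ)) := rfl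
  rw [this]; ring

theorem dzbar_apply (j : Fin k) (D : 𝓓'(Ω, ℂ)) (φ : 𝓓(Ω, ℝ)) :
    dzbar j D φ = 1 / 2 * (-D (TestFunction.lineDerivCLM ℝ (basisVec j) φ)
      - Complex.I * D (TestFunction.lineDerivCLM ℝ (Complex.I • basisVec j) φ)) := by
  have : dzbar j D φ = 1 / 2 * (-D (TestFunction.lineDerivCLM ℝ (basisVec j) φ)
      + Complex.I * -D (TestFunction.lineDerivCLM ℝ (Complex.I • basisVec j) φ)) := rfl
  rw [this]; ring

theorem locallyIntegrableOn_ofReal {u : Cn k → ℝ} (hu : ContinuousOn u Ω) :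
    LocallyIntegrableOn (fun z => (u z : ℂ)) Ω volume :=
  (Complex.continuous_ofReal.comp_continuousOn hu).locallyIntegrableOn Ω.isOpen.measurableSet

theorem distOf_ofReal_apply {u : Cn k → ℝ} (hu : ContinuousOn u Ω) (φ : 𝓓(Ω, ℝ)) :
    distOf Ω (fun z => (u z : ℂ)) φ = ((∫ x, φ x * u x : ℝ) : ℂ) := by
  rw [distOf_apply (locallyIntegrableOn_ofReal hu), ← integral_complex_ofReal]
  simp

/-- Local square integrability on `Ω`. -/
def LocL2 (Ω : TopologicalSpace.Opens (Cn k)) (g : Cn k → ℂ) : Prop :=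
  ∀ K ⊆ (Ω : Set (Cn k)), IsCompact K → MemLp g 2 (volume.restrict K)

theorem LocL2.locallyIntegrableOn {g : Cn k → ℂ} (hg : LocL2 Ω g) :
    LocallyIntegrableOn g Ω volume := by
  rw [locallyIntegrableOn_iff Ω.isOpen.isLocallyClosed]
  intro K hK hKc
  have : IsFiniteMeasure (volume.restrict K) := ⟨by simpa using hKc.measure_lt_top⟩
  exact (hg K hK hKc).integrable (by norm_num)

theorem LocL2.locallyIntegrableOn_mul_star {g h : Cn k → ℂ} (hg : LocL2 Ω g) (hh : LocL2 Ω h) :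
    LocallyIntegrableOn (fun z => g z * star (h z)) Ω volume := by
  rw [locallyIntegrableOn_iff Ω.isOpen.isLocallyClosed]
  intro K hK hKc
  exact MemLp.integrable_mul (hg K hK hKc) (hh K hK hKc).star

theorem IsTest.integrable_mul {φ : Cn k → ℝ} (h : IsTest Ω φ) {f : Cn k → ℝ}
    (hf : LocallyIntegrableOn f Ω volume) : Integrable (fun x => φ x * f x) := by
  have := TestFunction.integrable_bilin (μ := volume) (φ := f)
    (ContinuousLinearMap.lsmul ℝ ℝ (E := ℝ)) hf (f := h.toTest)
  simpa using this

theorem IsTest.integrable_mul_of_continuousOn {φ : Cn k → ℝ} (h : IsTest Ω φ) {f : Cn k → ℝ}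
    (hf : ContinuousOn f Ω) : Integrable (fun x => φ x * f x) :=
  h.integrable_mul (hf.locallyIntegrableOn Ω.isOpen.measurableSet)

theorem IsTest.integrable_mul_complex {φ : Cn k → ℝ} (h : IsTest Ω φ) {f : Cn k → ℂ}
    (hf : LocallyIntegrableOn f Ω volume) : Integrable (fun x => (φ x : ℂ) * f x) := by
  have := TestFunction.integrable_bilin (μ := volume) (φ := f)
    (ContinuousLinearMap.lsmul ℝ ℝ (E := ℂ)) hf (f := h.toTest)
  simpa using this

theorem IsTest.lap_isTest {φ : Cn k → ℝ} (h : IsTest Ω φ) (j : Fin k) :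
    IsTest Ω (fun x => _root_.lineDeriv ℝ
        (fun y => _root_.lineDeriv ℝ φ y (basisVec j)) x (basisVec j)
      + _root_.lineDeriv ℝ
        (fun y => _root_.lineDeriv ℝ φ y (Complex.I • basisVec j)) x (Complex.I • basisVec j)) := by
  have h1 := (h.lineDeriv (basisVec j)).lineDeriv (basisVec j)
  have h2 := (h.lineDeriv (Complex.I • basisVec j)).lineDeriv (Complex.I • basisVec j)
  exact isTest_coe (h1.toTest + h2.toTest)

/-- The weak consequences of `i∂u ∧ ∂̄u ≤ ddᶜ v` used below: `G` is the weak gradient of `u` and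
the energy density of `u` is dominated by the Laplacian of `v`. -/
structure EnergyBound (Ω : TopologicalSpace.Opens (Cn k)) (u v : Cn k → ℝ)
    (G : Fin k → Cn k → ℂ) : Prop where
  contU : ContinuousOn u Ω
  contV : ContinuousOn v Ω
  locL2 : ∀ j, LocL2 Ω (G j)
  re : ∀ φ, IsTest Ω φ → ∀ j,
    ∫ x, lineDeriv ℝ φ x (basisVec j) * u x = -2 * ∫ x, φ x * (G j x).re
  im : ∀ φ, IsTest Ω φ → ∀ j,
    ∫ x, lineDeriv ℝ φ x (Complex.I • basisVec j) * u x = 2 * ∫ x, φ x * (G j x).im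
  energy : ∀ φ, IsTest Ω φ → (∀ x, 0 ≤ φ x) →
    ∑ j, ∫ x, φ x * ‖G j x‖ ^ 2 ≤ 1 / (4 * Real.pi) * ∫ x, lap φ x * v x

/-- Since `u` is real, `∂u/∂z_j = G_j` splits into `∂u/∂x_j = 2 Re G_j` and `∂u/∂y_j = -2 Im G_j`;
integration by parts changes both signs. -/
theorem IsDel.weak {u : Cn k → ℝ} {G : Fin k → Cn k → ℂ} (hu : ContinuousOn u Ω)
    (h : IsDel Ω u G) {φ : Cn k → ℝ} (hφ : IsTest Ω φ) (j : Fin k) :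
    (∫ x, lineDeriv ℝ φ x (basisVec j) * u x = -2 * ∫ x, φ x * (G j x).re) ∧
    (∫ x, lineDeriv ℝ φ x (Complex.I • basisVec j) * u x = 2 * ∫ x, φ x * (G j x).im) := by
  have hG : LocL2 Ω (G j) := (h j).1
  have e := congrArg (fun D : 𝓓'(Ω, ℂ) => D hφ.toTest) (h j).2
  simp only [dz_apply, distOf_ofReal_apply hu, distOf_apply hG.locallyIntegrableOn,
    coe_lineDerivCLM, hφ.coe_toTest] at e
  have hi := hφ.integrable_mul_complex hG.locallyIntegrableOn
  have hre := integral_re hi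
  have him := integral_im hi
  rw [← e] at hre him
  simp at hre him
  constructor <;> linarith

/-- `∂/∂z_j ∂/∂z̄_j` is a quarter of the Laplacian in the `j`-th complex variable. The mixed
derivatives carry a factor `i` and real integrals, so they disappear in the real part. -/
theorem ddc_apply_self_re {v : Cn k → ℝ} (hv : ContinuousOn v Ω) {φ : Cn k → ℝ}
    (hφ : IsTest Ω φ) (j : Fin k) :
    (ddc Ω v j j hφ.toTest).re = 1 / (4 * Real.pi) * ∫ x, (lineDeriv ℝ
        (fun y => lineDeriv ℝ φ y (basisVec j)) x (basisVec j)
      + lineDeriv ℝ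
        (fun y => lineDeriv ℝ φ y (Complex.I • basisVec j)) x (Complex.I • basisVec j)) * v x := by
  have h1 := ((hφ.lineDeriv (basisVec j)).lineDeriv (basisVec j)).integrable_mul_of_continuousOn hv
  have h2 := ((hφ.lineDeriv (Complex.I • basisVec j)).lineDeriv
    (Complex.I • basisVec j)).integrable_mul_of_continuousOn hv
  simp only [add_mul]
  rw [integral_add h1 h2]
  simp only [ddc, cmul_apply, dz_apply, dzbar_apply, distOf_ofReal_apply hv, coe_lineDerivCLM,
    hφ.coe_toTest]
  have : ((1 / Real.pi : ℝ) : ℂ) = ((Real.pi⁻¹ : ℝ) : ℂ) := by simp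
  rw [this, Complex.re_ofReal_mul]
  simp
  field_simp
  ring

theorem delWedge_apply_self_re {G : Fin k → Cn k → ℂ} (hG : ∀ j, LocL2 Ω (G j)) {φ : Cn k → ℝ}
    (hφ : IsTest Ω φ) (j : Fin k) :
    (delWedge Ω G j j hφ.toTest).re = ∫ x, φ x * ‖G j x‖ ^ 2 := by
  rw [delWedge, distOf_apply ((hG j).locallyIntegrableOn_mul_star (hG j))]
  have := integral_re (hφ.integrable_mul_complex ((hG j).locallyIntegrableOn_mul_star (hG j)))
  change RCLike.re (∫ x, ((hφ.toTest x : ℝ) : ℂ) * _) = _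
  rw [hφ.coe_toTest, ← this]
  congr 1 with x
  have : G j x * star (G j x) = ((‖G j x‖ ^ 2 : ℝ) : ℂ) := by
    simpa using Complex.mul_conj' (G j x)
  rw [this, ← Complex.ofReal_mul]
  rfl

theorem Current11.IsPositive.diag {R : Current11 Ω} (h : R.IsPositive) (j : Fin k)
    {φ : 𝓓(Ω, ℝ)} (hφ : ∀ x, 0 ≤ φ x) : 0 ≤ (R j j φ).re := by
  have := (h (basisVec j) φ hφ).1
  rw [Finset.sum_eq_single j, Finset.sum_eq_single j] at this
  · simpa [basisVec] using this
  · intro b _ hb; simp [basisVec, hb]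
  · simp
  · intro b _ hb; exact Finset.sum_eq_zero fun l _ => by simp [basisVec, hb]
  · simp

theorem integral_lap_mul {v : Cn k → ℝ} (hv : ContinuousOn v Ω) {φ : Cn k → ℝ}
    (hφ : IsTest Ω φ) : ∫ x, lap φ x * v x = ∑ j, ∫ x, (lineDeriv ℝ
        (fun y => lineDeriv ℝ φ y (basisVec j)) x (basisVec j)
      + lineDeriv ℝ
        (fun y => lineDeriv ℝ φ y (Complex.I • basisVec j)) x (Complex.I • basisVec j)) * v x := by
  simp only [lap, Finset.sum_mul]
  exact integral_finsetSum _ fun j _ => (hφ.lap_isTest j).integrable_mul_of_continuousOn hv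

theorem sum_ddc_re {v : Cn k → ℝ} (hv : ContinuousOn v Ω) {φ : Cn k → ℝ} (hφ : IsTest Ω φ) :
    ∑ j, (ddc Ω v j j hφ.toTest).re = 1 / (4 * Real.pi) * ∫ x, lap φ x * v x := by
  simp only [ddc_apply_self_re hv, integral_lap_mul hv hφ, Finset.mul_sum]

/-- Only the trace of `S` enters, so the lemma serves both `S = ddᶜ v` on a ball and `S = T + ddᶜ
u_S` in a chart. The energy inequality is the sum of the diagonal positivity conditions. -/
theorem energyBound_of_isPositive {u v : Cn k → ℝ} {G : Fin k → Cn k → ℂ}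
    {S : Current11 Ω} (hu : ContinuousOn u Ω) (hv : ContinuousOn v Ω) (hG : IsDel Ω u G)
    (hS : ∀ φ (hφ : IsTest Ω φ),
      ∑ j, (S j j hφ.toTest).re = 1 / (4 * Real.pi) * ∫ x, lap φ x * v x)
    (h : Current11.IsPositive (S - delWedge Ω G)) : EnergyBound Ω u v G where
  contU := hu
  contV := hv
  locL2 j := (hG j).1
  re φ hφ j := (hG.weak hu hφ j).1
  im φ hφ j := (hG.weak hu hφ j).2
  energy φ hφ h0 := by
    rw [← hS φ hφ]
    refine Finset.sum_le_sum fun j _ => ?_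
    have := h.diag j (φ := hφ.toTest) h0
    rw [← delWedge_apply_self_re (fun j => (hG j).1) hφ j]
    change 0 ≤ (S j j hφ.toTest - delWedge Ω G j j hφ.toTest).re at this
    rw [Complex.sub_re] at this
    linarith

end

section

/-! ### Radial profiles -/

/-- A smooth nondecreasing step, equal to `0` on `(-∞, 1/2]` and to `1` on `[1, ∞)`. -/
def step (s : ℝ) : ℝ := Real.smoothTransition (2 * s - 1)

theorem contDiff_step : ContDiff ℝ ((⊤ : ℕ∞) : WithTop ℕ∞) step :=
  Real.smoothTransition.contDiff.comp ((contDiff_const.mul contDiff_id).sub contDiff_const)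

theorem step_of_le {s : ℝ} (h : s ≤ 1 / 2) : step s = 0 :=
  Real.smoothTransition.zero_of_nonpos (by linarith)

theorem step_of_ge {s : ℝ} (h : 1 ≤ s) : step s = 1 :=
  Real.smoothTransition.one_of_one_le (by linarith)

theorem monotone_step : Monotone step := fun _ _ h =>
  Real.smoothTransition.monotone (by linarith)

theorem contDiff_deriv_step : ContDiff ℝ ((⊤ : ℕ∞) : WithTop ℕ∞) (deriv step) := by
  exact (contDiff_infty_iff_deriv.1 contDiff_step).2

theorem deriv_step_nonneg (s : ℝ) : 0 ≤ deriv step s := monotone_step.deriv_nonneg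

theorem deriv_step_of_lt {s : ℝ} (h : s < 1 / 2) : deriv step s = 0 := by
  have : step =ᶠ[nhds s] fun _ => 0 := by
    filter_upwards [Iio_mem_nhds h] with y hy using step_of_le (le_of_lt hy)
  rw [this.deriv_eq]; simp

theorem deriv_step_of_gt {s : ℝ} (h : 1 < s) : deriv step s = 0 := by
  have : step =ᶠ[nhds s] fun _ => 1 := by
    filter_upwards [Ioi_mem_nhds h] with y hy using step_of_ge (le_of_lt hy)
  rw [this.deriv_eq]; simp

theorem deriv_step_of_ge {s : ℝ} (h : 1 ≤ s) : deriv step s = 0 := by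
  have hc : IsClosed {x | deriv step x = 0} :=
    isClosed_eq contDiff_deriv_step.continuous continuous_const
  have : Set.Ici (1 : ℝ) ⊆ {x | deriv step x = 0} := by
    rw [← closure_Ioi]
    exact closure_minimal (fun x hx => deriv_step_of_gt hx) hc
  exact this h

/-- The radial flux `step (4 s) - step s`. -/
def flux (s : ℝ) : ℝ := step (4 * s) - step s

theorem contDiff_flux : ContDiff ℝ ((⊤ : ℕ∞) : WithTop ℕ∞) flux :=
  (contDiff_step.comp (contDiff_const.mul contDiff_id)).sub contDiff_step

theorem flux_of_le {s : ℝ} (h : s ≤ 1 / 8) : flux s = 0 := by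
  rw [flux, step_of_le (by linarith), step_of_le (by linarith), sub_zero]

theorem flux_of_ge {s : ℝ} (h : 1 ≤ s) : flux s = 0 := by
  rw [flux, step_of_ge (by linarith), step_of_ge (by linarith), sub_self]

theorem flux_nonneg (s : ℝ) : 0 ≤ flux s := by
  by_cases h : s ≤ 1 / 8
  · rw [flux_of_le h]
  · exact sub_nonneg.2 (monotone_step (by linarith))

theorem deriv_flux (s : ℝ) : deriv flux s = 4 * deriv step (4 * s) - deriv step s := by
  have hd : Differentiable ℝ step := contDiff_step.differentiable (by simp)
  have h1 : HasDerivAt (fun s => step (4 * s)) (deriv step (4 * s) * (4 * 1)) s :=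
    (hd (4 * s)).hasDerivAt.comp s ((hasDerivAt_id s).const_mul 4)
  have h2 := h1.sub (hd s).hasDerivAt
  have := h2.deriv
  rw [show flux = (fun s => step (4 * s)) - step from rfl, this]
  ring

/-- The factor `s⁻ᵏ` is singular only at `0`, where `f` vanishes in a neighbourhood. -/
theorem contDiff_mul_inv_pow {f : ℝ → ℝ} (hf : ContDiff ℝ ((⊤ : ℕ∞) : WithTop ℕ∞) f)
    (h0 : ∀ s < 1 / 8, f s = 0) (k : ℕ) :
    ContDiff ℝ ((⊤ : ℕ∞) : WithTop ℕ∞) (fun s => f s * (s⁻¹) ^ k) := by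
  rw [contDiff_iff_contDiffAt]
  intro s
  by_cases hs : s = 0
  · have : (fun s => f s * (s⁻¹) ^ k) =ᶠ[nhds s] fun _ => 0 := by
      filter_upwards [Iio_mem_nhds (show s < 1 / 8 by rw [hs]; norm_num)] with y hy
      rw [h0 y hy, zero_mul]
    exact contDiffAt_const.congr_of_eventuallyEq this
  · exact hf.contDiffAt.mul ((contDiffAt_inv ℝ hs).pow k)

/-- The radial derivative of the bump `prof`, up to sign. -/
def slope (k : ℕ) (s : ℝ) : ℝ := flux s * (s⁻¹) ^ k

theorem contDiff_slope (k : ℕ) : ContDiff ℝ ((⊤ : ℕ∞) : WithTop ℕ∞) (slope k) :=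
  contDiff_mul_inv_pow contDiff_flux (fun _ h => flux_of_le h.le) k

theorem slope_nonneg (k : ℕ) {s : ℝ} : 0 ≤ slope k s := by
  by_cases h : s ≤ 1 / 8
  · rw [slope, flux_of_le h, zero_mul]
  · exact mul_nonneg (flux_nonneg s) (pow_nonneg (inv_nonneg.2 (by linarith)) k)

theorem slope_of_le (k : ℕ) {s : ℝ} (h : s ≤ 1 / 8) : slope k s = 0 := by
  rw [slope, flux_of_le h, zero_mul]

theorem slope_of_ge (k : ℕ) {s : ℝ} (h : 1 ≤ s) : slope k s = 0 := by
  rw [slope, flux_of_ge h, zero_mul]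

/-- The nonnegative profile whose radial extension to `ℂᵏ` has Laplacian
`dens k s - 4 ^ k * dens k (4 * s)`. -/
def prof (k : ℕ) (s : ℝ) : ℝ := ∫ σ in s..1, slope k σ

/-- The profile of the averaging kernel. -/
def dens (k : ℕ) (s : ℝ) : ℝ := 4 * s * (deriv step s * (s⁻¹) ^ k)

theorem contDiff_dens (k : ℕ) : ContDiff ℝ ((⊤ : ℕ∞) : WithTop ℕ∞) (dens k) :=
  (contDiff_const.mul contDiff_id).mul (contDiff_mul_inv_pow contDiff_deriv_step
    (fun _ h => deriv_step_of_lt (by linarith)) k)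

theorem dens_of_ge (k : ℕ) {s : ℝ} (h : 1 ≤ s) : dens k s = 0 := by
  rw [dens, deriv_step_of_ge h, zero_mul, mul_zero]

theorem dens_nonneg (k : ℕ) {s : ℝ} : 0 ≤ dens k s := by
  by_cases h : s < 1 / 2
  · rw [dens, deriv_step_of_lt h, zero_mul, mul_zero]
  · have : 0 ≤ s := by linarith
    have := deriv_step_nonneg s
    unfold dens; positivity

theorem hasDerivAt_prof (k : ℕ) (s : ℝ) : HasDerivAt (prof k) (-slope k s) s := by
  have hc := (contDiff_slope k).continuous
  exact intervalIntegral.integral_hasDerivAt_left (hc.intervalIntegrable _ _)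
    hc.stronglyMeasurable.stronglyMeasurableAtFilter hc.continuousAt

theorem deriv_prof (k : ℕ) : deriv (prof k) = fun s => -slope k s :=
  funext fun s => (hasDerivAt_prof k s).deriv

theorem contDiff_prof (k : ℕ) : ContDiff ℝ ((⊤ : ℕ∞) : WithTop ℕ∞) (prof k) := by
  rw [contDiff_infty_iff_deriv]
  refine ⟨fun s => (hasDerivAt_prof k s).differentiableAt, ?_⟩
  rw [deriv_prof]
  exact (contDiff_slope k).neg

theorem antitone_prof (k : ℕ) : Antitone (prof k) :=
  antitone_of_deriv_nonpos (fun s => (hasDerivAt_prof k s).differentiableAt) fun s => by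
    rw [deriv_prof]; exact neg_nonpos.2 (slope_nonneg k)

theorem prof_of_ge (k : ℕ) {s : ℝ} (h : 1 ≤ s) : prof k s = 0 := by
  rw [prof, intervalIntegral.integral_symm, neg_eq_zero]
  refine (intervalIntegral.integral_congr fun σ hσ => ?_).trans intervalIntegral.integral_zero
  rw [Set.uIcc_of_le h] at hσ
  exact slope_of_ge k hσ.1

theorem prof_nonneg (k : ℕ) (s : ℝ) : 0 ≤ prof k s := by
  by_cases h : s ≤ 1
  · rw [← prof_of_ge k le_rfl]; exact antitone_prof k h
  · rw [prof_of_ge k (by linarith)]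

/-- The mean value theorem on `[1/2, 1]`, where `step` climbs from `0` to `1`. It shows that the
averaging kernel is not identically zero. -/
theorem exists_deriv_step_eq : ∃ ξ ∈ Set.Ioo (1 / 2 : ℝ) 1, deriv step ξ = 2 := by
  obtain ⟨ξ, hξ, h⟩ := exists_deriv_eq_slope step (show (1 / 2 : ℝ) < 1 by norm_num)
    contDiff_step.continuous.continuousOn
    (contDiff_step.differentiable (by simp)).differentiableOn
  refine ⟨ξ, hξ, ?_⟩
  rw [h, step_of_ge le_rfl, step_of_le le_rfl]; norm_num

/-- A positive lower bound for the bump near its centre, used to dominate the kernel at scale `t` by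
the bump at scale `4t`. At `s = 1/4` the flux equals `1`, so the integral of the slope over `[1/8,
1]` is positive. -/
theorem prof_eighth_pos (k : ℕ) : 0 < prof k (1 / 8) := by
  have hc := (contDiff_slope k).continuous
  refine intervalIntegral.integral_pos (by norm_num) hc.continuousOn
    (fun s _ => slope_nonneg k) ⟨1 / 4, by norm_num, ?_⟩
  rw [slope, flux, step_of_ge (by norm_num), step_of_le (by norm_num)]
  positivity

theorem prof_eighth_le (k : ℕ) {s : ℝ} (h : s ≤ 1 / 8) : prof k (1 / 8) ≤ prof k s :=
  antitone_prof k h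

theorem exists_bound_of_compact {f : ℝ → ℝ} (hf : Continuous f) :
    ∃ M : ℝ, 0 < M ∧ ∀ s, 0 ≤ s → s ≤ 1 → |f s| ≤ M := by
  obtain ⟨M, hM⟩ := (isCompact_Icc (a := (0 : ℝ)) (b := 1)).exists_bound_of_continuousOn
    hf.continuousOn
  exact ⟨max M 1, by positivity, fun s h0 h1 => (hM s ⟨h0, h1⟩).trans (le_max_left _ _)⟩

/-- A nonnegative profile dominates the square of its derivative. -/
theorem exists_slope_sq_le (k : ℕ) :
    ∃ M : ℝ, 0 < M ∧ ∀ s, 0 ≤ s → slope k s ^ 2 ≤ 2 * M * prof k s := by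
  have hds : ContDiff ℝ ((⊤ : ℕ∞) : WithTop ℕ∞) (deriv (slope k)) :=
    (contDiff_infty_iff_deriv.1 (contDiff_slope k)).2
  obtain ⟨M, hM0, hM⟩ := exists_bound_of_compact hds.continuous
  refine ⟨M, hM0, fun s hs => ?_⟩
  by_cases h1 : 1 ≤ s
  · rw [slope_of_ge k h1, prof_of_ge k h1]; simp
  push Not at h1
  have hd : ∀ x, HasDerivAt (fun s => 2 * M * prof k s - slope k s ^ 2)
      (2 * M * (-slope k x) - 2 * slope k x * deriv (slope k) x) x := fun x => by
    have := ((hasDerivAt_prof k x).const_mul (2 * M)).sub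
      ((((contDiff_slope k).differentiable (by simp)) x).hasDerivAt.pow 2)
    exact this.congr_deriv (by norm_num)
  -- The derivative is `-2 · slope · (M + slope')`, which is nonpositive because `M` bounds
  -- `|slope'|` on `[0, 1]`. As the function vanishes at `1`, it is nonnegative before.
  have hanti : AntitoneOn (fun s => 2 * M * prof k s - slope k s ^ 2) (Set.Icc 0 1) := by
    refine antitoneOn_of_deriv_nonpos (convex_Icc 0 1)
      (fun x _ => (hd x).continuousAt.continuousWithinAt)
      (fun x _ => (hd x).differentiableAt.differentiableWithinAt) fun x hx => ?_
    rw [interior_Icc] at hx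
    rw [(hd x).deriv]
    have h2 := abs_le.1 (hM x hx.1.le hx.2.le)
    have h3 := slope_nonneg k (s := x)
    nlinarith
  have := hanti ⟨hs, h1.le⟩ (Set.right_mem_Icc.2 zero_le_one) h1.le
  simp only [prof_of_ge k le_rfl, slope_of_ge k le_rfl] at this
  linarith

/-- With `s = |x|²/t²` the radial Laplacian is `4 s f'' + 4 k f' = 4 s^(1-k) (sᵏ f')'` up to the
factor `t⁻²`. Here `sᵏ f' = -flux`, and the derivative of `flux s = step (4s) - step s` produces one
kernel and its rescaled copy. -/
theorem lap_profile (k : ℕ) (s : ℝ) :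
    4 * s * (-deriv (slope k) s) + 4 * k * (-slope k s) = dens k s - 4 ^ k * dens k (4 * s) := by
  by_cases hs : s < 1 / 8
  · have : slope k =ᶠ[nhds s] fun _ => 0 := by
      filter_upwards [Iio_mem_nhds hs] with y hy using slope_of_le k (le_of_lt hy)
    rw [this.deriv_eq, slope_of_le k hs.le, dens, dens, deriv_step_of_lt (by linarith),
      deriv_step_of_lt (by linarith)]
    simp
  have h0 : s ≠ 0 := by intro h; rw [h] at hs; norm_num at hs
  have h1 : HasDerivAt (slope k) (deriv flux s * (s⁻¹) ^ k
      + flux s * (k * (s⁻¹) ^ (k - 1) * (-(s ^ 2)⁻¹))) s :=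
    ((contDiff_flux.differentiable (by simp)) s).hasDerivAt.mul ((hasDerivAt_inv h0).pow k)
  rw [h1.deriv, deriv_flux, slope, dens, dens]
  rcases k with _ | k
  · simp; ring
  · rw [Nat.add_sub_cancel, mul_inv, mul_pow, pow_succ (s⁻¹) k]
    push_cast
    have : (4 : ℝ) ^ k * (1 / 4) ^ k = 1 := by
      rw [← mul_pow]; norm_num
    field_simp
    ring_nf
    linear_combination (4 * s * deriv step (s * 4)) * this

end

section

/-! ### Radial test functions -/

/-- The radial function with profile `f`, centre `a` and radius `t`. -/
def rad {k : ℕ} (f : ℝ → ℝ) (a : Cn k) (t : ℝ) (x : Cn k) : ℝ := f (‖x - a‖ ^ 2 / t ^ 2)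

variable {k : ℕ}

theorem contDiff_rad {f : ℝ → ℝ} (hf : ContDiff ℝ ((⊤ : ℕ∞) : WithTop ℕ∞) f) (a : Cn k) (t : ℝ) :
    ContDiff ℝ ((⊤ : ℕ∞) : WithTop ℕ∞) (rad f a t) :=
  hf.comp (((contDiff_norm_sq ℂ).comp (contDiff_id.sub contDiff_const)).div_const _)

theorem rad_eq_zero {f : ℝ → ℝ} (h1 : ∀ s, 1 ≤ s → f s = 0) {a x : Cn k} {t : ℝ} (ht : 0 < t)
    (hx : t ≤ ‖x - a‖) : rad f a t x = 0 := by
  refine h1 _ ?_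
  rw [one_le_div (by positivity)]
  exact pow_le_pow_left₀ ht.le hx 2

theorem tsupport_rad_subset {f : ℝ → ℝ} (h1 : ∀ s, 1 ≤ s → f s = 0) (a : Cn k) {t : ℝ}
    (ht : 0 < t) : tsupport (rad f a t) ⊆ Metric.closedBall a t := by
  refine closure_minimal (fun x hx => ?_) Metric.isClosed_closedBall
  by_contra h
  rw [Metric.mem_closedBall, dist_eq_norm, not_le] at h
  exact hx (rad_eq_zero h1 ht h.le)

theorem hasCompactSupport_rad {f : ℝ → ℝ} (h1 : ∀ s, 1 ≤ s → f s = 0) (a : Cn k) {t : ℝ}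
    (ht : 0 < t) : HasCompactSupport (rad f a t) :=
  (isCompact_closedBall a t).of_isClosed_subset (isClosed_tsupport _) (tsupport_rad_subset h1 a ht)

theorem isTest_rad {Ω : TopologicalSpace.Opens (Cn k)} {f : ℝ → ℝ}
    (hf : ContDiff ℝ ((⊤ : ℕ∞) : WithTop ℕ∞) f) (h1 : ∀ s, 1 ≤ s → f s = 0) {a : Cn k} {t : ℝ}
    (ht : 0 < t) (hΩ : Metric.closedBall a t ⊆ Ω) : IsTest Ω (rad f a t) :=
  ⟨contDiff_rad hf a t, hasCompactSupport_rad h1 a ht, (tsupport_rad_subset h1 a ht).trans hΩ⟩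

theorem hasDerivAt_norm_sq_line (y w : Cn k) :
    HasDerivAt (fun s : ℝ => ‖y + s • w‖ ^ 2) (2 * (inner ℂ y w).re) 0 := by
  have h : (fun s : ℝ => ‖y + s • w‖ ^ 2)
      = fun s : ℝ => ‖y‖ ^ 2 + s * (2 * (inner ℂ y w).re) + s ^ 2 * ‖w‖ ^ 2 := by
    ext s
    have e : s • w = (s : ℂ) • w := (Complex.coe_smul s w).symm
    rw [norm_add_sq (𝕜 := ℂ), e, inner_smul_right, norm_smul, mul_pow]
    simp
    ring
  rw [h]
  have h1 := (((hasDerivAt_id (0 : ℝ)).mul_const (2 * (inner ℂ y w).re)).const_add (‖y‖ ^ 2)).add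
    (((hasDerivAt_id (0 : ℝ)).pow 2).mul_const (‖w‖ ^ 2))
  exact h1.congr_deriv (by simp)

theorem lineDeriv_rad {f f' : ℝ → ℝ} (hf : ∀ s, HasDerivAt f (f' s) s) (a : Cn k) (t : ℝ)
    (x w : Cn k) : lineDeriv ℝ (rad f a t) x w
      = rad f' a t x * (2 * (inner ℂ (x - a) w).re / t ^ 2) := by
  have h1 : HasDerivAt (fun s : ℝ => ‖x + s • w - a‖ ^ 2 / t ^ 2)
      (2 * (inner ℂ (x - a) w).re / t ^ 2) 0 := by
    have := (hasDerivAt_norm_sq_line (x - a) w).div_const (t ^ 2)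
    simpa only [add_sub_right_comm] using this
  have h2 : HasDerivAt f (f' (‖x - a‖ ^ 2 / t ^ 2)) (‖x + (0 : ℝ) • w - a‖ ^ 2 / t ^ 2) := by
    simpa using hf (‖x - a‖ ^ 2 / t ^ 2)
  exact (h2.comp (0 : ℝ) h1).deriv

theorem hasLineDerivAt_rad {f f' : ℝ → ℝ} (hf : ∀ s, HasDerivAt f (f' s) s) (a : Cn k) (t : ℝ)
    (x w : Cn k) : HasLineDerivAt ℝ (rad f a t)
      (rad f' a t x * (2 * (inner ℂ (x - a) w).re / t ^ 2)) x w := by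
  have h1 : HasDerivAt (fun s : ℝ => ‖x + s • w - a‖ ^ 2 / t ^ 2)
      (2 * (inner ℂ (x - a) w).re / t ^ 2) 0 := by
    have := (hasDerivAt_norm_sq_line (x - a) w).div_const (t ^ 2)
    simpa only [add_sub_right_comm] using this
  have h2 : HasDerivAt f (f' (‖x - a‖ ^ 2 / t ^ 2)) (‖x + (0 : ℝ) • w - a‖ ^ 2 / t ^ 2) := by
    simpa using hf (‖x - a‖ ^ 2 / t ^ 2)
  exact h2.comp (0 : ℝ) h1

theorem lineDeriv_lineDeriv_rad {f f' f'' : ℝ → ℝ} (hf : ∀ s, HasDerivAt f (f' s) s)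
    (hf' : ∀ s, HasDerivAt f' (f'' s) s) (a : Cn k) (t : ℝ) (x w : Cn k) :
    lineDeriv ℝ (fun y => lineDeriv ℝ (rad f a t) y w) x w
      = rad f'' a t x * (2 * (inner ℂ (x - a) w).re / t ^ 2) ^ 2
        + rad f' a t x * (2 * ‖w‖ ^ 2 / t ^ 2) := by
  simp only [lineDeriv_rad hf]
  have h1 := hasLineDerivAt_rad hf' a t x w
  have h2 : HasLineDerivAt ℝ (fun y : Cn k => 2 * (inner ℂ (y - a) w).re / t ^ 2)
      (2 * ‖w‖ ^ 2 / t ^ 2) x w := by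
    have e : (fun s : ℝ => 2 * (inner ℂ (x + s • w - a) w).re / t ^ 2)
        = fun s : ℝ => 2 * ((inner ℂ (x - a) w).re + s * ‖w‖ ^ 2) / t ^ 2 := by
      ext s
      have e1 : s • w = (s : ℂ) • w := (Complex.coe_smul s w).symm
      have e2 : (inner ℂ w w).re = ‖w‖ ^ 2 := by
        simpa using inner_self_eq_norm_sq (𝕜 := ℂ) w
      rw [add_sub_right_comm, inner_add_left, e1, inner_smul_left, Complex.add_re,
        Complex.conj_ofReal, Complex.re_ofReal_mul, e2]
    have h3 := (((((hasDerivAt_id (0 : ℝ)).mul_const (‖w‖ ^ 2)).const_add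
      ((inner ℂ (x - a) w).re)).const_mul 2).div_const (t ^ 2))
    change HasDerivAt (fun s : ℝ => 2 * (inner ℂ (x + s • w - a) w).re / t ^ 2) _ 0
    rw [e]
    exact h3.congr_deriv (by simp)
  have h3 : HasDerivAt (fun s : ℝ => rad f' a t (x + s • w)
      * (2 * (inner ℂ (x + s • w - a) w).re / t ^ 2)) _ 0 := HasDerivAt.mul h1 h2
  change deriv (fun s : ℝ => rad f' a t (x + s • w)
      * (2 * (inner ℂ (x + s • w - a) w).re / t ^ 2)) 0 = _
  rw [h3.deriv]
  simp
  ring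

theorem inner_basisVec_re (y : Cn k) (j : Fin k) : (inner ℂ y (basisVec j)).re = (y j).re := by
  simp [basisVec, EuclideanSpace.inner_single_right]

theorem inner_I_basisVec_re (y : Cn k) (j : Fin k) :
    (inner ℂ y (Complex.I • basisVec j)).re = (y j).im := by
  rw [inner_smul_right]
  simp [basisVec, EuclideanSpace.inner_single_right]

theorem norm_basisVec (j : Fin k) : ‖(basisVec j : Cn k)‖ = 1 := by simp [basisVec]

theorem norm_I_basisVec (j : Fin k) : ‖(Complex.I • basisVec j : Cn k)‖ = 1 := by
  rw [norm_smul, norm_basisVec]; simp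

theorem sum_re_sq_add_im_sq (y : Cn k) : ∑ j, ((y j).re ^ 2 + (y j).im ^ 2) = ‖y‖ ^ 2 := by
  rw [EuclideanSpace.norm_sq_eq]
  refine Finset.sum_congr rfl fun j _ => ?_
  rw [← Complex.normSq_eq_norm_sq, Complex.normSq_apply]; ring

theorem lap_rad {f f' f'' : ℝ → ℝ} (hf : ∀ s, HasDerivAt f (f' s) s)
    (hf' : ∀ s, HasDerivAt f' (f'' s) s) (a : Cn k) (t : ℝ) (x : Cn k) :
    lap (rad f a t) x = (t ^ 2)⁻¹ * (4 * (‖x - a‖ ^ 2 / t ^ 2) * rad f'' a t x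
      + 4 * k * rad f' a t x) := by
  simp only [lap, lineDeriv_lineDeriv_rad hf hf', inner_basisVec_re, inner_I_basisVec_re,
    norm_basisVec, norm_I_basisVec]
  rw [← sum_re_sq_add_im_sq (x - a), Finset.sum_div, Finset.mul_sum, Finset.sum_mul]
  have : (4 : ℝ) * k * rad f' a t x = ∑ _j : Fin k, 4 * rad f' a t x := by
    simp; ring
  rw [this, ← Finset.sum_add_distrib, Finset.mul_sum]
  refine Finset.sum_congr rfl fun j _ => ?_
  by_cases ht : t = 0
  · simp [ht]
  field_simp
  ring

/-- Halving `t` multiplies `s = |x - a|²/t²` by `4`, so the second term of `lap_profile` is the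
kernel at scale `t/2`. -/
theorem lap_rad_prof (a : Cn k) (t : ℝ) (x : Cn k) :
    lap (rad (prof k) a t) x
      = (t ^ 2)⁻¹ * (rad (dens k) a t x - 4 ^ k * rad (dens k) a (t / 2) x) := by
  have h : ∀ s, HasDerivAt (fun s => -slope k s) (-deriv (slope k) s) s := fun s =>
    (((contDiff_slope k).differentiable (by simp)) s).hasDerivAt.neg
  rw [lap_rad (hasDerivAt_prof k) h]
  congr 1
  have e : ‖x - a‖ ^ 2 / (t / 2) ^ 2 = 4 * (‖x - a‖ ^ 2 / t ^ 2) := by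
    rw [div_pow, div_div_eq_mul_div]; ring
  rw [rad, rad, rad, rad, e]
  exact lap_profile k _

/-! ### Averages -/

/-- The unnormalised average of `u` at scale `t` around `a`. -/
def avg {k : ℕ} (u : Cn k → ℝ) (a : Cn k) (t : ℝ) : ℝ :=
  (t⁻¹) ^ (2 * k) * ∫ x, rad (dens k) a t x * u x

/-- The total mass of the averaging kernel. -/
def mass (k : ℕ) : ℝ := ∫ x : Cn k, dens k (‖x‖ ^ 2)

theorem finrank_Cn (k : ℕ) : Module.finrank ℝ (Cn k) = 2 * k := by
  rw [← Module.finrank_mul_finrank ℝ ℂ]; simp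

theorem integral_rad (f : ℝ → ℝ) (a : Cn k) {t : ℝ} (ht : 0 < t) :
    ∫ x, rad f a t x = t ^ (2 * k) * ∫ x : Cn k, f (‖x‖ ^ 2) := by
  have h1 : ∀ x, rad f a t x = (fun y : Cn k => f (‖t⁻¹ • y‖ ^ 2)) (x - a) := fun x => by
    simp only [rad, norm_smul, norm_inv, Real.norm_eq_abs, mul_pow, inv_pow, sq_abs]
    congr 1; rw [div_eq_inv_mul]
  simp only [h1]
  rw [integral_sub_right_eq_self (fun y : Cn k => f (‖t⁻¹ • y‖ ^ 2)),
    Measure.integral_comp_inv_smul_of_nonneg volume (fun y : Cn k => f (‖y‖ ^ 2)) ht.le,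
    finrank_Cn, smul_eq_mul]

theorem integral_rad_dens (a : Cn k) {t : ℝ} (ht : 0 < t) :
    ∫ x, rad (dens k) a t x = t ^ (2 * k) * mass k := integral_rad _ a ht

theorem integrable_rad_dens (a : Cn k) {t : ℝ} (ht : 0 < t) : Integrable (rad (dens k) a t) :=
  (contDiff_rad (contDiff_dens k) a t).continuous.integrable_of_hasCompactSupport
    (hasCompactSupport_rad (fun _ h => dens_of_ge k h) a ht)

theorem mass_pos (hk : 1 ≤ k) : 0 < mass k := by
  obtain ⟨ξ, hξ, h⟩ := exists_deriv_step_eq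
  have h0 : ∀ x : Cn k, dens k (‖x‖ ^ 2) = rad (dens k) 0 1 x := fun x => by simp [rad]
  rw [mass]
  simp only [h0]
  have hξ0 : 0 < ξ := by linarith [hξ.1]
  refine Continuous.integral_pos_of_hasCompactSupport_nonneg_nonzero
    -- At this point the squared norm is `ξ`, where the derivative of `step` is `2`; a basis vector
    -- exists since `k ≥ 1`.
    (x := (Real.sqrt ξ) • (basisVec ⟨0, hk⟩ : Cn k))
    (contDiff_rad (contDiff_dens k) _ _).continuous
    (hasCompactSupport_rad (fun _ h => dens_of_ge k h) _ one_pos) (fun x => dens_nonneg k) ?_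
  simp only [rad, sub_zero, norm_smul, norm_basisVec, mul_one, one_pow, div_one,
    Real.norm_eq_abs, sq_abs, Real.sq_sqrt hξ0.le, dens, h]
  positivity

/-- The kernel is nonnegative, supported in the ball of radius `t`, and its normalised mass is `mass
k` at every scale. -/
theorem avg_sub_const_le {Ω : TopologicalSpace.Opens (Cn k)} {v : Cn k → ℝ}
    (hv : ContinuousOn v Ω) {a : Cn k} {t M c : ℝ} (ht : 0 < t)
    (hΩ : Metric.closedBall a t ⊆ Ω) (hM : ∀ x, ‖x - a‖ ≤ t → |v x - c| ≤ M) :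
    |avg v a t - mass k * c| ≤ mass k * M := by
  have hT := isTest_rad (contDiff_dens k) (fun _ h => dens_of_ge k h) ht hΩ
  have hi := hT.integrable_mul_of_continuousOn hv
  have hd := integrable_rad_dens a ht
  have ht' : (0 : ℝ) < t⁻¹ ^ (2 * k) := by positivity
  have hc : ∀ c : ℝ, t⁻¹ ^ (2 * k) * ∫ x, rad (dens k) a t x * c = mass k * c := fun c => by
    rw [integral_mul_const, integral_rad_dens a ht, ← mul_assoc, ← mul_assoc, ← mul_pow,
      inv_mul_cancel₀ ht.ne', one_pow, one_mul]
  have h1 : avg v a t - mass k * c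
      = t⁻¹ ^ (2 * k) * ∫ x, rad (dens k) a t x * (v x - c) := by
    simp only [mul_sub]
    rw [integral_sub hi (hd.mul_const c), mul_sub, hc, avg]
  rw [h1, abs_mul, abs_of_pos ht', ← hc M]
  refine mul_le_mul_of_nonneg_left ?_ ht'.le
  refine abs_integral_le_integral_abs.trans (integral_mono_of_nonneg
    (Filter.Eventually.of_forall fun x => abs_nonneg _) (hd.mul_const M)
    (Filter.Eventually.of_forall fun x => ?_))
  simp only [abs_mul]
  have h0 : 0 ≤ rad (dens k) a t x := dens_nonneg k
  rw [abs_of_nonneg h0]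
  by_cases hx : ‖x - a‖ ≤ t
  · exact mul_le_mul_of_nonneg_left (hM x hx) h0
  · rw [rad_eq_zero (fun _ h => dens_of_ge k h) ht (by linarith)]; simp

/-- Applied to `v` this evaluates the energy bound; applied to `u` it represents the increment of
its averages. The factor `4ᵏ` in the Laplacian is exactly the change of normalisation from `t` to
`t/2`. -/
theorem integral_lap_rad_prof_mul {Ω : TopologicalSpace.Opens (Cn k)} {v : Cn k → ℝ}
    (hv : ContinuousOn v Ω) {a : Cn k} {t : ℝ} (ht : 0 < t) (hΩ : Metric.closedBall a t ⊆ Ω) :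
    ∫ x, lap (rad (prof k) a t) x * v x
      = (t ^ 2)⁻¹ * t ^ (2 * k) * (avg v a t - avg v a (t / 2)) := by
  have hT := isTest_rad (contDiff_dens k) (fun _ h => dens_of_ge k h) ht hΩ
  have hT2 := isTest_rad (contDiff_dens k) (fun _ h => dens_of_ge k h) (half_pos ht)
    ((Metric.closedBall_subset_closedBall (by linarith)).trans hΩ)
  have hi := hT.integrable_mul_of_continuousOn hv
  have hi2 := hT2.integrable_mul_of_continuousOn hv
  have : ∀ x, lap (rad (prof k) a t) x * v x = (t ^ 2)⁻¹ * (rad (dens k) a t x * v x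
      - 4 ^ k * (rad (dens k) a (t / 2) x * v x)) := fun x => by rw [lap_rad_prof]; ring
  simp only [this]
  rw [integral_const_mul, integral_sub hi (hi2.const_mul _), integral_const_mul, avg, avg]
  have e1 : t ^ (2 * k) * t⁻¹ ^ (2 * k) = 1 := by rw [← mul_pow, mul_inv_cancel₀ ht.ne', one_pow]
  have e2 : t ^ (2 * k) * (t / 2)⁻¹ ^ (2 * k) = 4 ^ k := by
    rw [← mul_pow, inv_div, mul_div_cancel₀ _ ht.ne', pow_mul]; norm_num
  rw [mul_assoc, mul_sub (t ^ (2 * k)), ← mul_assoc (t ^ (2 * k)), ← mul_assoc (t ^ (2 * k)), e1,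
    e2, one_mul]

end

section

/-! ### Averages of `u` and `v` at two scales -/

/-- Cauchy-Schwarz in linearised form: optimise over `l`. It lets the sum over coordinates and the
integral be handled by a pointwise inequality with parameter. When `E = 0`, a large `l` forces `X =
0`. -/
theorem sq_le_of_forall_le {X E V : ℝ} (hX : 0 ≤ X) (hE : 0 ≤ E) (hV : 0 ≤ V)
    (h : ∀ l : ℝ, 0 < l → X ≤ l * E + V / l) : X ^ 2 ≤ 4 * E * V := by
  rcases hX.eq_or_lt with h0 | h0
  · rw [← h0, zero_pow two_ne_zero]; positivity
  rcases hE.eq_or_lt with h1 | h1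
  · have h2 := h (2 * (V + 1) / X) (by positivity)
    rw [← h1, mul_zero, zero_add, div_div_eq_mul_div, le_div_iff₀ (by positivity)] at h2
    nlinarith
  · have h2 := h (X / (2 * E)) (by positivity)
    have e1 : X / (2 * E) * E = X / 2 := by field_simp
    have e2 : V / (X / (2 * E)) = 2 * E * V / X := by field_simp
    rw [e1, e2] at h2
    have h3 : X / 2 ≤ 2 * E * V / X := by linarith
    rw [le_div_iff₀ h0] at h3
    nlinarith

variable {k : ℕ} {Ω : TopologicalSpace.Opens (Cn k)}

theorem LocL2.integrable_mul_re {g : Cn k → ℂ} (hg : LocL2 Ω g) {φ : Cn k → ℝ}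
    (hφ : IsTest Ω φ) : Integrable (fun x => φ x * (g x).re) := by
  simpa using (hφ.integrable_mul_complex hg.locallyIntegrableOn).re

theorem LocL2.integrable_mul_im {g : Cn k → ℂ} (hg : LocL2 Ω g) {φ : Cn k → ℝ}
    (hφ : IsTest Ω φ) : Integrable (fun x => φ x * (g x).im) := by
  simpa using (hφ.integrable_mul_complex hg.locallyIntegrableOn).im

theorem LocL2.integrable_mul_norm {g : Cn k → ℂ} (hg : LocL2 Ω g) {φ : Cn k → ℝ}
    (hφ : IsTest Ω φ) (h0 : ∀ x, 0 ≤ φ x) : Integrable (fun x => φ x * ‖g x‖) := by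
  have := (hφ.integrable_mul_complex hg.locallyIntegrableOn).norm
  simpa [abs_of_nonneg (h0 _)] using this

theorem LocL2.integrable_mul_norm_sq {g : Cn k → ℂ} (hg : LocL2 Ω g) {φ : Cn k → ℝ}
    (hφ : IsTest Ω φ) : Integrable (fun x => φ x * ‖g x‖ ^ 2) := by
  refine (hφ.integrable_mul_complex (hg.locallyIntegrableOn_mul_star hg)).re.congr
    (Filter.Eventually.of_forall fun x => ?_)
  have : g x * star (g x) = ((‖g x‖ ^ 2 : ℝ) : ℂ) := by
    simpa using Complex.mul_conj' (g x)
  simp only [this, ← Complex.ofReal_mul]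
  rfl

/-- The left side is `|4 f Re(y g)| / t²`, the pairing of the gradients of the bump and of `u` in
one complex coordinate. Its square is at most `32 M P |g|² / t²`, which is four times the product of
the two terms on the right. -/
theorem pairing_le {f : ℝ} {y g : ℂ} {t M P l : ℝ} (ht : 0 < t) (hM : 0 < M)
    (hl : 0 < l) (hP : 0 ≤ P) (hf : f ^ 2 ≤ 2 * M * P) (hy : ‖y‖ ≤ t) :
    |(-2) * (f * (2 * y.re / t ^ 2) * g.re) + 2 * (f * (2 * y.im / t ^ 2) * g.im)|
      ≤ l * (P * ‖g‖ ^ 2) + 8 * M / t ^ 2 / l := by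
  refine abs_le_of_sq_le_sq ?_ (by positivity)
  have e : ((-2) * (f * (2 * y.re / t ^ 2) * g.re) + 2 * (f * (2 * y.im / t ^ 2) * g.im)) ^ 2
      = 16 * f ^ 2 * (y.re * g.re - y.im * g.im) ^ 2 / t ^ 4 := by field_simp; ring
  have h1 : (y.re * g.re - y.im * g.im) ^ 2 ≤ ‖y‖ ^ 2 * ‖g‖ ^ 2 := by
    rw [← Complex.normSq_eq_norm_sq, ← Complex.normSq_eq_norm_sq, Complex.normSq_apply,
      Complex.normSq_apply]
    nlinarith [sq_nonneg (y.re * g.im + y.im * g.re)]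
  have h2 : ‖y‖ ^ 2 ≤ t ^ 2 := pow_le_pow_left₀ (norm_nonneg _) hy 2
  have h3 : (y.re * g.re - y.im * g.im) ^ 2 ≤ t ^ 2 * ‖g‖ ^ 2 :=
    h1.trans (mul_le_mul_of_nonneg_right h2 (by positivity))
  rw [e, div_le_iff₀ (by positivity)]
  have h4 : 16 * f ^ 2 * (y.re * g.re - y.im * g.im) ^ 2
      ≤ 16 * (2 * M * P) * (t ^ 2 * ‖g‖ ^ 2) := by gcongr
  refine h4.trans ?_
  have h5 := four_mul_le_sq_add (l * (P * ‖g‖ ^ 2)) (8 * M / t ^ 2 / l)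
  have h6 : 4 * (l * (P * ‖g‖ ^ 2)) * (8 * M / t ^ 2 / l) * t ^ 4
      = 16 * (2 * M * P) * (t ^ 2 * ‖g‖ ^ 2) := by field_simp; ring
  rw [← h6]
  exact mul_le_mul_of_nonneg_right h5 (by positivity)

theorem norm_apply_le (y : Cn k) (j : Fin k) : ‖y j‖ ≤ ‖y‖ := PiLp.norm_apply_le y j

/-- The increment of the averages of `u` between two scales is controlled by that of `v`. -/
theorem exists_avg_sub_sq_le (hk : 1 ≤ k) : ∃ C : ℝ, 0 < C ∧
    ∀ (Ω : TopologicalSpace.Opens (Cn k)) (u v : Cn k → ℝ) (G : Fin k → Cn k → ℂ),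
      EnergyBound Ω u v G → ∀ (a : Cn k) (t : ℝ), 0 < t → Metric.closedBall a t ⊆ Ω →
        (avg u a t - avg u a (t / 2)) ^ 2 ≤ C * (avg v a t - avg v a (t / 2)) := by
  obtain ⟨M, hM0, hM⟩ := exists_slope_sq_le k
  set ω := (volume : Measure (Cn k)).real (Metric.ball 0 1) with hω
  have hωpos : 0 < ω := by
    rw [hω, Measure.real]
    exact ENNReal.toReal_pos (Metric.measure_ball_pos _ _ one_pos).ne' measure_ball_lt_top.ne
  have hk0 : (0 : ℝ) < k := by exact_mod_cast hk
  refine ⟨4 * (1 / (4 * Real.pi)) * (k * (8 * M * ω)), by positivity, ?_⟩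
  intro Ω u v G h a t ht hΩ
  set φ := rad (prof k) a t with hφ
  have hT : IsTest Ω φ := isTest_rad (contDiff_prof k) (fun _ h => prof_of_ge k h) ht hΩ
  have hφ0 : ∀ x, 0 ≤ φ x := fun x => prof_nonneg k _
  set X := ∫ x, lap φ x * u x with hX
  set E := ∑ j, ∫ x, φ x * ‖G j x‖ ^ 2 with hE
  have hE0 : 0 ≤ E := Finset.sum_nonneg fun j _ => integral_nonneg fun x =>
    mul_nonneg (hφ0 x) (by positivity)
  -- The error term of `pairing_le` integrated over the ball of radius `t`, once for each of the `k`
  -- coordinates.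
  set V := k * (8 * M / t ^ 2 * (t ^ (2 * k) * ω)) with hV
  have key : |X| ^ 2 ≤ 4 * E * V := by
    refine sq_le_of_forall_le (abs_nonneg _) hE0 (by positivity) fun l hl => ?_
    -- Integration by parts: one of the two derivatives in `Δφ` is moved onto `u`.
    have h1 : X = ∑ j, ∫ x, ((-2) * (lineDeriv ℝ φ x (basisVec j) * (G j x).re)
        + 2 * (lineDeriv ℝ φ x (Complex.I • basisVec j) * (G j x).im)) := by
      rw [hX, integral_lap_mul h.contU hT]
      refine Finset.sum_congr rfl fun j _ => ?_
      have hT1 := hT.lineDeriv (basisVec j)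
      have hT2 := hT.lineDeriv (Complex.I • basisVec j)
      rw [integral_add (((h.locL2 j).integrable_mul_re hT1).const_mul _)
        (((h.locL2 j).integrable_mul_im hT2).const_mul _), integral_const_mul, integral_const_mul,
        ← h.re _ hT1, ← h.im _ hT2]
      simp only [add_mul]
      exact integral_add ((hT1.lineDeriv _).integrable_mul_of_continuousOn h.contU)
        ((hT2.lineDeriv _).integrable_mul_of_continuousOn h.contU)
    have h2 : ∀ j, |∫ x, ((-2) * (lineDeriv ℝ φ x (basisVec j) * (G j x).re)
        + 2 * (lineDeriv ℝ φ x (Complex.I • basisVec j) * (G j x).im))|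
        ≤ l * (∫ x, φ x * ‖G j x‖ ^ 2) + (8 * M / t ^ 2 * (t ^ (2 * k) * ω)) / l := fun j => by
      have i1 := ((h.locL2 j).integrable_mul_norm_sq hT).const_mul l
      have i2 : Integrable ((Metric.closedBall a t).indicator fun _ => 8 * M / t ^ 2 / l)
          (volume : Measure (Cn k)) :=
        (integrable_indicator_iff Metric.isClosed_closedBall.measurableSet).2
          (integrableOn_const measure_closedBall_lt_top.ne)
      have i3 : ∫ x, (Metric.closedBall a t).indicator (fun _ => 8 * M / t ^ 2 / l) x
          = (8 * M / t ^ 2 * (t ^ (2 * k) * ω)) / l := by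
        rw [integral_indicator Metric.isClosed_closedBall.measurableSet, setIntegral_const,
          Measure.addHaar_real_closedBall _ _ ht.le, finrank_Cn, smul_eq_mul]
        ring
      rw [← integral_const_mul, ← i3, ← integral_add i1 i2]
      refine abs_integral_le_integral_abs.trans (integral_mono_of_nonneg
        (Filter.Eventually.of_forall fun x => abs_nonneg _) (i1.add i2)
        (Filter.Eventually.of_forall fun x => ?_))
      simp only [hφ, lineDeriv_rad (hasDerivAt_prof k), inner_basisVec_re, inner_I_basisVec_re]
      by_cases hx : ‖x - a‖ ≤ t
      · rw [Set.indicator_of_mem (by rwa [Metric.mem_closedBall, dist_eq_norm])]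
        refine pairing_le ht hM0 hl (hφ0 x) ?_ ((norm_apply_le _ j).trans hx)
        rw [rad, neg_sq]
        exact hM _ (by positivity)
      · push Not at hx
        have e1 : rad (fun s => -slope k s) a t x = 0 :=
          rad_eq_zero (fun s hs => by rw [slope_of_ge k hs, neg_zero]) ht hx.le
        have e2 : rad (prof k) a t x = 0 := rad_eq_zero (fun _ h => prof_of_ge k h) ht hx.le
        rw [e1, e2, Set.indicator_of_notMem
          (by rwa [Metric.mem_closedBall, dist_eq_norm, not_le])]
        simp
    rw [h1]
    refine (Finset.abs_sum_le_sum_abs _ _).trans ((Finset.sum_le_sum fun j _ => h2 j).trans ?_)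
    rw [Finset.sum_add_distrib, ← Finset.mul_sum, Finset.sum_const, Finset.card_univ,
      Fintype.card_fin, nsmul_eq_mul, hV, hE, mul_div_assoc (k : ℝ)]
  have hE1 := h.energy φ hT hφ0
  rw [integral_lap_rad_prof_mul h.contV ht hΩ, ← hE] at hE1
  rw [sq_abs, hX, integral_lap_rad_prof_mul h.contU ht hΩ] at key
  set dA := avg u a t - avg u a (t / 2)
  set dB := avg v a t - avg v a (t / 2)
  set T := (t ^ 2)⁻¹ * t ^ (2 * k) with hTT
  have hTpos : 0 < T := by positivity
  have h5 : (T * dA) ^ 2 ≤ 4 * (1 / (4 * Real.pi) * (T * dB)) * V :=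
    key.trans (by gcongr)
  -- Both `E` and `V` scale like `T = t^(2k-2)` and `X` equals `T` times the increment, so the power
  -- of `t` cancels.
  have h6 : V = T * (k * (8 * M * ω)) := by rw [hV, hTT]; field_simp
  rw [h6] at h5
  have h7 : T ^ 2 * dA ^ 2 ≤ T ^ 2 * (4 * (1 / (4 * Real.pi)) * (k * (8 * M * ω)) * dB) := by
    linarith
  exact le_of_mul_le_mul_left h7 (by positivity)

/-! ### Averages of `u` at two points -/

/-- A Caccioppoli-type bound. The kernel at scale `t` lies below a multiple of the bump at scale
`4t`, whose energy is at most the increment of the averages of `v` between `4t` and `2t`. Both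
averages are within `mass k * M` of `mass k * v a`. -/
theorem exists_energy_le (hk : 1 ≤ k) : ∃ C : ℝ, 0 < C ∧
    ∀ (Ω : TopologicalSpace.Opens (Cn k)) (u v : Cn k → ℝ) (G : Fin k → Cn k → ℂ),
      EnergyBound Ω u v G → ∀ (a : Cn k) (t M : ℝ), 0 < t → Metric.closedBall a (4 * t) ⊆ Ω →
        (∀ x, ‖x - a‖ ≤ 4 * t → |v x - v a| ≤ M) →
        ∑ j, ∫ x, rad (dens k) a t x * ‖G j x‖ ^ 2 ≤ C * (t ^ 2)⁻¹ * t ^ (2 * k) * M := by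
  obtain ⟨D, hD0, hD⟩ := exists_bound_of_compact (contDiff_dens k).continuous
  have hp := prof_eighth_pos k
  have hm := mass_pos hk
  refine ⟨D / prof k (1 / 8) * (1 / (4 * Real.pi)) * (16⁻¹ * 4 ^ (2 * k)) * (2 * mass k),
    by positivity, ?_⟩
  intro Ω u v G h a t M ht hΩ hM
  have h4t : 0 < 4 * t := by linarith
  have hT := isTest_rad (contDiff_prof k) (fun _ h => prof_of_ge k h) h4t hΩ
  have hT1 := isTest_rad (contDiff_dens k) (fun _ h => dens_of_ge k h) ht
    ((Metric.closedBall_subset_closedBall (by linarith)).trans hΩ)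
  have h1 : ∑ j, ∫ x, rad (dens k) a t x * ‖G j x‖ ^ 2
      ≤ D / prof k (1 / 8) * ∑ j, ∫ x, rad (prof k) a (4 * t) x * ‖G j x‖ ^ 2 := by
    rw [Finset.mul_sum]
    refine Finset.sum_le_sum fun j _ => ?_
    rw [← integral_const_mul]
    refine integral_mono ((h.locL2 j).integrable_mul_norm_sq hT1)
      (((h.locL2 j).integrable_mul_norm_sq hT).const_mul _) fun x => ?_
    simp only
    rw [← mul_assoc]
    refine mul_le_mul_of_nonneg_right ?_ (by positivity)
    by_cases hx : t ≤ ‖x - a‖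
    · rw [rad_eq_zero (fun _ h => dens_of_ge k h) ht hx]
      exact mul_nonneg (by positivity) (prof_nonneg k _)
    · push Not at hx
      have hs : ‖x - a‖ ^ 2 / t ^ 2 ≤ 1 := by
        rw [div_le_one (by positivity)]
        exact pow_le_pow_left₀ (norm_nonneg _) hx.le 2
      have e1 : rad (dens k) a t x ≤ D := (le_abs_self _).trans (hD _ (by positivity) hs)
      -- At scale `4t` the profile variable is at most `1/16` on the ball of radius `t`.
      have e2 : prof k (1 / 8) ≤ rad (prof k) a (4 * t) x := by
        refine prof_eighth_le k ?_
        rw [mul_pow, mul_comm, ← div_div]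
        linarith
      calc rad (dens k) a t x ≤ D := e1
        _ = D / prof k (1 / 8) * prof k (1 / 8) := by field_simp
        _ ≤ _ := by gcongr
  have h2 := h.energy _ hT (fun x => prof_nonneg k _)
  rw [integral_lap_rad_prof_mul h.contV h4t hΩ] at h2
  have b1 := avg_sub_const_le h.contV h4t hΩ hM
  have b2 := avg_sub_const_le h.contV (half_pos h4t)
    ((Metric.closedBall_subset_closedBall (by linarith)).trans hΩ)
    (fun x hx => hM x (by linarith))
  have h3 : avg v a (4 * t) - avg v a (4 * t / 2) ≤ 2 * mass k * M := by
    have := abs_le.1 b1; have := abs_le.1 b2; linarith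
  refine h1.trans ?_
  calc _ ≤ D / prof k (1 / 8) * (1 / (4 * Real.pi) * (((4 * t) ^ 2)⁻¹ * (4 * t) ^ (2 * k)
        * (2 * mass k * M))) := by
        refine mul_le_mul_of_nonneg_left (h2.trans ?_) (by positivity)
        gcongr
    _ = _ := by rw [mul_pow, mul_pow, mul_inv]; norm_num; ring

theorem lineDeriv_rad_eq_sum {f f' : ℝ → ℝ} (hf : ∀ s, HasDerivAt f (f' s) s) (a : Cn k) (t : ℝ)
    (x w : Cn k) : lineDeriv ℝ (rad f a t) x w
      = ∑ j, ((w j).re * lineDeriv ℝ (rad f a t) x (basisVec j)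
        + (w j).im * lineDeriv ℝ (rad f a t) x (Complex.I • basisVec j)) := by
  simp only [lineDeriv_rad hf, inner_basisVec_re, inner_I_basisVec_re]
  have : (inner ℂ (x - a) w).re
      = ∑ j, ((w j).re * ((x - a) j).re + (w j).im * ((x - a) j).im) := by
    rw [PiLp.inner_apply, Complex.re_sum]
    refine Finset.sum_congr rfl fun j _ => ?_
    simp
    ring
  rw [this, Finset.mul_sum, Finset.sum_div, Finset.mul_sum]
  refine Finset.sum_congr rfl fun j _ => ?_
  ring

/-- The derivative of the averages of `u` with respect to the centre. -/
theorem hasFDerivAt_avg {u : Cn k → ℝ} {c : Cn k} {R t : ℝ} (ht : 0 < t)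
    (hu : ContinuousOn u (Metric.closedBall c (R + t))) :
    ∃ L : Cn k → (Cn k →L[ℝ] ℝ), ∃ Φ : Cn k → ℝ, (∀ x, HasFDerivAt Φ (L x) x) ∧
      ∀ x ∈ Metric.closedBall c R, Φ x = ∫ z, rad (dens k) x t z * u z ∧
        ∀ w, L x w = -∫ z, lineDeriv ℝ (rad (dens k) x t) z w * u z := by
  -- For centres within `R` of `c` the kernel only sees `K`, so `u` may be replaced by its extension
  -- by zero outside `K`. The averages become a convolution of an integrable function with a smooth
  -- compactly supported kernel.
  set K := Metric.closedBall c (R + t)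
  set g : Cn k → ℝ := rad (dens k) 0 t
  have hg : ContDiff ℝ ((⊤ : ℕ∞) : WithTop ℕ∞) g := contDiff_rad (contDiff_dens k) _ _
  have hgc : HasCompactSupport g := hasCompactSupport_rad (fun _ h => dens_of_ge k h) _ ht
  have hui : Integrable (K.indicator u) :=
    (integrable_indicator_iff Metric.isClosed_closedBall.measurableSet).2
      (hu.integrableOn_compact (isCompact_closedBall _ _))
  have hd : ∀ s, HasDerivAt (dens k) (deriv (dens k) s) s := fun s =>
    ((contDiff_dens k).differentiable (by simp) s).hasDerivAt
  have hd0 : ∀ s, 1 ≤ s → deriv (dens k) s = 0 := by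
    have hc : IsClosed {x | deriv (dens k) x = 0} :=
      isClosed_eq ((contDiff_infty_iff_deriv.1 (contDiff_dens k)).2).continuous continuous_const
    have : Set.Ici (1 : ℝ) ⊆ {x | deriv (dens k) x = 0} := by
      rw [← closure_Ioi]
      refine closure_minimal (fun x hx => ?_) hc
      have : dens k =ᶠ[nhds x] fun _ => 0 := by
        filter_upwards [Ioi_mem_nhds hx] with y hy using dens_of_ge k (le_of_lt hy)
      rw [Set.mem_ofPred_eq, this.deriv_eq]; simp
    exact fun s hs => this hs
  have hsub : ∀ x ∈ Metric.closedBall c R, ∀ z, z ∉ K → t ≤ ‖z - x‖ := fun x hx z hz => by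
    by_contra hlt
    push Not at hlt
    rw [Metric.mem_closedBall] at hx
    refine hz (Metric.mem_closedBall.2 ?_)
    have := dist_triangle z x c
    rw [dist_eq_norm z x] at this
    linarith
  refine ⟨fun x => convolution (K.indicator u) (fderiv ℝ g)
    (ContinuousLinearMap.precompR (Cn k) (ContinuousLinearMap.mul ℝ ℝ)) volume x,
    convolution (K.indicator u) g (ContinuousLinearMap.mul ℝ ℝ) volume,
    fun x => hgc.hasFDerivAt_convolution_right _ hui.locallyIntegrable (hg.of_le (by simp)) x,
    fun x hx => ⟨?_, fun w => ?_⟩⟩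
  · rw [convolution_def]
    congr 1 with z
    simp only [ContinuousLinearMap.mul_apply']
    have e : g (x - z) = rad (dens k) x t z := by
      simp only [g, rad, sub_zero, norm_sub_rev x z]
    rw [e, mul_comm]
    by_cases hz : z ∈ K
    · rw [Set.indicator_of_mem hz]
    · rw [rad_eq_zero (fun _ h => dens_of_ge k h) ht (hsub x hx z hz)]; simp
  · have hint : ConvolutionExistsAt (K.indicator u) (fderiv ℝ g) x
        (ContinuousLinearMap.precompR (Cn k) (ContinuousLinearMap.mul ℝ ℝ)) volume :=
      (hgc.fderiv ℝ).convolutionExists_right _ hui.locallyIntegrable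
        (hg.continuous_fderiv (by simp)) x
    simp only
    rw [convolution_def, ContinuousLinearMap.integral_apply hint, ← integral_neg]
    congr 1 with z
    -- Differentiating in the centre is minus differentiating in the variable, since the kernel
    -- depends only on `|z - x|`.
    have e : fderiv ℝ g (x - z) w = -lineDeriv ℝ (rad (dens k) x t) z w := by
      rw [← (hg.differentiable (by simp) _).lineDeriv_eq_fderiv, lineDeriv_rad hd,
        lineDeriv_rad hd, sub_zero, ← neg_sub z x, inner_neg_left]
      have e' : rad (deriv (dens k)) 0 t (-(z - x)) = rad (deriv (dens k)) x t z := by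
        simp only [rad, sub_zero, norm_neg]
      rw [e', Complex.neg_re]
      ring
    change K.indicator u z * fderiv ℝ g (x - z) w = _
    rw [e]
    by_cases hz : z ∈ K
    · rw [Set.indicator_of_mem hz]; ring
    · rw [lineDeriv_rad hd, rad_eq_zero hd0 ht (hsub x hx z hz)]; simp

/-- The averages of `u` at a fixed scale are Lipschitz. -/
theorem exists_avg_sub_avg_sq_le (hk : 1 ≤ k) : ∃ C : ℝ, 0 < C ∧
    ∀ (Ω : TopologicalSpace.Opens (Cn k)) (u v : Cn k → ℝ) (G : Fin k → Cn k → ℂ),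
      EnergyBound Ω u v G → ∀ (c : Cn k) (R t M : ℝ), 0 < t →
        Metric.closedBall c (R + 4 * t) ⊆ Ω →
        (∀ x ∈ Metric.closedBall c R, ∀ z, ‖z - x‖ ≤ 4 * t → |v z - v x| ≤ M) →
        ∀ a ∈ Metric.closedBall c R, ∀ b ∈ Metric.closedBall c R,
          (avg u a t - avg u b t) ^ 2 ≤ C * M * ‖a - b‖ ^ 2 / t ^ 2 := by
  obtain ⟨C, hC0, hC⟩ := exists_energy_le hk
  have hm := mass_pos hk
  have hk0 : (0 : ℝ) < k := by exact_mod_cast hk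
  refine ⟨4 * (2 * C) * (2 * (k * mass k)), by positivity, ?_⟩
  intro Ω u v G h c R t M ht hΩ hM a ha b hb
  have hM0 : 0 ≤ M := (abs_nonneg _).trans (hM a ha a (by simp; linarith))
  have hcont : ContinuousOn u (Metric.closedBall c (R + t)) :=
    h.contU.mono ((Metric.closedBall_subset_closedBall (by linarith)).trans hΩ)
  obtain ⟨L, Φ, hΦ, hLΦ⟩ := hasFDerivAt_avg ht hcont
  have hd : ∀ s, HasDerivAt (dens k) (deriv (dens k) s) s := fun s =>
    ((contDiff_dens k).differentiable (by simp) s).hasDerivAt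
  set N := Real.sqrt (4 * (2 * C * (t ^ 2)⁻¹ * t ^ (2 * k) * M)
    * (2 * (k * (t ^ (2 * k) * mass k)))) with hN
  have hbound : ∀ x ∈ Metric.closedBall c R, ‖L x‖ ≤ N := fun x hx => by
    refine ContinuousLinearMap.opNorm_le_bound _ (Real.sqrt_nonneg _) fun w => ?_
    have hsub : Metric.closedBall x (4 * t) ⊆ Ω :=
      (Metric.closedBall_subset_closedBall' (by
        rw [Metric.mem_closedBall] at hx; linarith)).trans hΩ
    have hT := isTest_rad (contDiff_dens k) (fun _ h => dens_of_ge k h) ht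
      ((Metric.closedBall_subset_closedBall (by linarith)).trans hsub)
    have h0 : ∀ z, 0 ≤ rad (dens k) x t z := fun z => dens_nonneg k
    -- The derivative falls on the kernel; expanding `w` in real coordinates, the weak gradient
    -- identities move it onto `u`.
    have e1 : L x w = ∑ j, (2 * ((w j).re * ∫ z, rad (dens k) x t z * (G j z).re)
        - 2 * ((w j).im * ∫ z, rad (dens k) x t z * (G j z).im)) := by
      rw [(hLΦ x hx).2 w]
      simp only [lineDeriv_rad_eq_sum hd x t _ w, Finset.sum_mul]
      rw [integral_finsetSum, ← Finset.sum_neg_distrib]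
      · refine Finset.sum_congr rfl fun j _ => ?_
        have i1 := ((hT.lineDeriv (basisVec j)).integrable_mul_of_continuousOn
          h.contU).const_mul (w j).re
        have i2 := ((hT.lineDeriv (Complex.I • basisVec j)).integrable_mul_of_continuousOn
          h.contU).const_mul (w j).im
        simp only [add_mul, mul_assoc]
        rw [integral_add i1 i2, integral_const_mul, integral_const_mul, h.re _ hT, h.im _ hT]
        ring
      · intro j _
        have i1 := ((hT.lineDeriv (basisVec j)).integrable_mul_of_continuousOn
          h.contU).const_mul (w j).re
        have i2 := ((hT.lineDeriv (Complex.I • basisVec j)).integrable_mul_of_continuousOn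
          h.contU).const_mul (w j).im
        simp only [add_mul, mul_assoc]
        exact i1.add i2
    have e2 : |L x w| ≤ ‖w‖ * (4 * ∑ j, ∫ z, rad (dens k) x t z * ‖G j z‖) := by
      rw [e1, Finset.mul_sum, Finset.mul_sum]
      refine (Finset.abs_sum_le_sum_abs _ _).trans (Finset.sum_le_sum fun j _ => ?_)
      have hi := (h.locL2 j).integrable_mul_norm hT h0
      have j1 : |∫ z, rad (dens k) x t z * (G j z).re|
          ≤ ∫ z, rad (dens k) x t z * ‖G j z‖ :=
        abs_integral_le_integral_abs.trans (integral_mono_of_nonneg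
          (Filter.Eventually.of_forall fun z => abs_nonneg _) hi
          (Filter.Eventually.of_forall fun z => by
            simp only [abs_mul, abs_of_nonneg (h0 z)]
            exact mul_le_mul_of_nonneg_left (Complex.abs_re_le_norm _) (h0 z)))
      have j2 : |∫ z, rad (dens k) x t z * (G j z).im|
          ≤ ∫ z, rad (dens k) x t z * ‖G j z‖ :=
        abs_integral_le_integral_abs.trans (integral_mono_of_nonneg
          (Filter.Eventually.of_forall fun z => abs_nonneg _) hi
          (Filter.Eventually.of_forall fun z => by
            simp only [abs_mul, abs_of_nonneg (h0 z)]
            exact mul_le_mul_of_nonneg_left (Complex.abs_im_le_norm _) (h0 z)))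
      have w1 : |(w j).re| ≤ ‖w‖ := (Complex.abs_re_le_norm _).trans (norm_apply_le w j)
      have w2 : |(w j).im| ≤ ‖w‖ := (Complex.abs_im_le_norm _).trans (norm_apply_le w j)
      have q1 := mul_le_mul w1 j1 (abs_nonneg _) (norm_nonneg w)
      have q2 := mul_le_mul w2 j2 (abs_nonneg _) (norm_nonneg w)
      rw [← abs_mul] at q1 q2
      have := abs_sub (2 * ((w j).re * ∫ z, rad (dens k) x t z * (G j z).re))
        (2 * ((w j).im * ∫ z, rad (dens k) x t z * (G j z).im))
      rw [abs_mul 2, abs_mul 2, abs_two] at this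
      linarith
    -- Cauchy-Schwarz against the kernel: its mass `t^(2k) * mass k` times the energy bound, again
    -- through `sq_le_of_forall_le`.
    have e3 : (4 * ∑ j, ∫ z, rad (dens k) x t z * ‖G j z‖) ^ 2
        ≤ 4 * (2 * C * (t ^ 2)⁻¹ * t ^ (2 * k) * M) * (2 * (k * (t ^ (2 * k) * mass k))) := by
      refine sq_le_of_forall_le (mul_nonneg (by norm_num) (Finset.sum_nonneg fun j _ =>
        integral_nonneg fun z => mul_nonneg (h0 z) (norm_nonneg _))) (by positivity)
        (by positivity) fun l hl => ?_
      have hen := hC Ω u v G h x t M ht hsub (hM x hx)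
      have s1 : ∀ j, ∫ z, rad (dens k) x t z * ‖G j z‖ ≤ l / 2 *
          (∫ z, rad (dens k) x t z * ‖G j z‖ ^ 2) + (t ^ (2 * k) * mass k) / (2 * l) := fun j => by
        have i2 := ((h.locL2 j).integrable_mul_norm_sq hT).const_mul (l / 2)
        have i3 := (integrable_rad_dens x ht).div_const (2 * l)
        rw [← integral_rad_dens x ht, ← integral_const_mul, ← integral_div,
          ← integral_add i2 i3]
        refine integral_mono ((h.locL2 j).integrable_mul_norm hT h0) (i2.add i3) fun z => ?_
        have : ‖G j z‖ ≤ l / 2 * ‖G j z‖ ^ 2 + 1 / (2 * l) := by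
          have := sq_nonneg (l * ‖G j z‖ - 1)
          have e : l / 2 * ‖G j z‖ ^ 2 + 1 / (2 * l) - ‖G j z‖
              = (l * ‖G j z‖ - 1) ^ 2 / (2 * l) := by field_simp; ring
          have : 0 ≤ (l * ‖G j z‖ - 1) ^ 2 / (2 * l) := by positivity
          linarith
        have := mul_le_mul_of_nonneg_left this (h0 z)
        simp only
        calc _ ≤ _ := this
          _ = _ := by ring
      have s2 := Finset.sum_le_sum fun j (_ : j ∈ Finset.univ) => s1 j
      rw [Finset.sum_add_distrib, ← Finset.mul_sum, Finset.sum_const, Finset.card_univ,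
        Fintype.card_fin, nsmul_eq_mul] at s2
      have s3 := mul_le_mul_of_nonneg_left hen hl.le
      have e : 2 * (k * (t ^ (2 * k) * mass k)) / l
          = 4 * (k * (t ^ (2 * k) * mass k / (2 * l))) := by field_simp; ring
      rw [e]
      linarith
    rw [Real.norm_eq_abs, mul_comm N]
    exact e2.trans (mul_le_mul_of_nonneg_left (Real.le_sqrt_of_sq_le e3) (norm_nonneg _))
  -- The mean value inequality on the convex ball turns the gradient bound into a Lipschitz bound.
  have hmv := (convex_closedBall c R).norm_image_sub_le_of_norm_hasFDerivWithin_le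
    (fun x _ => (hΦ x).hasFDerivWithinAt) hbound hb ha
  rw [(hLΦ a ha).1, (hLΦ b hb).1, Real.norm_eq_abs] at hmv
  have h5 := pow_le_pow_left₀ (abs_nonneg _) hmv 2
  rw [sq_abs, mul_pow, Real.sq_sqrt (by positivity)] at h5
  rw [avg, avg, ← mul_sub, mul_pow]
  refine (mul_le_mul_of_nonneg_left h5 (by positivity)).trans_eq ?_
  have e1 : t⁻¹ ^ (2 * k) * t ^ (2 * k) = 1 := by rw [← mul_pow, inv_mul_cancel₀ ht.ne', one_pow]
  calc _ = (t⁻¹ ^ (2 * k) * t ^ (2 * k)) ^ 2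
        * (4 * (2 * C) * (2 * (k * mass k)) * M * ‖a - b‖ ^ 2 / t ^ 2) := by
        field_simp
    _ = _ := by rw [e1]; ring

end

section

/-! ### Summation over dyadic scales -/

/-- Abel summation. -/
theorem sum_weight_mul_sub (w b : ℕ → ℝ) (J : ℕ) :
    ∑ j ∈ Finset.range J, w j * (b j - b (j + 1))
      = w 0 * b 0 - w J * b J + ∑ j ∈ Finset.range J, (w (j + 1) - w j) * b (j + 1) := by
  induction J with
  | zero => simp
  | succ J ih => rw [Finset.sum_range_succ, Finset.sum_range_succ, ih]; ring

/-- A weighted Cauchy-Schwarz estimate for telescoping sums. -/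
theorem sub_sq_le_of_weights {a b w β : ℕ → ℝ} {C S W : ℝ} (hC : 0 ≤ C)
    (hab : ∀ j, (a j - a (j + 1)) ^ 2 ≤ C * (b j - b (j + 1)))
    (hb0 : ∀ j, 0 ≤ b j) (hb : ∀ j, b j ≤ β j) (hw : ∀ j, 0 < w j) (hmono : Monotone w)
    (hS : ∀ J, ∑ j ∈ Finset.range J, 1 / w j ≤ S)
    (hW : ∀ J, w 0 * β 0 + ∑ j ∈ Finset.range J, (w (j + 1) - w j) * β (j + 1) ≤ W) (J : ℕ) :
    (a 0 - a J) ^ 2 ≤ C * S * W := by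
  have h1 : a 0 - a J = ∑ j ∈ Finset.range J, (a j - a (j + 1)) :=
    (Finset.sum_range_sub' a J).symm
  have h2 : (∑ j ∈ Finset.range J, (a j - a (j + 1))) ^ 2
      ≤ (∑ j ∈ Finset.range J, 1 / w j) * ∑ j ∈ Finset.range J, w j * (a j - a (j + 1)) ^ 2 := by
    refine Finset.sum_sq_le_sum_mul_sum_of_sq_le_mul _ (fun j _ => by have := hw j; positivity)
      (fun j _ => by have := hw j; positivity) fun j _ => ?_
    have := (hw j).ne'
    refine le_of_eq ?_
    field_simp
  have h3 : ∑ j ∈ Finset.range J, w j * (a j - a (j + 1)) ^ 2 ≤ C * W := by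
    calc _ ≤ ∑ j ∈ Finset.range J, C * (w j * (b j - b (j + 1))) :=
          Finset.sum_le_sum fun j _ => by
            have := mul_le_mul_of_nonneg_left (hab j) (hw j).le
            linarith
      _ = C * ∑ j ∈ Finset.range J, w j * (b j - b (j + 1)) := by rw [Finset.mul_sum]
      _ ≤ C * W := by
          refine mul_le_mul_of_nonneg_left ?_ hC
          refine le_trans ?_ (hW J)
          -- The boundary term `-w_J b_J` is nonpositive and is dropped. Monotonicity of `w` makes
          -- the remaining coefficients nonnegative, so `b` may be replaced by its majorant `β`.
          rw [sum_weight_mul_sub]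
          have e1 := mul_nonneg (hw J).le (hb0 J)
          have e2 := mul_le_mul_of_nonneg_left (hb 0) (hw 0).le
          have e3 : ∑ j ∈ Finset.range J, (w (j + 1) - w j) * b (j + 1)
              ≤ ∑ j ∈ Finset.range J, (w (j + 1) - w j) * β (j + 1) :=
            Finset.sum_le_sum fun j _ => mul_le_mul_of_nonneg_left (hb _)
              (sub_nonneg.2 (hmono (Nat.le_succ j)))
          linarith
  rw [h1]
  have h4 : 0 ≤ ∑ j ∈ Finset.range J, w j * (a j - a (j + 1)) ^ 2 :=
    Finset.sum_nonneg fun j _ => by have := hw j; positivity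
  calc _ ≤ _ := h2
    _ ≤ S * ∑ j ∈ Finset.range J, w j * (a j - a (j + 1)) ^ 2 :=
      mul_le_mul_of_nonneg_right (hS J) h4
    _ ≤ S * (C * W) := mul_le_mul_of_nonneg_left h3 (by simpa using hS 0)
    _ = _ := by ring

variable {k : ℕ}

theorem tendsto_avg {Ω : TopologicalSpace.Opens (Cn k)} {v : Cn k → ℝ} (hk : 1 ≤ k)
    (hv : ContinuousOn v Ω) {a : Cn k} {t : ℝ} (ht : 0 < t) (hΩ : Metric.closedBall a t ⊆ Ω) :
    Filter.Tendsto (fun j : ℕ => avg v a (t / 2 ^ j)) Filter.atTop (nhds (mass k * v a)) := by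
  have hm := mass_pos hk
  have hva : ContinuousAt v a := hv.continuousAt
    (Ω.isOpen.mem_nhds (hΩ (Metric.mem_closedBall_self ht.le)))
  have ht0 : Filter.Tendsto (fun j : ℕ => t / 2 ^ j) Filter.atTop (nhds 0) :=
    tendsto_const_nhds.div_atTop (tendsto_pow_atTop_atTop_of_one_lt one_lt_two)
  rw [Metric.tendsto_atTop]
  intro ε hε
  obtain ⟨δ, hδ, h⟩ := Metric.continuousAt_iff.1 hva (ε / (2 * mass k)) (by positivity)
  obtain ⟨N, hN⟩ := Filter.eventually_atTop.1 (ht0.eventually_lt_const hδ)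
  refine ⟨N, fun j hj => ?_⟩
  have hpos : 0 < t / 2 ^ j := by positivity
  have hle : t / 2 ^ j ≤ t := div_le_self ht.le (one_le_pow₀ one_le_two)
  have := avg_sub_const_le hv hpos ((Metric.closedBall_subset_closedBall hle).trans hΩ)
    (M := ε / (2 * mass k)) (c := v a) fun x hx => by
      have := h (x := x) (by rw [dist_eq_norm]; exact hx.trans_lt (hN j hj))
      rw [Real.dist_eq] at this
      exact this.le
  rw [Real.dist_eq]
  have e : mass k * (ε / (2 * mass k)) = ε / 2 := by field_simp
  rw [e] at this
  linarith

/-- The distance of `u a` to an average of `u` around `a`, in terms of the modulus of continuity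
of `v` at the dyadic scales and of auxiliary weights. -/
theorem exists_avg_sub_self_sq_le (hk : 1 ≤ k) : ∃ C : ℝ, 0 < C ∧
    ∀ (Ω : TopologicalSpace.Opens (Cn k)) (u v : Cn k → ℝ) (G : Fin k → Cn k → ℂ),
      EnergyBound Ω u v G → ∀ (a : Cn k) (t : ℝ), 0 < t → Metric.closedBall a t ⊆ Ω →
        ∀ (β w : ℕ → ℝ) (S W : ℝ),
        (∀ j, ∀ x, ‖x - a‖ ≤ t / 2 ^ j → |v x - v a| ≤ β j) →
        (∀ j, 0 < w j) → Monotone w → (∀ J, ∑ j ∈ Finset.range J, 1 / w j ≤ S) →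
        (∀ J, w 0 * β 0 + ∑ j ∈ Finset.range J, (w (j + 1) - w j) * β (j + 1) ≤ W) →
        (avg u a t - mass k * u a) ^ 2 ≤ C * S * W := by
  obtain ⟨C, hC0, hC⟩ := exists_avg_sub_sq_le hk
  have hm := mass_pos hk
  refine ⟨C * mass k, by positivity, ?_⟩
  intro Ω u v G h a t ht hΩ β w S W hβ hw hmono hS hW
  have hpos : ∀ j : ℕ, 0 < t / 2 ^ j := fun j => by positivity
  have hsub : ∀ j : ℕ, Metric.closedBall a (t / 2 ^ j) ⊆ Ω := fun j =>
    (Metric.closedBall_subset_closedBall (div_le_self ht.le (one_le_pow₀ one_le_two))).trans hΩ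
  have hhalf : ∀ j : ℕ, t / 2 ^ j / 2 = t / 2 ^ (j + 1) := fun j => by rw [pow_succ]; field_simp
  set A : ℕ → ℝ := fun j => avg u a (t / 2 ^ j) with hA
  set B : ℕ → ℝ := fun j => avg v a (t / 2 ^ j) - mass k * v a with hB
  have hAB : ∀ j, (A j - A (j + 1)) ^ 2 ≤ C * (B j - B (j + 1)) := fun j => by
    have := hC Ω u v G h a _ (hpos j) (hsub j)
    rw [hhalf] at this
    simpa [hA, hB] using this
  -- The averages of `v` decrease with the scale because each increment dominates a square; their
  -- limit at the point is `mass k * v a`, so the deviations `B` are nonnegative.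
  have hanti : Antitone B := antitone_nat_of_succ_le fun j => by
    have h1 := (sq_nonneg _).trans (hAB j)
    have := nonneg_of_mul_nonneg_right h1 hC0
    linarith
  have hB0 : ∀ j, 0 ≤ B j := fun j => by
    refine hanti.le_of_tendsto ?_ j
    simpa [hB] using (tendsto_avg hk h.contV ht hΩ).sub_const (mass k * v a)
  have hBβ : ∀ j, B j ≤ mass k * β j := fun j =>
    (le_abs_self _).trans (avg_sub_const_le h.contV (hpos j) (hsub j) (hβ j))
  have key := sub_sq_le_of_weights hC0.le hAB hB0 hBβ hw hmono hS (W := mass k * W) fun J => by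
    have := mul_le_mul_of_nonneg_left (hW J) hm.le
    refine le_of_eq_of_le ?_ this
    rw [mul_add, Finset.mul_sum]
    congr 1
    · ring
    · exact Finset.sum_congr rfl fun j _ => by ring
  have hlim : Filter.Tendsto (fun J => (A 0 - A J) ^ 2) Filter.atTop
      (nhds ((A 0 - mass k * u a) ^ 2)) :=
    (tendsto_const_nhds.sub (tendsto_avg hk h.contU ht hΩ)).pow 2
  have := le_of_tendsto' hlim key
  simp only [hA, pow_zero, div_one] at this
  linarith

/-! ### Weights -/

theorem logStar_of_le {t : ℝ} (h0 : 0 < t) (h : t ≤ 1) : logStar t = 1 - Real.log t := by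
  rw [logStar, abs_of_nonpos (Real.log_nonpos h0.le h)]; ring

theorem logStar_anti {s t : ℝ} (h0 : 0 < s) (hst : s ≤ t) (h : t ≤ 1) :
    logStar t ≤ logStar s := by
  rw [logStar_of_le h0 (hst.trans h), logStar_of_le (h0.trans_le hst) h]
  linarith [Real.log_le_log h0 hst]

theorem one_le_logStar (t : ℝ) : 1 ≤ logStar t := by
  rw [logStar]; linarith [abs_nonneg (Real.log t)]

theorem logStar_half {t : ℝ} (h0 : 0 < t) (h : t ≤ 1) :
    logStar (t / 2) = logStar t + Real.log 2 := by
  rw [logStar_of_le h0 h, logStar_of_le (by linarith) (by linarith),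
    Real.log_div h0.ne' two_ne_zero]; ring

/-- Along dyadic scales `log⋆` is an arithmetic progression with step `log 2`; the weights are
functions of this progression. -/
theorem logStar_div_two_pow {t : ℝ} (h0 : 0 < t) (h : t ≤ 1) (j : ℕ) :
    logStar (t / 2 ^ (j + 1)) = logStar (t / 2 ^ j) + Real.log 2 := by
  rw [pow_succ, ← div_div]
  exact logStar_half (by positivity) ((div_le_self h0.le (one_le_pow₀ one_le_two)).trans h)

theorem log_two_pos : 0 < Real.log 2 := Real.log_pos one_lt_two

theorem le_logStar {t : ℝ} (h0 : 0 < t) (h : t ≤ 1 / 2) : 1 + Real.log 2 ≤ logStar t := by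
  have : logStar (1 / 2) = 1 + Real.log 2 := by
    rw [logStar_of_le (by norm_num) (by norm_num), one_div, Real.log_inv]; ring
  rw [← this]
  exact logStar_anti h0 h (by norm_num)

/-- The step of the weight `x (log x)²`. -/
theorem mul_log_sq_sub_le {x : ℝ} (hx : 1 + Real.log 2 ≤ x) :
    (x + Real.log 2) * Real.log (x + Real.log 2) ^ 2 - x * Real.log x ^ 2
      ≤ 4 * Real.log 2 * (1 + 2 / Real.log (1 + Real.log 2)) * Real.log x ^ 2 := by
  have h2 := log_two_pos
  set h := Real.log 2
  have hx0 : 0 < x := by linarith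
  have hl : 0 < Real.log (1 + h) := Real.log_pos (by linarith)
  set l := Real.log (1 + h)
  have hlx : l ≤ Real.log x := Real.log_le_log (by linarith) hx
  have hly : Real.log x ≤ Real.log (x + h) := Real.log_le_log hx0 (by linarith)
  have hd : x * (Real.log (x + h) - Real.log x) ≤ h := by
    rw [← Real.log_div (by linarith) hx0.ne']
    have := Real.log_le_sub_one_of_pos (show 0 < (x + h) / x by positivity)
    have e : (x + h) / x - 1 = h / x := by field_simp; ring
    rw [e, le_div_iff₀ hx0] at this
    linarith
  -- Since `x ≥ 1 + h`, one has `x + h ≤ x²`, so one step at most doubles the logarithm.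
  have h2l : Real.log (x + h) ≤ 2 * Real.log x := by
    have : x + h ≤ x ^ 2 := by nlinarith
    have := Real.log_le_log (by linarith) this
    rwa [Real.log_pow, Nat.cast_ofNat] at this
  set y := Real.log (x + h)
  set z := Real.log x
  have e : (x + h) * y ^ 2 - x * z ^ 2 = h * y ^ 2 + x * (y - z) * (y + z) := by ring
  rw [e]
  have e1 : x * (y - z) * (y + z) ≤ h * (2 * y) :=
    mul_le_mul hd (by linarith) (by linarith) h2.le
  have e2 : y ≤ y ^ 2 / l := by rw [le_div_iff₀ hl]; nlinarith
  have e3 : y ^ 2 ≤ 4 * z ^ 2 := by nlinarith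
  calc h * y ^ 2 + x * (y - z) * (y + z) ≤ h * y ^ 2 + h * (2 * (y ^ 2 / l)) := by
        have := mul_le_mul_of_nonneg_left e2 h2.le
        linarith
    _ = h * (1 + 2 / l) * y ^ 2 := by ring
    _ ≤ h * (1 + 2 / l) * (4 * z ^ 2) := by gcongr
    _ = _ := by ring

/-- Discrete form of the fact that `-1/log x` is a primitive of `1/(x log² x)`: the terms are
dominated by a telescoping sequence. -/
theorem one_div_mul_log_sq_le {x : ℝ} (hx : 1 + Real.log 2 ≤ x) :
    1 / ((x + Real.log 2) * Real.log (x + Real.log 2) ^ 2)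
      ≤ 1 / Real.log 2 * (1 / Real.log x - 1 / Real.log (x + Real.log 2)) := by
  have h2 := log_two_pos
  set h := Real.log 2
  have hx0 : 0 < x := by linarith
  have hl : 0 < Real.log x := Real.log_pos (by linarith)
  have hly : Real.log x ≤ Real.log (x + h) := Real.log_le_log hx0 (by linarith)
  have hd : h / (x + h) ≤ Real.log (x + h) - Real.log x := by
    rw [← Real.log_div (by linarith) hx0.ne']
    have := Real.one_sub_inv_le_log_of_pos (show 0 < (x + h) / x by positivity)
    have e : 1 - ((x + h) / x)⁻¹ = h / (x + h) := by field_simp; ring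
    rwa [e] at this
  set y := Real.log (x + h)
  set z := Real.log x
  have hy : 0 < y := by linarith
  rw [div_le_iff₀ (by positivity)] at hd
  have e : 1 / h * (1 / z - 1 / y) = (y - z) / (h * (y * z)) := by field_simp
  rw [e, div_le_div_iff₀ (by positivity) (by positivity)]
  have : h * (y * z) ≤ h * (y * y) := by gcongr
  nlinarith [mul_le_mul_of_nonneg_right hd (show 0 ≤ y ^ 2 by positivity)]

theorem sum_one_div_mul_log_sq_le {x : ℕ → ℝ} (hx0 : 1 + Real.log 2 ≤ x 0)
    (hx : ∀ j, x (j + 1) = x j + Real.log 2) (J : ℕ) :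
    ∑ j ∈ Finset.range J, 1 / (x j * Real.log (x j) ^ 2)
      ≤ 1 / Real.log (1 + Real.log 2) ^ 2
        + 1 / Real.log 2 * (1 / Real.log (1 + Real.log 2)) := by
  have h2 := log_two_pos
  have hxj : ∀ j, x 0 ≤ x j := fun j => by
    induction j with
    | zero => rfl
    | succ j ih => rw [hx]; linarith
  have hl : 0 < Real.log (1 + Real.log 2) := Real.log_pos (by linarith)
  have hlx : ∀ j, Real.log (1 + Real.log 2) ≤ Real.log (x j) := fun j =>
    Real.log_le_log (by linarith) (hx0.trans (hxj j))
  have key : ∀ J, ∑ j ∈ Finset.range (J + 1), 1 / (x j * Real.log (x j) ^ 2)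
      ≤ 1 / (x 0 * Real.log (x 0) ^ 2)
        + 1 / Real.log 2 * (1 / Real.log (x 0) - 1 / Real.log (x J)) := fun J => by
    induction J with
    | zero => simp
    | succ J ih =>
      rw [Finset.sum_range_succ]
      have := one_div_mul_log_sq_le (hx0.trans (hxj J))
      rw [hx J]
      linarith
  have hfin : 1 / (x 0 * Real.log (x 0) ^ 2) ≤ 1 / Real.log (1 + Real.log 2) ^ 2 := by
    refine one_div_le_one_div_of_le (by positivity) ?_
    calc Real.log (1 + Real.log 2) ^ 2 ≤ 1 * Real.log (x 0) ^ 2 := by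
          rw [one_mul]; exact pow_le_pow_left₀ hl.le (hlx 0) 2
      _ ≤ _ := mul_le_mul_of_nonneg_right (by linarith) (by positivity)
  have hfin2 : 1 / Real.log (x 0) ≤ 1 / Real.log (1 + Real.log 2) :=
    one_div_le_one_div_of_le hl (hlx 0)
  rcases J with _ | J
  · simp; positivity
  · refine (key J).trans (add_le_add hfin (mul_le_mul_of_nonneg_left ?_ (by positivity)))
    have : 0 ≤ 1 / Real.log (x J) := one_div_nonneg.2 (hl.le.trans (hlx J))
    linarith

/-- The tangent inequality at the right end point for the convex function `x^(-α)`; it makes the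
sums of `x_j^(-α-1)` telescope. -/
theorem rpow_neg_sub_ge {x α : ℝ} (hx : 0 < x) (hα : 0 < α) {h : ℝ} (hh : 0 ≤ h) :
    α * h * (x + h) ^ (-α - 1) ≤ x ^ (-α) - (x + h) ^ (-α) := by
  have hy : 0 < x + h := by linarith
  have e1 : (x + h) ^ (-α - 1) = (x + h) ^ (-α) / (x + h) := by
    rw [Real.rpow_sub hy, Real.rpow_one]
  have e2 : x ^ (-α) = (x + h) ^ (-α) * ((x + h) / x) ^ α := by
    rw [Real.div_rpow hy.le hx.le, Real.rpow_neg hx.le, Real.rpow_neg hy.le]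
    have := (Real.rpow_pos_of_pos hy α).ne'
    field_simp
  have e3 : 1 + α * (h / (x + h)) ≤ ((x + h) / x) ^ α := by
    rw [Real.rpow_def_of_pos (by positivity)]
    have := Real.one_sub_inv_le_log_of_pos (show 0 < (x + h) / x by positivity)
    have e : 1 - ((x + h) / x)⁻¹ = h / (x + h) := by field_simp; ring
    rw [e] at this
    have h3 := Real.add_one_le_exp (Real.log ((x + h) / x) * α)
    have h4 := mul_le_mul_of_nonneg_left this hα.le
    linarith
  have hp : 0 < (x + h) ^ (-α) := Real.rpow_pos_of_pos hy _
  rw [e1, e2]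
  have := mul_le_mul_of_nonneg_left e3 hp.le
  have e4 : α * h * ((x + h) ^ (-α) / (x + h)) = (x + h) ^ (-α) * (α * (h / (x + h))) := by ring
  rw [e4]
  linarith

/-- Bernoulli's inequality at `x / (x + h)`; it bounds the increments of the weights `x^(1+ε)`. -/
theorem rpow_sub_le {x q : ℝ} (hx : 0 < x) (hq : 1 ≤ q) {h : ℝ} (hh : 0 ≤ h) :
    (x + h) ^ q - x ^ q ≤ q * h * (x + h) ^ (q - 1) := by
  have hy : 0 < x + h := by linarith
  have hb := one_add_mul_self_le_rpow_one_add (s := -(h / (x + h)))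
    (by rw [neg_le_neg_iff, div_le_one hy]; linarith) hq
  have e0 : 1 + -(h / (x + h)) = x / (x + h) := by field_simp; ring
  rw [e0, Real.div_rpow hx.le hy.le] at hb
  have hp : 0 < (x + h) ^ q := Real.rpow_pos_of_pos hy _
  rw [Real.rpow_sub hy, Real.rpow_one]
  rw [le_div_iff₀ hp] at hb
  have e : q * h * ((x + h) ^ q / (x + h)) = q * (h / (x + h)) * (x + h) ^ q := by ring
  rw [e]
  linarith

theorem sum_rpow_neg_le {x : ℕ → ℝ} (hx0 : 0 < x 0) {h : ℝ} (hh : 0 < h)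
    (hx : ∀ j, x (j + 1) = x j + h) {α : ℝ} (hα : 0 < α) (J : ℕ) :
    ∑ j ∈ Finset.range J, x (j + 1) ^ (-α - 1) ≤ 1 / (α * h) * x 0 ^ (-α) := by
  have hxj : ∀ j, 0 < x j := fun j => by
    induction j with
    | zero => exact hx0
    | succ j ih => rw [hx]; linarith
  have key : ∀ J, ∑ j ∈ Finset.range J, x (j + 1) ^ (-α - 1)
      ≤ 1 / (α * h) * (x 0 ^ (-α) - x J ^ (-α)) := fun J => by
    induction J with
    | zero => simp
    | succ J ih =>
      rw [Finset.sum_range_succ]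
      have := rpow_neg_sub_ge (hxj J) hα hh.le
      rw [← hx] at this
      have h1 : x (J + 1) ^ (-α - 1)
          ≤ 1 / (α * h) * (x J ^ (-α) - x (J + 1) ^ (-α)) := by
        rw [one_div, inv_mul_eq_div, le_div_iff₀ (by positivity)]
        linarith
      linarith
  refine (key J).trans (mul_le_mul_of_nonneg_left ?_ (by positivity))
  linarith [Real.rpow_pos_of_pos (hxj J) (-α)]

end

section

/-! ### The modulus of continuity of `u` in terms of an integral -/

/-- The integrand `m(t) (log log⋆ t)² t⁻¹`. -/
def diniIntegrand (m : ℝ → ℝ) (t : ℝ) : ℝ := m t * Real.log (logStar t) ^ 2 * t⁻¹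

theorem log_logStar_nonneg (t : ℝ) : 0 ≤ Real.log (logStar t) := Real.log_nonneg (one_le_logStar t)

theorem log_logStar_anti {s t : ℝ} (h0 : 0 < s) (hst : s ≤ t) (h : t ≤ 1) :
    Real.log (logStar t) ≤ Real.log (logStar s) :=
  Real.log_le_log (by linarith [one_le_logStar t]) (logStar_anti h0 hst h)

theorem diniIntegrand_nonneg {m : ℝ → ℝ} (hm0 : ∀ t ∈ Set.Ioc (0 : ℝ) 1, 0 ≤ m t) {t : ℝ}
    (ht : t ∈ Set.Ioc (0 : ℝ) 1) : 0 ≤ diniIntegrand m t := by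
  have h1 := hm0 t ht
  have h2 := ht.1
  unfold diniIntegrand; positivity

/-- On `[a, b]` the modulus is smallest at `a` and `log log⋆` is smallest at `b`. -/
theorem le_diniIntegrand {m : ℝ → ℝ} (hm : MonotoneOn m (Set.Ioc 0 1))
    (hm0 : ∀ t ∈ Set.Ioc (0 : ℝ) 1, 0 ≤ m t) {a s b : ℝ} (ha : 0 < a) (has : a ≤ s) (hsb : s ≤ b)
    (hb : b ≤ 1) : m a * Real.log (logStar b) ^ 2 * s⁻¹ ≤ diniIntegrand m s := by
  have hs : 0 < s := ha.trans_le has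
  have h1 : m a ≤ m s := hm ⟨ha, by linarith⟩ ⟨hs, by linarith⟩ has
  have h2 := log_logStar_anti hs hsb hb
  have h3 := log_logStar_nonneg b
  have h4 := hm0 a ⟨ha, by linarith⟩
  unfold diniIntegrand
  gcongr
  exact h4.trans h1

theorem logStar_le_mul_log {t : ℝ} (h0 : 0 < t) (h : t ≤ 1 / 2) :
    logStar t ≤ (1 / Real.log 2 + 1) * -Real.log t := by
  rw [logStar_of_le h0 (by linarith)]
  have h1 : Real.log t ≤ -Real.log 2 := by
    rw [← Real.log_inv]; exact Real.log_le_log h0 (by linarith)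
  have h2 := log_two_pos
  have : 1 ≤ 1 / Real.log 2 * -Real.log t := by
    rw [one_div, inv_mul_eq_div, le_div_iff₀ h2]; linarith
  linarith

/-- `log⋆ t ≤ (log⋆ √t)²`, so `log log⋆` is comparable at `t` and `√t`. -/
theorem log_logStar_le_two_mul_sqrt {t : ℝ} (h0 : 0 < t) (h : t ≤ 1) :
    Real.log (logStar t) ≤ 2 * Real.log (logStar (Real.sqrt t)) := by
  have h1 : logStar t ≤ logStar (Real.sqrt t) ^ 2 := by
    rw [logStar_of_le h0 h, logStar_of_le (Real.sqrt_pos.2 h0) (Real.sqrt_le_one.2 h),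
      Real.log_sqrt h0.le]
    nlinarith [sq_nonneg (Real.log t)]
  have := Real.log_le_log (by linarith [one_le_logStar t]) h1
  rwa [Real.log_pow, Nat.cast_ofNat] at this

theorem le_sqrt_self {t : ℝ} (h0 : 0 ≤ t) (h : t ≤ 1) : t ≤ Real.sqrt t :=
  Real.le_sqrt_of_sq_le (by nlinarith)

theorem intervalIntegrable_diniIntegrand {m : ℝ → ℝ} {T a b : ℝ}
    (hi : IntegrableOn (diniIntegrand m) (Set.Ioc 0 T)) (ha : 0 ≤ a) (hab : a ≤ b) (hb : b ≤ T) :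
    IntervalIntegrable (diniIntegrand m) volume a b := by
  rw [intervalIntegrable_iff_integrableOn_Ioc_of_le hab]
  exact hi.mono_set (Set.Ioc_subset_Ioc ha hb)

theorem integral_diniIntegrand_nonneg {m : ℝ → ℝ}
    (hm0 : ∀ t ∈ Set.Ioc (0 : ℝ) 1, 0 ≤ m t) {a b : ℝ} (ha : 0 ≤ a) (hab : a ≤ b) (hb : b ≤ 1) :
    0 ≤ ∫ s in a..b, diniIntegrand m s := by
  rw [intervalIntegral.integral_of_le hab]
  exact setIntegral_nonneg measurableSet_Ioc fun s hs =>
    diniIntegrand_nonneg hm0 ⟨ha.trans_lt hs.1, hs.2.trans hb⟩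

theorem integral_diniIntegrand_mono {m : ℝ → ℝ} {T a b : ℝ}
    (hm0 : ∀ t ∈ Set.Ioc (0 : ℝ) 1, 0 ≤ m t)
    (hi : IntegrableOn (diniIntegrand m) (Set.Ioc 0 T)) (ha : 0 ≤ a) (hab : a ≤ b) (hb : b ≤ T)
    (hT : T ≤ 1) : ∫ s in a..b, diniIntegrand m s ≤ ∫ s in (0 : ℝ)..T, diniIntegrand m s := by
  have i1 := intervalIntegrable_diniIntegrand hi le_rfl ha (hab.trans hb)
  have i2 := intervalIntegrable_diniIntegrand hi ha hab hb
  have i3 := intervalIntegrable_diniIntegrand hi (ha.trans hab) hb le_rfl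
  rw [← intervalIntegral.integral_add_adjacent_intervals i1 (i2.trans i3),
    ← intervalIntegral.integral_add_adjacent_intervals i2 i3]
  have h1 := integral_diniIntegrand_nonneg hm0 le_rfl ha ((hab.trans hb).trans hT)
  have h2 := integral_diniIntegrand_nonneg hm0 (ha.trans hab) hb hT
  linarith

/-- Each term of the Abel sum is paid for by the dyadic block `[s/2, s]`: its length `s/2`
compensates `t⁻¹ ≥ s⁻¹`. -/
theorem mul_le_integral_half {m : ℝ → ℝ} {T s : ℝ} (hm : MonotoneOn m (Set.Ioc 0 1))
    (hm0 : ∀ t ∈ Set.Ioc (0 : ℝ) 1, 0 ≤ m t)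
    (hi : IntegrableOn (diniIntegrand m) (Set.Ioc 0 T)) (hs : 0 < s) (hsT : s ≤ T) (hT : T ≤ 1) :
    Real.log (logStar s) ^ 2 * m (s / 2) ≤ 2 * ∫ y in s / 2..s, diniIntegrand m y := by
  have i2 := intervalIntegrable_diniIntegrand hi (half_pos hs).le (half_le_self hs.le) hsT
  have h := intervalIntegral.integral_mono_on (half_le_self hs.le)
    (intervalIntegrable_const (c := m (s / 2) * Real.log (logStar s) ^ 2 * s⁻¹)) i2 fun y hy => by
      refine le_trans ?_ (le_diniIntegrand hm hm0 (half_pos hs) hy.1 hy.2 (hsT.trans hT))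
      have h0 := hm0 (s / 2) ⟨half_pos hs, by linarith⟩
      have hy0 : 0 < y := (half_pos hs).trans_le hy.1
      gcongr
      exact hy.2
  rw [intervalIntegral.integral_const, smul_eq_mul] at h
  have e : (s - s / 2) * (m (s / 2) * Real.log (logStar s) ^ 2 * s⁻¹)
      = Real.log (logStar s) ^ 2 * m (s / 2) / 2 := by field_simp; ring
  rw [e] at h
  linarith

/-- This absorbs the boundary term `w_0 β_0`. Its extra factor `log⋆ t` comes from `∫ dy/y = |log t|
/ 2` over `[t, √t]`, which is why the integral in the theorem runs up to `r^(1/2)`. -/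
theorem mul_le_integral_sqrt {m : ℝ → ℝ} {t : ℝ} (hm : MonotoneOn m (Set.Ioc 0 1))
    (hm0 : ∀ t ∈ Set.Ioc (0 : ℝ) 1, 0 ≤ m t)
    (hi : IntegrableOn (diniIntegrand m) (Set.Ioc 0 (Real.sqrt t))) (ht : 0 < t)
    (ht2 : t ≤ 1 / 2) :
    logStar t * Real.log (logStar t) ^ 2 * m t
      ≤ 8 * (1 / Real.log 2 + 1) * ∫ y in t..Real.sqrt t, diniIntegrand m y := by
  have hts : t ≤ Real.sqrt t := le_sqrt_self ht.le (by linarith)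
  have hs1 : Real.sqrt t ≤ 1 := Real.sqrt_le_one.2 (by linarith)
  have i2 := intervalIntegrable_diniIntegrand hi ht.le hts le_rfl
  have hinv : IntervalIntegrable (fun y : ℝ => y⁻¹) volume t (Real.sqrt t) :=
    intervalIntegral.intervalIntegrable_inv (fun y hy => by
      rw [Set.uIcc_of_le hts] at hy; exact (ht.trans_le hy.1).ne') continuousOn_id
  have h := intervalIntegral.integral_mono_on hts
    (hinv.const_mul (m t * Real.log (logStar (Real.sqrt t)) ^ 2)) i2 fun y hy =>
      le_diniIntegrand hm hm0 ht hy.1 hy.2 hs1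
  rw [intervalIntegral.integral_const_mul, integral_inv_of_pos ht (Real.sqrt_pos.2 ht),
    Real.log_div (Real.sqrt_pos.2 ht).ne' ht.ne', Real.log_sqrt ht.le] at h
  have h1 := logStar_le_mul_log ht ht2
  have h2 := log_logStar_le_two_mul_sqrt ht (by linarith)
  have h3 := log_logStar_nonneg t
  have h4 := hm0 t ⟨ht, by linarith⟩
  have h5 := log_two_pos
  have h6 : 0 ≤ -Real.log t := by linarith [Real.log_nonpos ht.le (by linarith)]
  calc logStar t * Real.log (logStar t) ^ 2 * m t
      ≤ (1 / Real.log 2 + 1) * -Real.log t * (2 * Real.log (logStar (Real.sqrt t))) ^ 2 * m t := by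
        gcongr
    _ = 8 * (1 / Real.log 2 + 1) * (m t * Real.log (logStar (Real.sqrt t)) ^ 2
          * (Real.log t / 2 - Real.log t)) := by ring
    _ ≤ _ := by gcongr

variable {k : ℕ}

/-- The dyadic estimate with weights `x_j (log x_j)²`, where `x_j = log⋆ (t / 2ʲ)`: the inverses sum
to at most `S`, the boundary term costs `K1` and the increments cost `K2` times the integral. -/
theorem exists_avg_sub_self_sq_le_integral (hk : 1 ≤ k) : ∃ C : ℝ, 0 < C ∧
    ∀ (Ω : TopologicalSpace.Opens (Cn k)) (u v : Cn k → ℝ) (G : Fin k → Cn k → ℂ),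
      EnergyBound Ω u v G → ∀ (m : ℝ → ℝ), MonotoneOn m (Set.Ioc 0 1) →
        (∀ t ∈ Set.Ioc (0 : ℝ) 1, 0 ≤ m t) → ∀ (a : Cn k) (t : ℝ), 0 < t → t ≤ 1 / 2 →
        Metric.closedBall a t ⊆ Ω →
        (∀ s, 0 < s → s ≤ t → ∀ x, ‖x - a‖ ≤ s → |v x - v a| ≤ m s) →
        IntegrableOn (diniIntegrand m) (Set.Ioc 0 (Real.sqrt t)) →
        (avg u a t - mass k * u a) ^ 2 ≤ C * ∫ s in (0 : ℝ)..Real.sqrt t, diniIntegrand m s := by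
  obtain ⟨C, hC0, hC⟩ := exists_avg_sub_self_sq_le hk
  have h2 := log_two_pos
  set l := Real.log (1 + Real.log 2) with hl
  have hl0 : 0 < l := Real.log_pos (by linarith)
  set S := 1 / l ^ 2 + 1 / Real.log 2 * (1 / l) with hS
  set K1 := 8 * (1 / Real.log 2 + 1) with hK1
  set K2 := 4 * Real.log 2 * (1 + 2 / l) with hK2
  refine ⟨C * S * (K1 + K2 * 2), by positivity, ?_⟩
  intro Ω u v G h m hm hm0 a t ht ht2 hΩ hv hi
  have hts : t ≤ Real.sqrt t := le_sqrt_self ht.le (by linarith)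
  have hs1 : Real.sqrt t ≤ 1 := Real.sqrt_le_one.2 (by linarith)
  have hpos : ∀ j : ℕ, 0 < t / 2 ^ j := fun j => by positivity
  have hle : ∀ j : ℕ, t / 2 ^ j ≤ t := fun j => div_le_self ht.le (one_le_pow₀ one_le_two)
  have hhalf : ∀ j : ℕ, t / 2 ^ j / 2 = t / 2 ^ (j + 1) := fun j => by rw [pow_succ]; field_simp
  set x : ℕ → ℝ := fun j => logStar (t / 2 ^ j) with hx
  have hx1 : ∀ j, x (j + 1) = x j + Real.log 2 := logStar_div_two_pow ht (by linarith)
  have hxj : ∀ j, 1 + Real.log 2 ≤ x j := fun j => le_logStar (hpos j) ((hle j).trans ht2)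
  have hlx : ∀ j, l ≤ Real.log (x j) := fun j => Real.log_le_log (by linarith) (hxj j)
  have hinc : ∀ j, x (j + 1) * Real.log (x (j + 1)) ^ 2 - x j * Real.log (x j) ^ 2
      ≤ K2 * Real.log (x j) ^ 2 := fun j => by
    rw [hx1]; exact mul_log_sq_sub_le (hxj j)
  have hmain := hC Ω u v G h a t ht hΩ (fun j => m (t / 2 ^ j))
    (fun j => x j * Real.log (x j) ^ 2) S
    ((K1 + K2 * 2) * ∫ s in (0 : ℝ)..Real.sqrt t, diniIntegrand m s)
    (fun j => hv _ (hpos j) (hle j))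
    (fun j => mul_pos (by linarith [hxj j]) (pow_pos (hl0.trans_le (hlx j)) 2))
    (monotone_nat_of_le_succ fun j => by
      have h3 : x j ≤ x (j + 1) := by rw [hx1]; linarith
      have h4 := hlx j
      have h5 : Real.log (x j) ≤ Real.log (x (j + 1)) :=
        Real.log_le_log (by linarith [hxj j]) h3
      have h6 : 0 ≤ x (j + 1) := by linarith [hxj j]
      have h7 : 0 ≤ Real.log (x j) := hl0.le.trans h4
      gcongr)
    (sum_one_div_mul_log_sq_le (hxj 0) hx1) fun J => by
      have hsum : ∀ J, ∑ j ∈ Finset.range J, (x (j + 1) * Real.log (x (j + 1)) ^ 2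
          - x j * Real.log (x j) ^ 2) * m (t / 2 ^ (j + 1))
          ≤ K2 * 2 * ∫ s in t / 2 ^ J..t, diniIntegrand m s := fun J => by
        induction J with
        | zero => simp
        | succ J ih =>
          rw [Finset.sum_range_succ]
          have i1 := intervalIntegrable_diniIntegrand hi (hpos (J + 1)).le
            (by rw [← hhalf]; exact half_le_self (hpos J).le) ((hle J).trans hts)
          have i2 := intervalIntegrable_diniIntegrand hi (hpos J).le (hle J) hts
          rw [← intervalIntegral.integral_add_adjacent_intervals i1 i2, mul_add]
          have h3 := mul_le_integral_half hm hm0 hi (hpos J) ((hle J).trans hts) hs1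
          rw [hhalf] at h3
          have h4 := mul_le_mul_of_nonneg_right (hinc J)
            (hm0 (t / 2 ^ (J + 1)) ⟨hpos _, (hle _).trans (by linarith)⟩)
          have h5 := mul_le_mul_of_nonneg_left h3 (show 0 ≤ K2 by positivity)
          linarith
      have h6 := mul_le_integral_sqrt hm hm0 hi ht ht2
      have h7 := integral_diniIntegrand_mono hm0 hi ht.le hts le_rfl hs1
      have h8 := integral_diniIntegrand_mono hm0 hi (hpos J).le (hle J) hts hs1
      have h9 := mul_le_mul_of_nonneg_left h7 (show 0 ≤ K1 by positivity)
      have h10 := mul_le_mul_of_nonneg_left h8 (show 0 ≤ K2 * 2 by positivity)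
      have h11 := hsum J
      simp only [hx, pow_zero, div_one] at h6 h11 ⊢
      linarith
  linarith

/-- The two-point estimate, from the estimates for averages. -/
theorem abs_sub_le_of_avg {u : Cn k → ℝ} {a b : Cn k} {t X Y : ℝ} (hk : 1 ≤ k)
    (ha : (avg u a t - mass k * u a) ^ 2 ≤ X) (hb : (avg u b t - mass k * u b) ^ 2 ≤ X)
    (hab : (avg u a t - avg u b t) ^ 2 ≤ Y) :
    |u a - u b| ≤ (mass k)⁻¹ * (2 * Real.sqrt X + Real.sqrt Y) := by
  have hm := mass_pos hk
  rw [inv_mul_eq_div, le_div_iff₀ hm, mul_comm, ← abs_of_pos hm, ← abs_mul]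
  have h1 := abs_le.1 (Real.abs_le_sqrt ha)
  have h2 := abs_le.1 (Real.abs_le_sqrt hb)
  have h3 := abs_le.1 (Real.abs_le_sqrt hab)
  rw [abs_le]
  constructor <;> linarith

theorem exists_abs_sub_le_integral (hk : 1 ≤ k) : ∃ C : ℝ, 0 < C ∧
    ∀ (Ω : TopologicalSpace.Opens (Cn k)) (u v : Cn k → ℝ) (G : Fin k → Cn k → ℂ),
      EnergyBound Ω u v G → ∀ (m : ℝ → ℝ), MonotoneOn m (Set.Ioc 0 1) →
        (∀ t ∈ Set.Ioc (0 : ℝ) 1, 0 ≤ m t) → ∀ (c : Cn k) (R r : ℝ), 0 < r → r ≤ 1 / 2 →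
        Metric.closedBall c (R + r) ⊆ Ω →
        (∀ x ∈ Metric.closedBall c R, ∀ s, 0 < s → s ≤ r →
          ∀ y, ‖y - x‖ ≤ s → |v y - v x| ≤ m s) →
        IntegrableOn (diniIntegrand m) (Set.Ioc 0 (Real.sqrt r)) →
        ∀ a ∈ Metric.closedBall c R, ∀ b ∈ Metric.closedBall c R, ‖a - b‖ ≤ r →
          |u a - u b| ≤ C * Real.sqrt (∫ s in (0 : ℝ)..Real.sqrt r, diniIntegrand m s) := by
  obtain ⟨C1, hC1, h1⟩ := exists_avg_sub_self_sq_le_integral hk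
  obtain ⟨C2, hC2, h2⟩ := exists_avg_sub_avg_sq_le hk
  have hlog := log_two_pos
  have hl0 : 0 < Real.log (1 + Real.log 2) := Real.log_pos (by linarith)
  set K := 8 * (1 / Real.log 2 + 1) / Real.log (1 + Real.log 2) ^ 2 with hK
  have hK0 : 0 < K := by positivity
  have hm := mass_pos hk
  refine ⟨(mass k)⁻¹ * (2 * Real.sqrt C1 + Real.sqrt (16 * C2 * K)), by positivity, ?_⟩
  intro Ω u v G h m hmono hm0 c R r hr hr2 hΩ hv hi a ha b hb hab
  -- Averaging at scale `r/4` keeps the neighbourhoods of radius `4t` in the Lipschitz estimate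
  -- within distance `r`.
  have hr4 : 0 < r / 4 := by linarith
  have hsq : Real.sqrt (r / 4) ≤ Real.sqrt r := Real.sqrt_le_sqrt (by linarith)
  have hrs : r ≤ Real.sqrt r := le_sqrt_self hr.le (by linarith)
  have hs1 : Real.sqrt r ≤ 1 := Real.sqrt_le_one.2 (by linarith)
  set I := ∫ s in (0 : ℝ)..Real.sqrt r, diniIntegrand m s with hI
  have hI0 : 0 ≤ I := integral_diniIntegrand_nonneg hm0 le_rfl (Real.sqrt_nonneg _) hs1
  have hone : ∀ x ∈ Metric.closedBall c R, (avg u x (r / 4) - mass k * u x) ^ 2 ≤ C1 * I := by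
    intro x hx
    rw [Metric.mem_closedBall] at hx
    have := h1 Ω u v G h m hmono hm0 x (r / 4) hr4 (by linarith)
      ((Metric.closedBall_subset_closedBall' (by linarith)).trans hΩ)
      (fun s hs hsr => hv x hx s hs (by linarith))
      (hi.mono_set (Set.Ioc_subset_Ioc_right hsq))
    refine this.trans (mul_le_mul_of_nonneg_left ?_ hC1.le)
    exact integral_diniIntegrand_mono hm0 hi le_rfl (Real.sqrt_nonneg _) hsq hs1
  have htwo : (avg u a (r / 4) - avg u b (r / 4)) ^ 2 ≤ 16 * C2 * K * I := by
    have h3 := h2 Ω u v G h c R (r / 4) (m r) hr4 (by rwa [mul_div_cancel₀ _ four_ne_zero])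
      (fun x hx z hz => hv x hx r hr le_rfl z (by linarith)) a ha b hb
    have h4 := mul_le_integral_sqrt hmono hm0 hi hr hr2
    have h5 := integral_diniIntegrand_mono hm0 hi hr.le hrs le_rfl hs1
    have h6 := le_logStar hr hr2
    have h7 : Real.log (1 + Real.log 2) ≤ Real.log (logStar r) :=
      Real.log_le_log (by linarith) h6
    have hmr := hm0 r ⟨hr, by linarith⟩
    -- The Lipschitz estimate involves `m r` alone; for `r ≤ 1/2` the factors `log⋆ r` and `log log⋆
    -- r` are bounded below, so `mul_le_integral_sqrt` also controls it by the integral.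
    have h8 : m r ≤ K * I := by
      have : Real.log (1 + Real.log 2) ^ 2 * m r ≤ 8 * (1 / Real.log 2 + 1) * I := by
        calc _ ≤ 1 * Real.log (logStar r) ^ 2 * m r := by rw [one_mul]; gcongr
          _ ≤ logStar r * Real.log (logStar r) ^ 2 * m r := by gcongr; linarith
          _ ≤ _ := h4
          _ ≤ _ := by gcongr
      rw [hK, div_mul_eq_mul_div, le_div_iff₀ (by positivity)]
      linarith
    calc _ ≤ _ := h3
      _ ≤ C2 * m r * r ^ 2 / (r / 4) ^ 2 := by gcongr
      _ = 16 * C2 * m r := by field_simp; ring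
      _ ≤ 16 * C2 * (K * I) := by gcongr
      _ = _ := by ring
  refine (abs_sub_le_of_avg hk (hone a ha) (hone b hb) htwo).trans_eq ?_
  rw [Real.sqrt_mul hC1.le, Real.sqrt_mul (by positivity)]
  ring

/-! ### The modulus of continuity on balls -/

theorem bddAbove_modulus {X : Type*} [PseudoMetricSpace X] {U : Set X} {g : X → ℝ} {N : ℝ}
    (hg : ∀ x ∈ U, |g x| ≤ N) (r : ℝ) :
    BddAbove {a : ℝ | ∃ x ∈ U, ∃ y ∈ U, dist x y ≤ r ∧ a = |g x - g y|} := by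
  refine ⟨N + N, ?_⟩
  rintro _ ⟨x, hx, y, hy, -, rfl⟩
  exact (abs_sub _ _).trans (add_le_add (hg x hx) (hg y hy))

theorem abs_sub_le_modulus {X : Type*} [PseudoMetricSpace X] {U : Set X} {g : X → ℝ} {N : ℝ}
    (hg : ∀ x ∈ U, |g x| ≤ N) {x y : X} (hx : x ∈ U) (hy : y ∈ U) {r : ℝ} (h : dist x y ≤ r) :
    |g x - g y| ≤ modulus U g r :=
  le_csSup (bddAbove_modulus hg r) ⟨x, hx, y, hy, h, rfl⟩

theorem modulus_nonneg {X : Type*} [PseudoMetricSpace X] (U : Set X) (g : X → ℝ) (r : ℝ) :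
    0 ≤ modulus U g r := by
  refine Real.sSup_nonneg ?_
  rintro _ ⟨x, -, y, -, -, rfl⟩
  exact abs_nonneg _

theorem modulus_mono {X : Type*} [PseudoMetricSpace X] {U : Set X} {g : X → ℝ} {N : ℝ}
    (hg : ∀ x ∈ U, |g x| ≤ N) : Monotone (modulus U g) := by
  intro r s hrs
  refine Real.sSup_le ?_ (modulus_nonneg _ _ _)
  rintro _ ⟨x, hx, y, hy, h, rfl⟩
  exact abs_sub_le_modulus hg hx hy (h.trans hrs)

theorem osc_nonneg {X : Type*} {U : Set X} {g : X → ℝ} {N : ℝ} (hg : ∀ x ∈ U, |g x| ≤ N) :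
    0 ≤ osc U g := by
  refine sub_nonneg.2 (Real.sInf_le_sSup _ ⟨-N, ?_⟩ ⟨N, ?_⟩)
  · rintro _ ⟨x, hx, rfl⟩; exact (abs_le.1 (hg x hx)).1
  · rintro _ ⟨x, hx, rfl⟩; exact (abs_le.1 (hg x hx)).2

theorem measurable_logStar : Measurable logStar :=
  (Real.measurable_log.norm).const_add 1

/-- The power `4` of `log log⋆` dominates the power `2` up to a constant only away from `t = 1`,
where `log log⋆` vanishes; hence `T < 1`. Measurability comes from the monotonicity of `m`. -/
theorem integrableOn_diniIntegrand {m : ℝ → ℝ} (hm : Monotone m)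
    (hi : IntegrableOn (fun t : ℝ => m t * Real.log (logStar t) ^ 4 * t⁻¹) (Set.Ioc 0 1))
    {T : ℝ} (hT1 : T < 1) :
    IntegrableOn (diniIntegrand m) (Set.Ioc 0 T) := by
  rcases le_or_gt T 0 with hT | hT
  · rw [Set.Ioc_eq_empty (not_lt.2 hT)]; exact integrableOn_empty
  have hκ : 0 < Real.log (logStar T) := by
    refine Real.log_pos ?_
    rw [logStar_of_le hT hT1.le]
    linarith [Real.log_neg hT hT1]
  have hmeas : Measurable (diniIntegrand m) :=
    (hm.measurable.mul ((Real.measurable_log.comp measurable_logStar).pow_const 2)).mul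
      measurable_inv
  refine Integrable.mono ((hi.mono_set (Set.Ioc_subset_Ioc_right hT1.le)).const_mul
    ((Real.log (logStar T) ^ 2)⁻¹)) hmeas.aestronglyMeasurable ?_
  refine (ae_restrict_iff' measurableSet_Ioc).2 (Filter.Eventually.of_forall fun t ht => ?_)
  have h1 := log_logStar_anti ht.1 ht.2 hT1.le
  have e : (Real.log (logStar T) ^ 2)⁻¹ * (m t * Real.log (logStar t) ^ 4 * t⁻¹)
      = diniIntegrand m t * (Real.log (logStar t) ^ 2 / Real.log (logStar T) ^ 2) := by
    unfold diniIntegrand; field_simp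
  rw [e, norm_mul]
  refine le_mul_of_one_le_right (norm_nonneg _) ?_
  rw [Real.norm_of_nonneg (by positivity), one_le_div (by positivity)]
  exact pow_le_pow_left₀ hκ.le h1 2

theorem exists_modulus_le (hk : 1 ≤ k) : ∃ c : ℝ, 0 < c ∧
      ∀ (u v : Cn k → ℝ) (G : Fin k → Cn k → ℂ),
        ContinuousOn u (ballC k 5) →
        IsDel (ballC k 5) u G →
        ContinuousOn v (ballC k 5) →
        Current11.IsPositive (ddc (ballC k 5) v - delWedge (ballC k 5) G) →
        MeasureTheory.IntegrableOn
          (fun t : ℝ => modulus (ballC k 4 : Set (Cn k)) v t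
            * Real.log (logStar t) ^ 4 * t⁻¹) (Set.Ioc 0 1) →
        0 ≤ osc (ballC k 4 : Set (Cn k)) v ∧ ∀ r : ℝ, 0 < r → r ≤ 1 / 2 →
          modulus (ballC k 1 : Set (Cn k)) u r ≤
            c * (∫ t in (0 : ℝ)..r ^ (1 / 2 : ℝ),
                modulus (ballC k 4 : Set (Cn k)) v t
                  * Real.log (logStar t) ^ 2 * t⁻¹) ^ (1 / 2 : ℝ) := by
  obtain ⟨C, hC0, hC⟩ := exists_abs_sub_le_integral hk
  refine ⟨C, hC0, ?_⟩
  intro u v G hu hG hv hpos hi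
  have hE : EnergyBound (ballC k 5) u v G :=
    energyBound_of_isPositive hu hv hG (fun φ hφ => sum_ddc_re hv hφ) hpos
  -- Boundedness of `v` on the ball of radius `4` makes the suprema in `modulus` and `osc` genuine
  -- rather than default values.
  obtain ⟨N, hN⟩ := (isCompact_closedBall (0 : Cn k) 4).exists_bound_of_continuousOn
    (hv.mono (Metric.closedBall_subset_ball (by norm_num : (4 : ℝ) < 5)))
  have hb : ∀ x ∈ (ballC k 4 : Set (Cn k)), |v x| ≤ N := fun x hx =>
    hN x (Metric.ball_subset_closedBall hx)
  refine ⟨osc_nonneg hb, fun r hr hr2 => ?_⟩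
  set m := modulus (ballC k 4 : Set (Cn k)) v with hm
  have hmono : Monotone m := modulus_mono hb
  have hsr : Real.sqrt r < 1 := by rw [Real.sqrt_lt' one_pos]; linarith
  rw [← Real.sqrt_eq_rpow, ← Real.sqrt_eq_rpow]
  refine Real.sSup_le ?_ (by positivity)
  rintro _ ⟨x, hx, y, hy, hxy, rfl⟩
  refine hC (ballC k 5) u v G hE m (hmono.monotoneOn _) (fun t _ => modulus_nonneg _ _ _) 0 1 r hr
    hr2 (Metric.closedBall_subset_ball (by linarith)) ?_ (integrableOn_diniIntegrand hmono hi hsr)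
    x (Metric.ball_subset_closedBall hx) y (Metric.ball_subset_closedBall hy)
    (by rwa [← dist_eq_norm])
  intro a ha s hs hsr b hba
  rw [Metric.mem_closedBall, dist_zero_right] at ha
  refine abs_sub_le_modulus hb (Metric.mem_ball.2 ?_) (Metric.mem_ball.2 ?_) (by
    rwa [dist_eq_norm])
  · rw [dist_zero_right]
    have := norm_add_le (b - a) a
    rw [sub_add_cancel] at this
    linarith
  · rw [dist_zero_right]; linarith

end

section

/-! ### Logarithmic moduli of continuity -/

variable {k : ℕ}

theorem exists_avg_sub_self_sq_le_logStar (hk : 1 ≤ k) {p : ℝ} (hp : 1 < p) : ∃ C : ℝ, 0 < C ∧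
    ∀ (Ω : TopologicalSpace.Opens (Cn k)) (u v : Cn k → ℝ) (G : Fin k → Cn k → ℂ),
      EnergyBound Ω u v G → ∀ (M : ℝ), 0 ≤ M → ∀ (a : Cn k) (t : ℝ), 0 < t → t ≤ 1 / 2 →
        Metric.closedBall a t ⊆ Ω →
        (∀ s, 0 < s → s ≤ t → ∀ x, ‖x - a‖ ≤ s → |v x - v a| ≤ M * logStar s ^ (-p)) →
        (avg u a t - mass k * u a) ^ 2 ≤ C * M * logStar t ^ (1 - p) := by
  obtain ⟨C, hC0, hC⟩ := exists_avg_sub_self_sq_le hk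
  have h2 := log_two_pos
  -- With weights `x^(1+ε)` and modulus `x^(-p)`, where `p = 1 + 2ε`, both `∑ 1/w_j` and the Abel
  -- sum are of order `x_0^(-ε)`; the product is of order `x_0^(1-p)`.
  set ε := (p - 1) / 2 with hε
  have hε0 : 0 < ε := by linarith
  set K := 1 / (ε * Real.log 2) with hK
  have hK0 : 0 < K := by positivity
  refine ⟨C * (1 + K) * (1 + (1 + ε) * Real.log 2 * K), by positivity, ?_⟩
  intro Ω u v G h M hM a t ht ht2 hΩ hv
  have hpos : ∀ j : ℕ, 0 < t / 2 ^ j := fun j => by positivity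
  have hle : ∀ j : ℕ, t / 2 ^ j ≤ t := fun j => div_le_self ht.le (one_le_pow₀ one_le_two)
  set x : ℕ → ℝ := fun j => logStar (t / 2 ^ j) with hx
  have hx1 : ∀ j, x (j + 1) = x j + Real.log 2 := logStar_div_two_pow ht (by linarith)
  have hxj : ∀ j, 1 ≤ x j := fun j => one_le_logStar _
  have hx0 : ∀ j, 0 < x j := fun j => one_pos.trans_le (hxj j)
  have hsum := sum_rpow_neg_le (hx0 0) h2 hx1 hε0
  rw [← hK] at hsum
  have hxε : 0 < x 0 ^ (-ε) := Real.rpow_pos_of_pos (hx0 0) _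
  have hmain := hC Ω u v G h a t ht hΩ (fun j => M * x j ^ (-p)) (fun j => x j ^ (1 + ε))
    ((1 + K) * x 0 ^ (-ε)) (M * ((1 + (1 + ε) * Real.log 2 * K) * x 0 ^ (-ε)))
    (fun j => hv _ (hpos j) (hle j)) (fun j => Real.rpow_pos_of_pos (hx0 j) _)
    (monotone_nat_of_le_succ fun j => Real.rpow_le_rpow (hx0 j).le
      (by rw [hx1]; linarith) (by linarith))
    (fun J => by
      have e : ∀ j, 1 / x j ^ (1 + ε) = x j ^ (-ε - 1) := fun j => by
        rw [one_div, ← Real.rpow_neg (hx0 j).le]; congr 1; ring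
      simp only [e]
      rcases J with _ | J
      · simp; positivity
      · rw [Finset.sum_range_succ']
        have h3 : x 0 ^ (-ε - 1) ≤ x 0 ^ (-ε) :=
          Real.rpow_le_rpow_of_exponent_le (hxj 0) (by linarith)
        have h4 := hsum J
        linarith)
    (fun J => by
      have e0 : x 0 ^ (1 + ε) * (M * x 0 ^ (-p)) = M * x 0 ^ (-ε) := by
        rw [mul_left_comm, ← Real.rpow_add (hx0 0)]
        congr 2; rw [hε]; ring
      have e1 : ∀ j, (x (j + 1) ^ (1 + ε) - x j ^ (1 + ε)) * (M * x (j + 1) ^ (-p))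
          ≤ M * ((1 + ε) * Real.log 2) * x (j + 1) ^ (-ε - 1) := fun j => by
        have h3 := rpow_sub_le (hx0 j) (show 1 ≤ 1 + ε by linarith) h2.le
        rw [← hx1, add_sub_cancel_left] at h3
        have h4 : 0 ≤ M * x (j + 1) ^ (-p) :=
          mul_nonneg hM (Real.rpow_nonneg (hx0 _).le _)
        refine (mul_le_mul_of_nonneg_right h3 h4).trans_eq ?_
        have : x (j + 1) ^ (-ε - 1) = x (j + 1) ^ ε * x (j + 1) ^ (-p) := by
          rw [← Real.rpow_add (hx0 _)]; congr 1; rw [hε]; ring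
        rw [this]; ring
      have h5 := Finset.sum_le_sum fun j (_ : j ∈ Finset.range J) => e1 j
      rw [← Finset.mul_sum] at h5
      have h6 := mul_le_mul_of_nonneg_left (hsum J)
        (show 0 ≤ M * ((1 + ε) * Real.log 2) by positivity)
      rw [e0]
      linarith)
  have e2 : x 0 ^ (-ε) * x 0 ^ (-ε) = logStar t ^ (1 - p) := by
    rw [← Real.rpow_add (hx0 0)]
    simp only [hx, pow_zero, div_one]
    congr 1; rw [hε]; ring
  rw [← e2]
  linarith

/-- If `v` has a logarithmic modulus of continuity, then so has `u`. -/
theorem exists_abs_sub_le_logStar (hk : 1 ≤ k) {p : ℝ} (hp : 1 < p) : ∃ C : ℝ, 0 < C ∧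
    ∀ (Ω : TopologicalSpace.Opens (Cn k)) (u v : Cn k → ℝ) (G : Fin k → Cn k → ℂ),
      EnergyBound Ω u v G → ∀ (M : ℝ), 0 ≤ M → ∀ (c : Cn k) (R r : ℝ), 0 < r → r ≤ 1 / 2 →
        Metric.closedBall c (R + r) ⊆ Ω →
        (∀ x ∈ Metric.closedBall c R, ∀ s, 0 < s → s ≤ r →
          ∀ y, ‖y - x‖ ≤ s → |v y - v x| ≤ M * logStar s ^ (-p)) →
        ∀ a ∈ Metric.closedBall c R, ∀ b ∈ Metric.closedBall c R,
          |u a - u b| ≤ C * Real.sqrt M * (1 + ‖a - b‖ / r) * logStar r ^ ((1 - p) / 2) := by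
  obtain ⟨C1, hC1, h1⟩ := exists_avg_sub_self_sq_le_logStar hk hp
  obtain ⟨C2, hC2, h2⟩ := exists_avg_sub_avg_sq_le hk
  have hm := mass_pos hk
  refine ⟨(mass k)⁻¹ * (2 * Real.sqrt C1 + 4 * Real.sqrt C2), by positivity, ?_⟩
  intro Ω u v G h M hM c R r hr hr2 hΩ hv a ha b hb
  have hr4 : 0 < r / 4 := by linarith
  have hL1 := one_le_logStar r
  have hL0 : 0 < logStar r := one_pos.trans_le hL1
  have hsq : Real.sqrt (logStar r ^ (1 - p)) = logStar r ^ ((1 - p) / 2) := by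
    rw [Real.sqrt_eq_rpow, ← Real.rpow_mul hL0.le]; congr 1; ring
  have hone : ∀ x ∈ Metric.closedBall c R, (avg u x (r / 4) - mass k * u x) ^ 2
      ≤ C1 * M * logStar r ^ (1 - p) := by
    intro x hx
    rw [Metric.mem_closedBall] at hx
    have := h1 Ω u v G h M hM x (r / 4) hr4 (by linarith)
      ((Metric.closedBall_subset_closedBall' (by linarith)).trans hΩ)
      (fun s hs hsr => hv x hx s hs (by linarith))
    refine this.trans (mul_le_mul_of_nonneg_left ?_ (by positivity))
    exact Real.rpow_le_rpow_of_nonpos hL0 (logStar_anti hr4 (by linarith) (by linarith))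
      (by linarith)
  have htwo : (avg u a (r / 4) - avg u b (r / 4)) ^ 2
      ≤ 16 * C2 * M * logStar r ^ (1 - p) * (‖a - b‖ / r) ^ 2 := by
    have h3 := h2 Ω u v G h c R (r / 4) (M * logStar r ^ (-p)) hr4
      (by rwa [mul_div_cancel₀ _ four_ne_zero])
      (fun x hx z hz => hv x hx r hr le_rfl z (by linarith)) a ha b hb
    have h4 : logStar r ^ (-p) ≤ logStar r ^ (1 - p) :=
      Real.rpow_le_rpow_of_exponent_le hL1 (by linarith)
    calc _ ≤ _ := h3
      _ ≤ C2 * (M * logStar r ^ (1 - p)) * ‖a - b‖ ^ 2 / (r / 4) ^ 2 := by gcongr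
      _ = _ := by field_simp; ring
  refine (abs_sub_le_of_avg hk (hone a ha) (hone b hb) htwo).trans ?_
  have hp0 : 0 ≤ logStar r ^ (1 - p) := Real.rpow_nonneg hL0.le _
  rw [Real.sqrt_mul (by positivity), Real.sqrt_mul hC1.le, Real.sqrt_mul (by positivity),
    Real.sqrt_mul (by positivity), Real.sqrt_mul (by positivity), Real.sqrt_mul (by norm_num),
    Real.sqrt_sq (by positivity), hsq, show Real.sqrt 16 = 4 by
      rw [show (16 : ℝ) = 4 ^ 2 by norm_num]; exact Real.sqrt_sq (by norm_num)]
  have hL2 : 0 ≤ logStar r ^ ((1 - p) / 2) := Real.rpow_nonneg hL0.le _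
  set L := logStar r ^ ((1 - p) / 2)
  set d := ‖a - b‖ / r
  have hd : 0 ≤ d := by positivity
  have e0 : (mass k)⁻¹ * (2 * Real.sqrt C1 + 4 * Real.sqrt C2) * Real.sqrt M * (1 + d) * L
      = (mass k)⁻¹ * ((2 * Real.sqrt C1 + 4 * Real.sqrt C2) * Real.sqrt M * (1 + d) * L) := by
    ring
  rw [e0]
  refine mul_le_mul_of_nonneg_left ?_ (by positivity)
  have e1 : 0 ≤ Real.sqrt C1 * Real.sqrt M * L * d := by positivity
  have e2 : 0 ≤ Real.sqrt C2 * Real.sqrt M * L := by positivity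
  linarith

end

section

/-! ### The Green function -/

theorem abs_log_sub_log_le {c x y : ℝ} (hc : 0 < c) (hx : c ≤ x) (hy : c ≤ y) :
    |Real.log x - Real.log y| ≤ |x - y| / c := by
  have key : ∀ x y : ℝ, c ≤ x → c ≤ y → Real.log x - Real.log y ≤ |x - y| / c := by
    intro x y hx hy
    have hx0 : 0 < x := hc.trans_le hx
    have hy0 : 0 < y := hc.trans_le hy
    rw [← Real.log_div hx0.ne' hy0.ne']
    refine (Real.log_le_sub_one_of_pos (by positivity)).trans ?_
    have e : x / y - 1 = (x - y) / y := by field_simp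
    rw [e]
    exact div_le_div₀ (abs_nonneg _) (le_abs_self _) hc hy
  rw [abs_le]
  have h1 := key x y hx hy
  have h2 := key y x hy hx
  rw [abs_sub_comm] at h2
  constructor <;> linarith

theorem norm_normalize_sub_le {E : Type*} [NormedAddCommGroup E] [NormedSpace ℝ E] {x y : E}
    (hx : x ≠ 0) (hy : y ≠ 0) : ‖‖x‖⁻¹ • x - ‖y‖⁻¹ • y‖ ≤ 2 * ‖x - y‖ / ‖x‖ := by
  have hx0 := norm_pos_iff.2 hx
  have hy0 := norm_pos_iff.2 hy
  have e : ‖x‖⁻¹ • x - ‖y‖⁻¹ • y = ‖x‖⁻¹ • (x - y) + (‖x‖⁻¹ - ‖y‖⁻¹) • y := by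
    rw [smul_sub, sub_smul]; abel
  rw [e]
  refine (norm_add_le _ _).trans ?_
  rw [norm_smul, norm_smul, Real.norm_of_nonneg (inv_nonneg.2 hx0.le), Real.norm_eq_abs]
  have e1 : ‖x‖⁻¹ - ‖y‖⁻¹ = (‖y‖ - ‖x‖) / (‖x‖ * ‖y‖) := by field_simp
  have e2 : |‖x‖⁻¹ - ‖y‖⁻¹| * ‖y‖ ≤ ‖x - y‖ / ‖x‖ := by
    rw [e1, abs_div, abs_of_pos (mul_pos hx0 hy0)]
    have := abs_norm_sub_norm_le y x
    rw [norm_sub_rev] at this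
    have e3 : |‖y‖ - ‖x‖| / (‖x‖ * ‖y‖) * ‖y‖ = |‖y‖ - ‖x‖| / ‖x‖ := by field_simp
    rw [e3]
    gcongr
  have e4 : 2 * ‖x - y‖ / ‖x‖ = ‖x‖⁻¹ * ‖x - y‖ + ‖x - y‖ / ‖x‖ := by field_simp; ring
  rw [e4]
  linarith

theorem eval_smul_of_isHomogeneous {n d : ℕ} {p : MvPolynomial (Fin n) ℂ}
    (hp : p.IsHomogeneous d) (c : ℂ) (z : Fin n → ℂ) :
    MvPolynomial.eval (fun i => c * z i) p = c ^ d * MvPolynomial.eval z p := by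
  rw [MvPolynomial.eval_eq', MvPolynomial.eval_eq', Finset.mul_sum]
  refine Finset.sum_congr rfl fun m hm => ?_
  have hd : ∑ i, m i = d := by
    have := hp (MvPolynomial.mem_support_iff.1 hm)
    rw [← this, Finsupp.weight_apply, Finsupp.sum_fintype _ _ (by simp)]
    simp
  simp only [mul_pow, Finset.prod_mul_distrib, Finset.prod_pow_eq_pow_sum, hd]
  ring

theorem contDiff_eval {n : ℕ} (p : MvPolynomial (Fin n) ℂ) :
    ContDiff ℝ 1 (fun z : Cn n => MvPolynomial.eval z.ofLp p) := by
  induction p using MvPolynomial.induction_on with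
  | C a => simpa using contDiff_const
  | add p q hp hq => simpa using hp.add hq
  | mul_X p i hp =>
    have : ContDiff ℝ 1 (fun z : Cn n => z i) :=
      (EuclideanSpace.proj (𝕜 := ℂ) i : Cn n →L[ℂ] ℂ).restrictScalars ℝ |>.contDiff
    simpa using hp.mul this

variable {k d : ℕ}

theorem HolEndo.lift_smul (f : HolEndo k d) (c : ℝ) (z : Cn (k + 1)) :
    f.lift (c • z) = c ^ d • f.lift z := by
  ext j
  have h := eval_smul_of_isHomogeneous (f.homogeneous j) (c : ℂ) z.ofLp
  have e : (c • z).ofLp = fun i => (c : ℂ) * z.ofLp i := by ext i; simp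
  simp only [HolEndo.lift, e, h, PiLp.smul_apply, Complex.real_smul, Complex.ofReal_pow]

theorem HolEndo.lift_ne_zero (f : HolEndo k d) {z : Cn (k + 1)} (hz : z ≠ 0) : f.lift z ≠ 0 := by
  intro h
  refine hz ?_
  have := f.eq_zero_of_eval z.ofLp fun j => by
    have := congrArg (fun y : Cn (k + 1) => y j) h
    simpa [HolEndo.lift] using this
  ext i
  exact congrFun this i

theorem HolEndo.contDiff_lift (f : HolEndo k d) : ContDiff ℝ 1 f.lift := by
  rw [contDiff_piLp]
  exact fun j => contDiff_eval (f.F j)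

/-- The map induced by the lift on the unit sphere. -/
def HolEndo.sphereMap (f : HolEndo k d) (z : Cn (k + 1)) : Cn (k + 1) := ‖f.lift z‖⁻¹ • f.lift z

theorem HolEndo.norm_sphereMap (f : HolEndo k d) {z : Cn (k + 1)} (hz : z ≠ 0) :
    ‖f.sphereMap z‖ = 1 := by
  rw [HolEndo.sphereMap, norm_smul, norm_inv, norm_norm]
  exact inv_mul_cancel₀ (norm_ne_zero_iff.2 (f.lift_ne_zero hz))

theorem ne_zero_of_norm_eq_one {z : Cn (k + 1)} (h : ‖z‖ = 1) : z ≠ 0 := by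
  intro h0; rw [h0, norm_zero] at h; exact zero_ne_one h

theorem HolEndo.norm_iterate_sphereMap (f : HolEndo k d) {z : Cn (k + 1)} (hz : ‖z‖ = 1) (n : ℕ) :
    ‖f.sphereMap^[n] z‖ = 1 := by
  induction n with
  | zero => exact hz
  | succ n ih =>
    rw [Function.iterate_succ_apply']
    exact f.norm_sphereMap (ne_zero_of_norm_eq_one ih)

theorem HolEndo.iterate_lift_ne_zero (f : HolEndo k d) {z : Cn (k + 1)} (hz : z ≠ 0) (n : ℕ) :
    f.lift^[n] z ≠ 0 := by
  induction n with
  | zero => exact hz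
  | succ n ih => rw [Function.iterate_succ_apply']; exact f.lift_ne_zero ih

theorem HolEndo.iterate_lift_eq (f : HolEndo k d) {z : Cn (k + 1)} (hz : z ≠ 0) (n : ℕ) :
    f.lift^[n] z = ‖f.lift^[n] z‖ • f.sphereMap^[n] (‖z‖⁻¹ • z) := by
  have hz0 := norm_ne_zero_iff.2 hz
  induction n with
  | zero => simp [smul_smul, hz0]
  | succ n ih =>
    rw [Function.iterate_succ_apply', Function.iterate_succ_apply']
    have hn : ‖(f.sphereMap^[n] (‖z‖⁻¹ • z))‖ = 1 :=
      f.norm_iterate_sphereMap (by rw [norm_smul, norm_inv, norm_norm, inv_mul_cancel₀ hz0]) n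
    have hn0 := norm_ne_zero_iff.2 (f.lift_ne_zero (ne_zero_of_norm_eq_one hn))
    set y := f.sphereMap^[n] (‖z‖⁻¹ • z)
    rw [ih, f.lift_smul, HolEndo.sphereMap, norm_smul, smul_smul, norm_pow, norm_norm, mul_assoc,
      mul_inv_cancel₀ hn0, mul_one]

/-- By homogeneity the norm factors out of the next iterate. What remains is `log ‖F‖` on the unit
sphere, which is bounded, so division by `dⁿ⁺¹` gives a geometric series. -/
theorem HolEndo.log_norm_iterate_succ (f : HolEndo k d) {z : Cn (k + 1)} (hz : z ≠ 0) (n : ℕ) :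
    Real.log ‖f.lift^[n + 1] z‖ = d * Real.log ‖f.lift^[n] z‖
      + Real.log ‖f.lift (f.sphereMap^[n] (‖z‖⁻¹ • z))‖ := by
  have hz0 := norm_ne_zero_iff.2 hz
  have hn : ‖(f.sphereMap^[n] (‖z‖⁻¹ • z))‖ = 1 :=
    f.norm_iterate_sphereMap (by rw [norm_smul, norm_inv, norm_norm, inv_mul_cancel₀ hz0]) n
  have hn0 := norm_ne_zero_iff.2 (f.lift_ne_zero (ne_zero_of_norm_eq_one hn))
  have hy0 := norm_ne_zero_iff.2 (f.iterate_lift_ne_zero hz n)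
  rw [Function.iterate_succ_apply']
  conv_lhs => rw [f.iterate_lift_eq hz n, f.lift_smul, norm_smul, norm_pow, norm_norm,
    Real.log_mul (pow_ne_zero _ hy0) hn0, Real.log_pow]

/-- Uniform bounds for the lift on the unit sphere. -/
theorem HolEndo.exists_sphere_bounds (f : HolEndo k d) : ∃ H L : ℝ, 0 < H ∧ 2 ≤ L ∧
    (∀ z : Cn (k + 1), ‖z‖ = 1 → |Real.log ‖f.lift z‖| ≤ H) ∧
    ∀ z w : Cn (k + 1), ‖z‖ = 1 → ‖w‖ = 1 →
      |Real.log ‖f.lift z‖ - Real.log ‖f.lift w‖| ≤ L * ‖z - w‖ ∧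
      ‖f.sphereMap z - f.sphereMap w‖ ≤ L * ‖z - w‖ := by
  have hS : IsCompact (Metric.sphere (0 : Cn (k + 1)) 1) := isCompact_sphere 0 1
  have hc : Continuous f.lift := f.contDiff_lift.continuous
  have hne : (Metric.sphere (0 : Cn (k + 1)) 1).Nonempty := by
    refine ⟨EuclideanSpace.single 0 1, ?_⟩
    simp
  obtain ⟨K, hK⟩ := (f.contDiff_lift.locallyLipschitz.locallyLipschitzOn
    (s := Metric.sphere (0 : Cn (k + 1)) 1)).exists_lipschitzOnWith_of_compact hS
  obtain ⟨z0, hz0, hmin⟩ := hS.exists_isMinOn hne hc.norm.continuousOn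
  have hz0' : ‖z0‖ = 1 := by simpa using hz0
  set c := ‖f.lift z0‖ with hcdef
  have hcpos : 0 < c := norm_pos_iff.2 (f.lift_ne_zero (ne_zero_of_norm_eq_one hz0'))
  have hcz : ∀ z : Cn (k + 1), ‖z‖ = 1 → c ≤ ‖f.lift z‖ := fun z hz => hmin (by simpa using hz)
  have hlog : ContinuousOn (fun z => Real.log ‖f.lift z‖) (Metric.sphere (0 : Cn (k + 1)) 1) :=
    hc.norm.continuousOn.log fun z hz => (hcpos.trans_le (hcz z (by simpa using hz))).ne'
  obtain ⟨H, hH⟩ := hS.exists_bound_of_continuousOn hlog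
  refine ⟨max H 1, max 2 (2 * K / c), by positivity, le_max_left _ _, fun z hz =>
    (hH z (by simpa using hz)).trans (le_max_left _ _), fun z w hz hw => ?_⟩
  have hKzw : ‖f.lift z - f.lift w‖ ≤ K * ‖z - w‖ := by
    have := hK.dist_le_mul z (by simpa using hz) w (by simpa using hw)
    rwa [dist_eq_norm, dist_eq_norm] at this
  have hL : 2 * (K * ‖z - w‖) / c ≤ max 2 (2 * K / c) * ‖z - w‖ := by
    have := mul_le_mul_of_nonneg_right (le_max_right 2 (2 * K / c)) (norm_nonneg (z - w))
    refine le_trans (le_of_eq ?_) this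
    ring
  constructor
  · refine (abs_log_sub_log_le hcpos (hcz z hz) (hcz w hw)).trans (le_trans ?_ hL)
    have h1 := abs_norm_sub_norm_le (f.lift z) (f.lift w)
    have h2 : 0 ≤ K * ‖z - w‖ := by positivity
    gcongr
    linarith
  · refine (norm_normalize_sub_le (f.lift_ne_zero (ne_zero_of_norm_eq_one hz))
      (f.lift_ne_zero (ne_zero_of_norm_eq_one hw))).trans (le_trans ?_ hL)
    have := hcz z hz
    gcongr

theorem HolEndo.tendsto_green (hd : 2 ≤ d) (f : HolEndo k d) {z : Cn (k + 1)} (hz : z ≠ 0) :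
    Filter.Tendsto (fun n : ℕ => Real.log ‖f.lift^[n] z‖ / (d : ℝ) ^ n) Filter.atTop
      (nhds (f.green z)) := by
  obtain ⟨H, L, hH0, -, hH, -⟩ := f.exists_sphere_bounds
  have hz0 := norm_ne_zero_iff.2 hz
  have hd2 : (2 : ℝ) ≤ d := by exact_mod_cast hd
  refine tendsto_nhds_limUnder (cauchySeq_tendsto_of_complete
    (cauchySeq_of_le_geometric (1 / 2) (H / 2) (by norm_num) fun n => ?_))
  have hn := hH _ (f.norm_iterate_sphereMap (z := ‖z‖⁻¹ • z)
    (by rw [norm_smul, norm_inv, norm_norm, inv_mul_cancel₀ hz0]) n)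
  rw [dist_comm, Real.dist_eq, f.log_norm_iterate_succ hz, pow_succ]
  set b := Real.log ‖f.lift (f.sphereMap^[n] (‖z‖⁻¹ • z))‖
  have e : (d * Real.log ‖f.lift^[n] z‖ + b) / ((d : ℝ) ^ n * d)
      - Real.log ‖f.lift^[n] z‖ / (d : ℝ) ^ n = b / ((d : ℝ) ^ n * d) := by
    field_simp; ring
  rw [e, abs_div, abs_of_pos (by positivity : (0 : ℝ) < (d : ℝ) ^ n * d)]
  have e2 : H / 2 * (1 / 2) ^ n = H / (2 ^ n * 2) := by
    rw [one_div, inv_pow]; field_simp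
  rw [e2]
  gcongr

/-- The Green function is Hölder continuous. -/
theorem HolEndo.exists_green_holder (hd : 2 ≤ d) (f : HolEndo k d) : ∃ A α : ℝ, 0 < A ∧ 0 < α ∧
    ∀ z w : Cn (k + 1), 1 ≤ ‖z‖ → 1 ≤ ‖w‖ →
      |f.green z - f.green w| ≤ ‖z - w‖ + A * ‖z - w‖ ^ α := by
  obtain ⟨H, L, hH0, hL2, hH, hL⟩ := f.exists_sphere_bounds
  have hd2 : (2 : ℝ) ≤ d := by exact_mod_cast hd
  have hlogL : 0 < Real.log L := Real.log_pos (by linarith)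
  have hL0 : 0 < L := by linarith
  -- Chosen so that `L^α = √2 < d`: the expansion of the sphere map, raised to the power `α`, is
  -- beaten by the division by `dⁿ`. The bound `L ≥ 2` gives `α ≤ 1`.
  set α := Real.log (Real.sqrt 2) / Real.log L with hα
  have hs2 : 1 < Real.sqrt 2 := by
    rw [Real.lt_sqrt zero_le_one]; norm_num
  have hα0 : 0 < α := div_pos (Real.log_pos hs2) hlogL
  have hα1 : α ≤ 1 := by
    rw [hα, div_le_one hlogL]
    refine Real.log_le_log (by positivity) (le_trans ?_ hL2)
    rw [Real.sqrt_le_left zero_le_two]; norm_num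
  have hLα : L ^ α = Real.sqrt 2 := by
    rw [Real.rpow_def_of_pos hL0, hα, mul_div_cancel₀ _ hlogL.ne', Real.exp_log (by positivity)]
  set K := max (2 * H) L with hK
  have hK0 : 0 < K := by positivity
  set q := Real.sqrt 2 / 2 with hq
  have hq0 : 0 < q := by positivity
  have hq1 : q < 1 := by
    rw [hq, div_lt_one two_pos, Real.sqrt_lt' two_pos]; norm_num
  refine ⟨K * 2 ^ α * (1 - q)⁻¹, α, by
    have : 0 < 1 - q := by linarith
    positivity, hα0, ?_⟩
  intro z w hz hw
  have hz0 : z ≠ 0 := by intro h; rw [h, norm_zero] at hz; linarith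
  have hw0 : w ≠ 0 := by intro h; rw [h, norm_zero] at hw; linarith
  set z' := ‖z‖⁻¹ • z
  set w' := ‖w‖⁻¹ • w
  have hz' : ‖z'‖ = 1 := by
    rw [norm_smul, norm_inv, norm_norm, inv_mul_cancel₀ (norm_ne_zero_iff.2 hz0)]
  have hw' : ‖w'‖ = 1 := by
    rw [norm_smul, norm_inv, norm_norm, inv_mul_cancel₀ (norm_ne_zero_iff.2 hw0)]
  have hδ : ‖z' - w'‖ ≤ 2 * ‖z - w‖ := by
    refine (norm_normalize_sub_le hz0 hw0).trans (div_le_self (by positivity) hz)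
  have hiter : ∀ n, ‖f.sphereMap^[n] z' - f.sphereMap^[n] w'‖ ≤ L ^ n * (2 * ‖z - w‖) := by
    intro n
    induction n with
    | zero => simpa using hδ
    | succ n ih =>
      rw [Function.iterate_succ_apply', Function.iterate_succ_apply', pow_succ']
      have := (hL _ _ (f.norm_iterate_sphereMap hz' n) (f.norm_iterate_sphereMap hw' n)).2
      refine this.trans ?_
      rw [mul_assoc]
      exact mul_le_mul_of_nonneg_left ih hL0.le
  set δ := ‖z - w‖ with hδdef
  have hδ0 : 0 ≤ δ := norm_nonneg _
  have hstep : ∀ n, |Real.log ‖f.lift (f.sphereMap^[n] z')‖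
      - Real.log ‖f.lift (f.sphereMap^[n] w')‖| ≤ K * 2 ^ α * δ ^ α * Real.sqrt 2 ^ n := by
    intro n
    have nz := f.norm_iterate_sphereMap hz' n
    have nw := f.norm_iterate_sphereMap hw' n
    have b1 : |Real.log ‖f.lift (f.sphereMap^[n] z')‖
        - Real.log ‖f.lift (f.sphereMap^[n] w')‖| ≤ K :=
      ((abs_sub _ _).trans (add_le_add (hH _ nz) (hH _ nw))).trans
        (by rw [← two_mul]; exact le_max_left _ _)
    set y := L ^ n * (2 * δ) with hy
    have hy0 : 0 ≤ y := by positivity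
    have b2 : |Real.log ‖f.lift (f.sphereMap^[n] z')‖
        - Real.log ‖f.lift (f.sphereMap^[n] w')‖| ≤ K * y :=
      (hL _ _ nz nw).1.trans (mul_le_mul (le_max_right _ _) (hiter n) (norm_nonneg _) hK0.le)
    have e : K * 2 ^ α * δ ^ α * Real.sqrt 2 ^ n = K * y ^ α := by
      rw [hy, Real.mul_rpow (by positivity) (by positivity), Real.mul_rpow zero_le_two hδ0,
        ← hLα, ← Real.rpow_natCast L n, ← Real.rpow_natCast (L ^ α) n, ← Real.rpow_mul hL0.le,
        ← Real.rpow_mul hL0.le, mul_comm α]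
      ring
    rw [e]
    -- Interpolation: the difference is at most both `K` and `K y`, hence at most `K y^α` since `0 <
    -- α ≤ 1`.
    rcases le_total y 1 with h1 | h1
    · refine b2.trans (mul_le_mul_of_nonneg_left ?_ hK0.le)
      rcases hy0.eq_or_lt with h2 | h2
      · rw [← h2, Real.zero_rpow hα0.ne']
      · calc y = y ^ (1 : ℝ) := (Real.rpow_one y).symm
          _ ≤ y ^ α := Real.rpow_le_rpow_of_exponent_ge h2 h1 hα1
    · refine b1.trans (le_mul_of_one_le_right hK0.le (Real.one_le_rpow h1 hα0.le))
  have hsum : ∀ n, |Real.log ‖f.lift^[n] z‖ / (d : ℝ) ^ n - Real.log ‖f.lift^[n] w‖ / (d : ℝ) ^ n|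
      ≤ δ + K * 2 ^ α * δ ^ α * ∑ j ∈ Finset.range n, q ^ j := by
    intro n
    induction n with
    | zero =>
      simp only [Function.iterate_zero, id, pow_zero, div_one, Finset.range_zero, Finset.sum_empty,
        mul_zero, add_zero]
      refine (abs_log_sub_log_le one_pos hz hw).trans ?_
      rw [div_one]
      exact abs_norm_sub_norm_le z w
    | succ n ih =>
      rw [f.log_norm_iterate_succ hz0, f.log_norm_iterate_succ hw0, Finset.sum_range_succ]
      have e : ∀ a b : ℝ, (d * a + b) / (d : ℝ) ^ (n + 1) = a / (d : ℝ) ^ n + b / (d : ℝ) ^ (n + 1) :=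
        fun a b => by rw [pow_succ]; field_simp
      rw [e, e, add_sub_add_comm, ← sub_div (Real.log ‖f.lift (f.sphereMap^[n] z')‖)]
      have hdn : |(Real.log ‖f.lift (f.sphereMap^[n] z')‖
          - Real.log ‖f.lift (f.sphereMap^[n] w')‖) / (d : ℝ) ^ (n + 1)|
          ≤ K * 2 ^ α * δ ^ α * q ^ n := by
        rw [abs_div, abs_of_pos (by positivity : (0 : ℝ) < (d : ℝ) ^ (n + 1)),
          div_le_iff₀ (by positivity)]
        refine (hstep n).trans ?_
        rw [mul_assoc _ (q ^ n)]
        refine mul_le_mul_of_nonneg_left ?_ (by positivity)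
        have : Real.sqrt 2 ^ n = q ^ n * 2 ^ n := by rw [← mul_pow, hq]; simp
        rw [this]
        refine mul_le_mul_of_nonneg_left ?_ (by positivity)
        calc (2 : ℝ) ^ n ≤ 2 ^ (n + 1) := pow_le_pow_right₀ one_le_two (Nat.le_succ n)
          _ ≤ _ := pow_le_pow_left₀ zero_le_two hd2 _
      refine (abs_add_le _ _).trans ?_
      rw [mul_add]
      linarith
  have hgeo : ∀ n, ∑ j ∈ Finset.range n, q ^ j ≤ (1 - q)⁻¹ := fun n => by
    rw [geom_sum_eq hq1.ne, ← neg_div_neg_eq, neg_sub, neg_sub, div_eq_mul_inv]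
    exact mul_le_of_le_one_left (inv_nonneg.2 (by linarith)) (by
      have : 0 ≤ q ^ n := by positivity
      linarith)
  refine le_of_tendsto' (((f.tendsto_green hd hz0).sub (f.tendsto_green hd hw0)).abs) fun n => ?_
  refine (hsum n).trans ?_
  have := mul_le_mul_of_nonneg_left (hgeo n) (show 0 ≤ K * 2 ^ α * δ ^ α by positivity)
  linarith

/-- Powers are dominated by negative powers of the logarithm near zero. -/
theorem exists_rpow_le_logStar {α p : ℝ} (hα : 0 < α) (hp : 0 < p) : ∃ K : ℝ, 0 < K ∧
    ∀ s : ℝ, 0 < s → s ≤ 1 → s ^ α ≤ K * logStar s ^ (-p) := by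
  refine ⟨(1 + p / α) ^ p, by positivity, fun s hs hs1 => ?_⟩
  have hL := one_le_logStar s
  have hL0 : 0 < logStar s := by linarith
  have hβ : 0 < α / p := by positivity
  -- Use `log (1/s) ≤ s^(-β)/β` with `β = α/p`, so that raising to the power `p` gives exactly
  -- `s^(-α)`.
  have h1 : logStar s ≤ (1 + p / α) * s ^ (-(α / p)) := by
    have h2 := Real.log_le_rpow_div (inv_nonneg.2 hs.le) hβ
    rw [Real.log_inv, Real.inv_rpow hs.le, ← Real.rpow_neg hs.le] at h2
    have h3 : 1 ≤ s ^ (-(α / p)) :=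
      Real.one_le_rpow_of_pos_of_le_one_of_nonpos hs hs1 (by linarith)
    have e : s ^ (-(α / p)) / (α / p) = p / α * s ^ (-(α / p)) := by field_simp
    rw [e] at h2
    rw [logStar_of_le hs hs1]
    linarith
  have h4 := Real.rpow_le_rpow hL0.le h1 hp.le
  rw [Real.mul_rpow (by positivity) (by positivity), ← Real.rpow_mul hs.le] at h4
  have e : -(α / p) * p = -α := by field_simp
  rw [e, Real.rpow_neg hs.le] at h4
  rw [Real.rpow_neg hL0.le, ← div_eq_mul_inv, le_div_iff₀ (by positivity)]
  have h5 : 0 < s ^ α := by positivity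
  calc s ^ α * logStar s ^ p ≤ s ^ α * ((1 + p / α) ^ p * (s ^ α)⁻¹) := by gcongr
    _ = _ := by field_simp

end

section

/-! ### The Fubini-Study distance in affine charts -/

variable {k d : ℕ}

/-- The cosine of the angle between two complex lines. -/
def cosAngle {n : ℕ} (z w : Cn n) : ℝ := ‖inner ℂ z w‖ / (‖z‖ * ‖w‖)

theorem cosAngle_nonneg {n : ℕ} (z w : Cn n) : 0 ≤ cosAngle z w := by unfold cosAngle; positivity

theorem cosAngle_le_one {n : ℕ} (z w : Cn n) : cosAngle z w ≤ 1 :=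
  div_le_one_of_le₀ (norm_inner_le_norm z w) (by positivity)

theorem cosAngle_smul_left {n : ℕ} {c : ℂ} (hc : c ≠ 0) (z w : Cn n) :
    cosAngle (c • z) w = cosAngle z w := by
  have := norm_ne_zero_iff.2 hc
  rw [cosAngle, cosAngle, inner_smul_left, norm_mul, norm_smul, RCLike.norm_conj, mul_assoc,
    mul_div_mul_left _ _ this]

theorem cosAngle_comm {n : ℕ} (z w : Cn n) : cosAngle z w = cosAngle w z := by
  rw [cosAngle, cosAngle, norm_inner_symm, mul_comm ‖z‖]

theorem cosAngle_smul_right {n : ℕ} {c : ℂ} (hc : c ≠ 0) (z w : Cn n) :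
    cosAngle z (c • w) = cosAngle z w := by
  rw [cosAngle_comm, cosAngle_smul_left hc, cosAngle_comm]

theorem fsDist_mk {z w : Cn (k + 1)} (hz : z ≠ 0) (hw : w ≠ 0) :
    fsDist (Projectivization.mk ℂ z hz) (Projectivization.mk ℂ w hw)
      = Real.arccos (cosAngle z w) / Real.sqrt Real.pi := by
  obtain ⟨a, ha⟩ := Projectivization.exists_smul_eq_mk_rep ℂ z hz
  obtain ⟨b, hb⟩ := Projectivization.exists_smul_eq_mk_rep ℂ w hw
  have : cosAngle (a • z) (b • w) = cosAngle z w := by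
    rw [Units.smul_def, Units.smul_def, cosAngle_smul_left a.ne_zero, cosAngle_smul_right b.ne_zero]
  rw [← this, fsDist, ha, hb, cosAngle]

theorem norm_sub_sq_complex {n : ℕ} (z w : Cn n) :
    ‖z - w‖ ^ 2 = ‖z‖ ^ 2 - 2 * (inner ℂ z w).re + ‖w‖ ^ 2 := norm_sub_sq (𝕜 := ℂ) z w

/-- The distance from `z` to its orthogonal projection on the line `ℂw` is `‖z‖` times the sine of
the angle. -/
theorem norm_sub_proj_sq {n : ℕ} {z w : Cn n} (hz : z ≠ 0) (hw : w ≠ 0) :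
    ‖z - (inner ℂ w z / (‖w‖ : ℂ) ^ 2) • w‖ ^ 2 = ‖z‖ ^ 2 * (1 - cosAngle z w ^ 2) := by
  have hz0 := norm_ne_zero_iff.2 hz
  have hw0 := norm_ne_zero_iff.2 hw
  have e1 : (inner ℂ z ((inner ℂ w z / (‖w‖ : ℂ) ^ 2) • w)).re
      = ‖(inner ℂ z w : ℂ)‖ ^ 2 / ‖w‖ ^ 2 := by
    rw [inner_smul_right, ← inner_conj_symm w z, div_mul_eq_mul_div, Complex.conj_mul']
    rw [← Complex.ofReal_pow, ← Complex.ofReal_pow, ← Complex.ofReal_div, Complex.ofReal_re]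
  have e2 : ‖(inner ℂ w z / (‖w‖ : ℂ) ^ 2) • w‖ = ‖(inner ℂ z w : ℂ)‖ / ‖w‖ := by
    rw [norm_smul, norm_div, norm_pow, Complex.norm_real, norm_norm, norm_inner_symm]
    field_simp
  rw [norm_sub_sq_complex, e1, e2, cosAngle]
  field_simp
  ring

theorem mul_one_sub_cosAngle_sq_le {n : ℕ} {z w : Cn n} (hz : z ≠ 0) (hw : w ≠ 0) :
    ‖z‖ ^ 2 * (1 - cosAngle z w ^ 2) ≤ ‖z - w‖ ^ 2 := by
  have hz0 := norm_pos_iff.2 hz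
  have hw0 := norm_pos_iff.2 hw
  have h1 : (inner ℂ z w).re ≤ ‖(inner ℂ z w : ℂ)‖ := Complex.re_le_norm _
  have e : ‖z‖ ^ 2 * (1 - cosAngle z w ^ 2) = ‖z‖ ^ 2 - (‖(inner ℂ z w : ℂ)‖ / ‖w‖) ^ 2 := by
    rw [cosAngle]; field_simp
  have h2 := sq_nonneg (‖w‖ - ‖(inner ℂ z w : ℂ)‖ / ‖w‖)
  have e2 : (‖w‖ - ‖(inner ℂ z w : ℂ)‖ / ‖w‖) ^ 2
      = ‖w‖ ^ 2 - 2 * ‖(inner ℂ z w : ℂ)‖ + (‖(inner ℂ z w : ℂ)‖ / ‖w‖) ^ 2 := by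
    field_simp
    ring
  rw [norm_sub_sq_complex, e]
  linarith

theorem sqrt_pi_le_two : Real.sqrt Real.pi ≤ 2 := by
  rw [Real.sqrt_le_left zero_le_two]; linarith [Real.pi_le_four]

theorem arccos_le_pi_div_two_mul {c : ℝ} (h0 : 0 ≤ c) :
    Real.arccos c ≤ Real.pi / 2 * Real.sqrt (1 - c ^ 2) := by
  have h := Real.mul_le_sin (Real.arccos_nonneg c) (Real.arccos_le_pi_div_two.2 h0)
  rw [Real.sin_arccos] at h
  have := Real.pi_pos
  calc Real.arccos c = Real.pi / 2 * (2 / Real.pi * Real.arccos c) := by field_simp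
    _ ≤ _ := by gcongr

theorem sqrt_le_arccos {c : ℝ} : Real.sqrt (1 - c ^ 2) ≤ Real.arccos c := by
  rw [← Real.sin_arccos]; exact Real.sin_le (Real.arccos_nonneg c)

/-- The angle is at most `π/2`, so the distance is at most `√π/2`. Consequently `log⋆` is decreasing
in every positive distance that occurs. -/
theorem fsDist_le_one (a b : Pk k) : fsDist a b ≤ 1 := by
  have hπ := Real.sqrt_pos.2 Real.pi_pos
  rw [fsDist, div_le_one hπ]
  refine (Real.arccos_le_pi_div_two.2 (cosAngle_nonneg a.rep b.rep)).trans ?_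
  have := Real.mul_self_sqrt Real.pi_pos.le
  nlinarith [sqrt_pi_le_two]

theorem fsDist_nonneg (a b : Pk k) : 0 ≤ fsDist a b :=
  div_nonneg (Real.arccos_nonneg _) (Real.sqrt_nonneg _)

theorem sqrt_one_sub_cosAngle_sq_le (a b : Pk k) :
    Real.sqrt (1 - cosAngle a.rep b.rep ^ 2) ≤ 2 * fsDist a b := by
  have hπ := Real.sqrt_pos.2 Real.pi_pos
  refine sqrt_le_arccos.trans ?_
  have e : Real.arccos (cosAngle a.rep b.rep) = Real.sqrt Real.pi * fsDist a b := by
    rw [fsDist, cosAngle]; field_simp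
  rw [e]
  exact mul_le_mul_of_nonneg_right sqrt_pi_le_two (fsDist_nonneg a b)

/-- Needed because `Real.log 0 = 0` gives `log⋆ 0 = 1`: distance zero must be treated separately in
every estimate with `log⋆`. -/
theorem eq_of_fsDist_eq_zero {a b : Pk k} (h : fsDist a b = 0) : a = b := by
  have h1 := sqrt_one_sub_cosAngle_sq_le a b
  rw [h, mul_zero] at h1
  have h2 := norm_sub_proj_sq a.rep_nonzero b.rep_nonzero
  have h3 : 1 - cosAngle a.rep b.rep ^ 2 ≤ 0 := Real.sqrt_eq_zero'.1 (le_antisymm h1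
    (Real.sqrt_nonneg _))
  have h4 : ‖a.rep - (inner ℂ b.rep a.rep / (‖b.rep‖ : ℂ) ^ 2) • b.rep‖ ^ 2 ≤ 0 := by
    rw [h2]; exact mul_nonpos_of_nonneg_of_nonpos (by positivity) h3
  have h5 : a.rep - (inner ℂ b.rep a.rep / (‖b.rep‖ : ℂ) ^ 2) • b.rep = 0 := by
    rw [← norm_eq_zero]
    exact pow_eq_zero_iff two_ne_zero |>.1 (le_antisymm h4 (by positivity))
  rw [← a.mk_rep, ← b.mk_rep, Projectivization.mk_eq_mk_iff']
  exact ⟨_, (sub_eq_zero.1 h5).symm⟩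

theorem norm_affineLift_sub (i : Fin (k + 1)) (w w' : Cn k) :
    ‖affineLift i w - affineLift i w'‖ = ‖w - w'‖ := by
  rw [← sq_eq_sq₀ (norm_nonneg _) (norm_nonneg _), EuclideanSpace.norm_sq_eq,
    EuclideanSpace.norm_sq_eq, Fin.sum_univ_succAbove _ i]
  simp [affineLift]

theorem norm_affineLift_sq (i : Fin (k + 1)) (w : Cn k) :
    ‖affineLift i w‖ ^ 2 = 1 + ‖w‖ ^ 2 := by
  rw [EuclideanSpace.norm_sq_eq, EuclideanSpace.norm_sq_eq, Fin.sum_univ_succAbove _ i]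
  simp [affineLift]

theorem one_le_norm_affineLift (i : Fin (k + 1)) (w : Cn k) : 1 ≤ ‖affineLift i w‖ := by
  have := norm_affineLift_sq i w
  nlinarith [norm_nonneg (affineLift i w), sq_nonneg ‖w‖]

theorem continuous_affineLift (i : Fin (k + 1)) : Continuous (affineLift (k := k) i) :=
  (Isometry.of_dist_eq fun x y => by
    rw [dist_eq_norm, dist_eq_norm, norm_affineLift_sub]).continuous

/-- The lifts have norm at least `1`, so the sine of their angle is at most `‖w - w'‖`. The angle is
at most `π/2` times its sine, and `π/2 ≤ √π`. -/
theorem fsDist_affineChart_le (i : Fin (k + 1)) (w w' : Cn k) :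
    fsDist (affineChart i w) (affineChart i w') ≤ ‖w - w'‖ := by
  rw [affineChart, affineChart, fsDist_mk]
  set z := affineLift i w
  set z' := affineLift i w'
  have hz1 : 1 ≤ ‖z‖ := one_le_norm_affineLift i w
  have h1 := mul_one_sub_cosAngle_sq_le (affineLift_ne_zero i w) (affineLift_ne_zero i w')
  rw [norm_affineLift_sub] at h1
  have hc := cosAngle_le_one z z'
  have hc0 := cosAngle_nonneg z z'
  have h2 : Real.sqrt (1 - cosAngle z z' ^ 2) ≤ ‖w - w'‖ := by
    rw [Real.sqrt_le_left (norm_nonneg _)]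
    refine le_trans ?_ h1
    refine le_mul_of_one_le_left (by nlinarith) (one_le_pow₀ hz1)
  have hπ := Real.sqrt_pos.2 Real.pi_pos
  rw [div_le_iff₀ hπ]
  refine (arccos_le_pi_div_two_mul hc0).trans ?_
  have h3 : Real.pi / 2 ≤ Real.sqrt Real.pi := by
    have := Real.mul_self_sqrt Real.pi_pos.le
    nlinarith [sqrt_pi_le_two]
  rw [mul_comm]
  exact mul_le_mul h2 h3 (by positivity) (norm_nonneg _)

theorem exists_affineChart_eq {b : Pk k} {i : Fin (k + 1)} {y : Cn (k + 1)} {c : ℂ}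
    (hy : y = c • b.rep) (hi : y i ≠ 0) :
    ∃ w : Cn k, b = affineChart i w ∧ affineLift i w = (y i)⁻¹ • y := by
  have hc : c ≠ 0 := by rintro rfl; rw [hy] at hi; simp at hi
  set w : Cn k := WithLp.toLp 2 fun j => (y i)⁻¹ * y (i.succAbove j)
  have hl : affineLift i w = (y i)⁻¹ • y := by
    ext j
    refine Fin.succAboveCases i ?_ (fun j => ?_) j
    · simp [affineLift, hi]
    · simp [affineLift, w]
  refine ⟨w, ?_, hl⟩
  conv_lhs => rw [← b.mk_rep]
  rw [affineChart, Projectivization.mk_eq_mk_iff']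
  refine ⟨((y i)⁻¹ * c)⁻¹, ?_⟩
  rw [hl, hy, smul_smul, smul_smul, mul_assoc, inv_mul_cancel₀, one_smul]
  rw [← hy]
  exact mul_ne_zero (inv_ne_zero hi) hc

theorem exists_affineChart (a : Pk k) :
    ∃ (i : Fin (k + 1)) (w : Cn k), a = affineChart i w ∧ ‖w‖ ^ 2 ≤ k := by
  -- Dividing by the largest homogeneous coordinate makes all affine coordinates of modulus at most
  -- `1`.
  obtain ⟨i, hi⟩ := Finite.exists_max fun i : Fin (k + 1) => ‖a.rep i‖
  have hi0 : a.rep i ≠ 0 := by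
    intro h
    refine a.rep_nonzero ?_
    ext j
    have := hi j
    rw [h, norm_zero] at this
    exact norm_le_zero_iff.1 this
  obtain ⟨w, hw, hl⟩ := exists_affineChart_eq (b := a) (y := a.rep) (c := 1) (one_smul _ _).symm hi0
  refine ⟨i, w, hw, ?_⟩
  rw [EuclideanSpace.norm_sq_eq]
  have : ∀ j, ‖w j‖ ^ 2 ≤ 1 := fun j => by
    have e : w j = (a.rep i)⁻¹ * a.rep (i.succAbove j) := by
      have := congrArg (fun x : Cn (k + 1) => x (i.succAbove j)) hl
      simpa [affineLift] using this
    rw [e, norm_mul, norm_inv, inv_mul_eq_div]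
    exact pow_le_one₀ (by positivity) (div_le_one_of_le₀ (hi _) (norm_nonneg _))
  refine (Finset.sum_le_sum fun j _ => this j).trans ?_
  simp

theorem sub_inv_smul_eq {E : Type*} [AddCommGroup E] [Module ℂ E] {c : ℂ} (hc : c ≠ 0) (z y : E) :
    z - c⁻¹ • y = c⁻¹ • ((z - y) - (1 - c) • z) := by
  rw [smul_sub, smul_smul, smul_sub, mul_sub, mul_one, inv_mul_cancel₀ hc, sub_smul, one_smul]
  abel

/-- Nearby points have nearby coordinates in a suitable chart. -/
theorem exists_affineChart_near : ∃ B C δ : ℝ, 1 ≤ B ∧ 1 ≤ C ∧ 0 < δ ∧ C * δ ≤ 1 / 2 ∧ (k : ℝ) ≤ B ^ 2 ∧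
    ∀ a b : Pk k, fsDist a b ≤ δ → ∃ (i : Fin (k + 1)) (w w' : Cn k),
      a = affineChart i w ∧ b = affineChart i w' ∧ ‖w‖ ≤ B ∧ ‖w - w'‖ ≤ C * fsDist a b := by
  set B := Real.sqrt (1 + k) with hB
  have hB2 : B ^ 2 = 1 + k := Real.sq_sqrt (by positivity)
  have hB1 : 1 ≤ B := Real.one_le_sqrt.2 (by simp)
  have hB0 : 0 < B := by linarith
  have hC1 : 1 ≤ 4 * B * (1 + B) := by nlinarith
  refine ⟨B, 4 * B * (1 + B), (2 * (4 * B * (1 + B)))⁻¹, hB1, hC1, by positivity, ?_, by linarith, ?_⟩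
  · refine le_of_eq ?_
    field_simp
  intro a b hab
  obtain ⟨i, w, ha, hw⟩ := exists_affineChart a
  set z := affineLift i w with hz
  have hz0 : z ≠ 0 := affineLift_ne_zero i w
  have hzB : ‖z‖ ≤ B := by
    rw [hB]; refine Real.le_sqrt_of_sq_le ?_
    rw [hz, norm_affineLift_sq]; linarith
  have hz1 : z i = 1 := by simp [hz, affineLift]
  -- The orthogonal projection of `z` on the line `b`. It is close to `z`, whose `i`-th coordinate
  -- is `1`, so `y i` stays away from `0` and `b` lies in the same chart.
  set y := (inner ℂ b.rep z / (‖b.rep‖ : ℂ) ^ 2) • b.rep with hy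
  set δ := fsDist a b with hδ
  have hδ0 : 0 ≤ δ := fsDist_nonneg a b
  have hzy : ‖z - y‖ ≤ 2 * B * δ := by
    have h1 : ‖z - y‖ ^ 2 = ‖z‖ ^ 2 * (1 - cosAngle z b.rep ^ 2) :=
      norm_sub_proj_sq hz0 b.rep_nonzero
    have h2 : Real.sqrt (1 - cosAngle z b.rep ^ 2) ≤ 2 * δ := by
      have e : cosAngle a.rep b.rep = cosAngle z b.rep := by
        obtain ⟨c, hc⟩ := Projectivization.exists_smul_eq_mk_rep ℂ z hz0
        have e' : a.rep = c • z := by rw [hc, ha]; rfl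
        rw [e', Units.smul_def, cosAngle_smul_left c.ne_zero]
      have := sqrt_one_sub_cosAngle_sq_le a b
      rwa [e] at this
    have h3 : ‖z - y‖ = ‖z‖ * Real.sqrt (1 - cosAngle z b.rep ^ 2) := by
      rw [← Real.sqrt_sq (norm_nonneg (z - y)), h1, Real.sqrt_mul (by positivity),
        Real.sqrt_sq (norm_nonneg z)]
    rw [h3]
    calc ‖z‖ * Real.sqrt (1 - cosAngle z b.rep ^ 2) ≤ B * (2 * δ) := by gcongr
      _ = _ := by ring
  have hyi : ‖1 - y i‖ ≤ 2 * B * δ := by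
    have := (norm_apply_le (z - y) i).trans hzy
    rwa [PiLp.sub_apply, hz1] at this
  have hsmall : 2 * B * δ ≤ 1 / 2 := by
    have h1 : 2 * B * δ ≤ 2 * B * (2 * (4 * B * (1 + B)))⁻¹ :=
      mul_le_mul_of_nonneg_left hab (by positivity)
    refine h1.trans ?_
    have e : 2 * B * (2 * (4 * B * (1 + B)))⁻¹ = 1 / (4 * (1 + B)) := by field_simp
    rw [e]
    exact one_div_le_one_div_of_le two_pos (by linarith)
  have hyi2 : 1 / 2 ≤ ‖y i‖ := by
    have := norm_sub_norm_le (1 : ℂ) (y i)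
    rw [norm_one] at this
    linarith
  have hyi0 : y i ≠ 0 := by
    intro h; rw [h, norm_zero] at hyi2; linarith
  obtain ⟨w', hb, hl⟩ := exists_affineChart_eq hy hyi0
  refine ⟨i, w, w', ha, hb, ?_, ?_⟩
  · rw [hB]; exact Real.le_sqrt_of_sq_le (by linarith)
  · rw [← norm_affineLift_sub i, hl, ← hz]
    rw [sub_inv_smul_eq hyi0, norm_smul, norm_inv]
    have h1 : ‖y i‖⁻¹ ≤ 2 := by
      rw [inv_le_comm₀ (by linarith) two_pos]; linarith
    have h2 : ‖(z - y) - (1 - y i) • z‖ ≤ 2 * B * δ + 2 * B * δ * B := by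
      refine (norm_sub_le _ _).trans (add_le_add hzy ?_)
      rw [norm_smul]
      exact mul_le_mul hyi hzB (norm_nonneg _) (by positivity)
    calc ‖y i‖⁻¹ * ‖(z - y) - (1 - y i) • z‖ ≤ 2 * (2 * B * δ + 2 * B * δ * B) := by gcongr
      _ = _ := by ring

/-- The point `[1 : … : 1]` has the same coordinates in every chart; it links the charts in the
global oscillation bound. -/
theorem affineChart_one (i : Fin (k + 1)) :
    affineChart i (WithLp.toLp 2 fun _ => (1 : ℂ)) = affineChart 0 (WithLp.toLp 2 fun _ => (1 : ℂ)) := by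
  have h : ∀ i : Fin (k + 1), affineLift i (WithLp.toLp 2 fun _ => (1 : ℂ))
      = WithLp.toLp 2 fun _ => (1 : ℂ) := fun i => by
    ext j
    refine Fin.succAboveCases i ?_ (fun j => ?_) j <;> simp [affineLift]
  simp only [affineChart, h]

theorem ContinuousOnPk.continuous_affineChart {g : Pk k → ℝ} (hg : ContinuousOnPk g)
    (i : Fin (k + 1)) : Continuous fun w => g (affineChart i w) :=
  hg.comp (f := fun w : Cn k => (⟨affineLift i w, affineLift_ne_zero i w⟩ :
    {z : Cn (k + 1) // z ≠ 0})) ((continuous_affineLift i).subtype_mk _)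

/-! ### Potentials in affine charts -/

/-- A function with a logarithmic modulus of continuity at small scales. -/
def HasLogModulus (h : Cn k → ℝ) (M p : ℝ) : Prop :=
  ∀ x s, 0 < s → s ≤ 1 / 2 → ∀ y, ‖y - x‖ ≤ s → |h y - h x| ≤ M * logStar s ^ (-p)

theorem HasLogModulus.continuous {h : Cn k → ℝ} {M p : ℝ} (hp : 0 < p) (hh : HasLogModulus h M p) :
    Continuous h := by
  have hlim : Filter.Tendsto (fun s => M * logStar s ^ (-p)) (nhdsWithin 0 (Set.Ioi 0)) (nhds 0) := by
    have h1 : Filter.Tendsto logStar (nhdsWithin 0 (Set.Ioi 0)) Filter.atTop :=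
      Filter.tendsto_atTop_add_const_left _ 1
        (Filter.tendsto_abs_atBot_atTop.comp Real.tendsto_log_nhdsGT_zero)
    simpa using ((tendsto_rpow_neg_atTop hp).comp h1).const_mul M
  rw [continuous_iff_continuousAt]
  intro x
  rw [Metric.continuousAt_iff]
  intro ε hε
  obtain ⟨s, ⟨hs1, hs2⟩, hs0⟩ := ((hlim.eventually_lt_const hε).and
    (mem_nhdsWithin_of_mem_nhds (Iic_mem_nhds (show (0 : ℝ) < 1 / 2 by norm_num)))).and
    self_mem_nhdsWithin |>.exists
  refine ⟨s, hs0, fun y hy => ?_⟩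
  rw [Real.dist_eq]
  rw [dist_eq_norm] at hy
  exact (hh x s hs0 hs2 y hy.le).trans_lt hs1

theorem HasLogModulus.add {h h' : Cn k → ℝ} {M M' p : ℝ} (hh : HasLogModulus h M p)
    (hh' : HasLogModulus h' M' p) : HasLogModulus (fun w => h w + h' w) (M + M') p := by
  intro x s hs hs2 y hy
  have h1 := hh x s hs hs2 y hy
  have h2 := hh' x s hs hs2 y hy
  rw [add_sub_add_comm, add_mul]
  exact (abs_add_le _ _).trans (add_le_add h1 h2)

theorem abs_sub_mul_logStar_le {q c : ℝ} (hc : 0 ≤ c) {g : Pk k → ℝ}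
    (hg : logSeminorm q g ≤ ENNReal.ofReal c) (a b : Pk k) :
    |g a - g b| * logStar (fsDist a b) ^ q ≤ c := by
  have h1 : ENNReal.ofReal (|g a - g b| * logStar (fsDist a b) ^ q) ≤ ENNReal.ofReal c :=
    (le_iSup₂_of_le a b le_rfl).trans hg
  exact (ENNReal.ofReal_le_ofReal_iff hc).1 h1

theorem hasLogModulus_affineChart {p : ℝ} (hp : 0 < p) {g : Pk k → ℝ} (hg : logSeminorm p g ≤ 1)
    (i : Fin (k + 1)) : HasLogModulus (fun w => g (affineChart i w)) 1 p := by
  intro x s hs hs2 y hy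
  have hLs := one_le_logStar s
  have h1 := abs_sub_mul_logStar_le zero_le_one (by simpa using hg) (affineChart i y)
    (affineChart i x)
  have h2 := fsDist_affineChart_le i y x
  set δ := fsDist (affineChart i y) (affineChart i x) with hδ
  rw [one_mul]
  simp only
  rcases (fsDist_nonneg (affineChart i y) (affineChart i x)).eq_or_lt with h0 | h0
  · rw [eq_of_fsDist_eq_zero h0.symm, sub_self, abs_zero]
    exact Real.rpow_nonneg (by linarith) _
  · have hLδ : logStar s ≤ logStar δ := logStar_anti h0 (h2.trans hy) (by linarith)
    have hpos : 0 < logStar δ ^ p := Real.rpow_pos_of_pos (by linarith) _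
    have hpos' : 0 < logStar s ^ p := Real.rpow_pos_of_pos (by linarith) _
    rw [Real.rpow_neg (by linarith), ← one_div, le_div_iff₀ hpos']
    refine le_trans (mul_le_mul_of_nonneg_left ?_ (abs_nonneg _)) h1
    exact Real.rpow_le_rpow (by linarith) hLδ hp.le

theorem HolEndo.exists_hasLogModulus_green (hd : 2 ≤ d) (f : HolEndo k d) {p : ℝ} (hp : 0 < p) :
    ∃ M : ℝ, 0 < M ∧ ∀ i : Fin (k + 1), HasLogModulus (fun w => f.green (affineLift i w)) M p := by
  obtain ⟨A, α, hA, hα, h⟩ := f.exists_green_holder hd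
  obtain ⟨K1, hK1, h1⟩ := exists_rpow_le_logStar one_pos hp
  obtain ⟨K2, hK2, h2⟩ := exists_rpow_le_logStar hα hp
  refine ⟨K1 + A * K2, by positivity, fun i x s hs hs2 y hy => ?_⟩
  have h3 := h _ _ (one_le_norm_affineLift i y) (one_le_norm_affineLift i x)
  rw [norm_affineLift_sub] at h3
  have h4 := h1 s hs (by linarith)
  have h5 := h2 s hs (by linarith)
  rw [Real.rpow_one] at h4
  have h6 : ‖y - x‖ ^ α ≤ s ^ α := Real.rpow_le_rpow (norm_nonneg _) hy hα.le
  have h7 := mul_le_mul_of_nonneg_left (h6.trans h5) hA.le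
  refine h3.trans ?_
  linarith

/-- In each chart `S` has the local potential Green function plus `u_S`, and `g` plays the role of
`u` relative to it. -/
theorem HasDynPotential.energyBound {f : HolEndo k d} {S : CurrentPk k} {uS : Pk k → ℝ}
    (hS : HasDynPotential f S uS) (i : Fin (k + 1))
    (hγ : Continuous fun w => f.green (affineLift i w))
    (hu : Continuous fun w => uS (affineChart i w)) {g : Pk k → ℝ} (hg : g ∈ familyF S) :
    ∃ G, EnergyBound (⊤ : TopologicalSpace.Opens (Cn k)) (fun w => g (affineChart i w))
      (fun w => f.green (affineLift i w) + uS (affineChart i w)) G := by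
  obtain ⟨hgc, hG⟩ := hg
  obtain ⟨G, hG1, hG2⟩ := hG i
  refine ⟨G, energyBound_of_isPositive (hgc.continuous_affineChart i).continuousOn
    (hγ.add hu).continuousOn hG1 (fun φ hφ => ?_) hG2⟩
  rw [hS.eq_add i, integral_lap_mul (Ω := ⊤)
    (v := fun w => f.green (affineLift i w) + uS (affineChart i w)) (hγ.add hu).continuousOn hφ, Finset.mul_sum]
  refine Finset.sum_congr rfl fun j _ => ?_
  change (ddc ⊤ (fun w => f.green (affineLift i w)) j j hφ.toTest
    + ddc ⊤ (fun w => uS (affineChart i w)) j j hφ.toTest).re = _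
  rw [Complex.add_re, ddc_apply_self_re hγ.continuousOn, ddc_apply_self_re hu.continuousOn,
    ← mul_add, ← integral_add ((hφ.lap_isTest j).integrable_mul_of_continuousOn hγ.continuousOn)
      ((hφ.lap_isTest j).integrable_mul_of_continuousOn hu.continuousOn)]
  simp only [mul_add]

/-! ### Uniform logarithmic continuity on `ℙᵏ` -/

theorem exists_logSeminorm_le (hk : 1 ≤ k) (hd : 2 ≤ d) (f : HolEndo k d) {p q : ℝ} (hp : 1 < p)
    (hq0 : 0 < q) (hq : q ≤ (p - 1) / 2) : ∃ c : ℝ, 0 < c ∧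
      ∀ (S : CurrentPk k) (uS : Pk k → ℝ), HasDynPotential f S uS → logSeminorm p uS ≤ 1 →
        ∀ g ∈ familyF S, logSeminorm q g ≤ ENNReal.ofReal c := by
  have hp0 : 0 < p := by linarith
  obtain ⟨C, hC0, hC⟩ := exists_abs_sub_le_logStar hk hp
  obtain ⟨Mγ, hMγ, hγ⟩ := f.exists_hasLogModulus_green hd hp0
  obtain ⟨B, C3, δ0, hB1, hC3, hδ0, hCδ, hkB, hnear⟩ := exists_affineChart_near (k := k)
  set M := Mγ + 1 with hM
  have hM0 : 0 < M := by positivity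
  set R := B + 1 with hR
  set D := C * Real.sqrt M * (1 + 2 * R / (1 / 2)) with hD
  have hR0 : 0 < R := by linarith
  have hD0 : 0 < D := by positivity
  have hlogC : 0 ≤ Real.log C3 := Real.log_nonneg hC3
  refine ⟨max (2 * D * logStar δ0 ^ q) (C * Real.sqrt M * 2 * (1 + Real.log C3) ^ q),
    lt_max_of_lt_right (by positivity), ?_⟩
  intro S uS hS huS g hg
  have hlocal : ∀ i, ∀ w w' : Cn k, ‖w‖ ≤ R → ‖w'‖ ≤ R → ∀ r, 0 < r → r ≤ 1 / 2 →
      |g (affineChart i w) - g (affineChart i w')|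
        ≤ C * Real.sqrt M * (1 + ‖w - w'‖ / r) * logStar r ^ ((1 - p) / 2) := by
    intro i w w' hw hw' r hr hr2
    have hu := hasLogModulus_affineChart hp0 huS i
    obtain ⟨G, hG⟩ := hS.energyBound i ((hγ i).continuous hp0) (hu.continuous hp0) hg
    exact hC ⊤ _ _ G hG M hM0.le 0 R r hr hr2 (fun _ _ => trivial)
      (fun x _ s hs hsr y hy => ((hγ i).add hu) x s hs (hsr.trans hr2) y hy)
      w (by simpa using hw) w' (by simpa using hw')
  have hosc : ∀ i, ∀ w w' : Cn k, ‖w‖ ≤ R → ‖w'‖ ≤ R →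
      |g (affineChart i w) - g (affineChart i w')| ≤ D := by
    intro i w w' hw hw'
    -- The factor `1 + ‖w - w'‖ / r` allows points that are not close, so the fixed radius `1/2`
    -- already bounds the oscillation on the whole ball.
    refine (hlocal i w w' hw hw' (1 / 2) (by norm_num) le_rfl).trans ?_
    have h1 : logStar (1 / 2) ^ ((1 - p) / 2) ≤ 1 :=
      Real.rpow_le_one_of_one_le_of_nonpos (one_le_logStar _) (by linarith)
    have h2 : ‖w - w'‖ ≤ 2 * R := (norm_sub_le _ _).trans (by linarith)
    refine (mul_le_of_le_one_right (by positivity) h1).trans ?_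
    rw [hD]
    gcongr
  have hsmall : ∀ w : Cn k, ‖w‖ ^ 2 ≤ k → ‖w‖ ≤ R := fun w hw => by
    have : ‖w‖ ≤ B := le_of_sq_le_sq (hw.trans hkB) (by linarith)
    linarith
  have hglobal : ∀ a b, |g a - g b| ≤ 2 * D := by
    have h1 : ∀ a, |g a - g (affineChart 0 (WithLp.toLp 2 fun _ => (1 : ℂ)))| ≤ D := fun a => by
      obtain ⟨i, w, rfl, hw⟩ := exists_affineChart a
      rw [← affineChart_one i]
      refine hosc i _ _ (hsmall w hw) (hsmall _ ?_)
      rw [EuclideanSpace.norm_sq_eq]; simp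
    intro a b
    have h2 := abs_le.1 (h1 a)
    have h3 := abs_le.1 (h1 b)
    rw [abs_le]; constructor <;> linarith
  refine iSup₂_le fun a b => ENNReal.ofReal_le_ofReal ?_
  set δ := fsDist a b with hδ
  have hLδ := one_le_logStar δ
  have hLδq : 0 ≤ logStar δ ^ q := Real.rpow_nonneg (by linarith) _
  rcases (fsDist_nonneg a b).eq_or_lt with h0 | h0
  · rw [eq_of_fsDist_eq_zero h0.symm, sub_self, abs_zero, zero_mul]
    exact le_max_of_le_right (by positivity)
  -- Distant points use the global oscillation bound. Near points share a chart, and the local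
  -- estimate is applied at radius `C3 * δ`, whose `log⋆` is comparable with that of `δ`.
  rcases le_total δ0 δ with h1 | h1
  · refine le_max_of_le_left (mul_le_mul (hglobal a b) ?_ hLδq (by positivity))
    exact Real.rpow_le_rpow (by linarith) (logStar_anti hδ0 h1 (fsDist_le_one a b)) hq0.le
  · refine le_max_of_le_right ?_
    obtain ⟨i, w, w', rfl, rfl, hw, hww⟩ := hnear a b h1
    rw [← hδ] at hww
    have hr0 : 0 < C3 * δ := mul_pos (by linarith) h0
    have hr2 : C3 * δ ≤ 1 / 2 := (mul_le_mul_of_nonneg_left h1 (by linarith)).trans hCδ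
    have hw' : ‖w'‖ ≤ R := by
      have := norm_sub_norm_le w' w
      rw [norm_sub_rev] at this
      linarith
    have h2 := hlocal i w w' (by linarith) hw' (C3 * δ) hr0 hr2
    have h3 : ‖w - w'‖ / (C3 * δ) ≤ 1 := (div_le_one hr0).2 hww
    have hLr := one_le_logStar (C3 * δ)
    have hLr0 : 0 < logStar (C3 * δ) := by linarith
    have hLcomp : logStar δ ≤ (1 + Real.log C3) * logStar (C3 * δ) := by
      have e : logStar δ = logStar (C3 * δ) + Real.log C3 := by
        rw [logStar_of_le h0 (fsDist_le_one _ _), logStar_of_le hr0 (by linarith),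
          Real.log_mul (by linarith) h0.ne']
        ring
      rw [e]; nlinarith
    have h4 : logStar δ ^ q ≤ (1 + Real.log C3) ^ q * logStar (C3 * δ) ^ q := by
      rw [← Real.mul_rpow (by linarith) hLr0.le]
      exact Real.rpow_le_rpow (by linarith) hLcomp hq0.le
    have h5 : logStar (C3 * δ) ^ ((1 - p) / 2) * logStar (C3 * δ) ^ q ≤ 1 := by
      rw [← Real.rpow_add hLr0]
      exact Real.rpow_le_one_of_one_le_of_nonpos hLr (by linarith)
    have h6 : 0 ≤ logStar (C3 * δ) ^ ((1 - p) / 2) := Real.rpow_nonneg hLr0.le _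
    have h7 : 0 < (1 + Real.log C3) ^ q := by positivity
    calc _ ≤ C * Real.sqrt M * (1 + 1) * logStar (C3 * δ) ^ ((1 - p) / 2)
          * ((1 + Real.log C3) ^ q * logStar (C3 * δ) ^ q) := by
          refine mul_le_mul (h2.trans ?_) h4 hLδq (by positivity)
          gcongr
      _ = C * Real.sqrt M * 2 * (1 + Real.log C3) ^ q
          * (logStar (C3 * δ) ^ ((1 - p) / 2) * logStar (C3 * δ) ^ q) := by ring
      _ ≤ _ := mul_le_of_le_one_right (by positivity) h5

/-- A bound for a logarithmic semi-norm gives a uniform modulus of continuity. -/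
theorem exists_fsDist_lt_imp {q c ε : ℝ} (hq : 0 < q) (hc : 0 < c) (hε : 0 < ε) :
    ∃ δ : ℝ, 0 < δ ∧ ∀ g : Pk k → ℝ, logSeminorm q g ≤ ENNReal.ofReal c →
      ∀ a b : Pk k, fsDist a b < δ → |g a - g b| < ε := by
  -- At distance below `exp (1 - X)` one has `log⋆ ≥ X`, so its `q`-th power is at least `c/ε + 1`.
  -- An oscillation of size `ε` would then exceed the bound `c`.
  set X := (c / ε + 1) ^ (1 / q) with hX
  have hcε : 0 < c / ε := by positivity
  have hX1 : 1 ≤ X := Real.one_le_rpow (by linarith) (by positivity)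
  refine ⟨Real.exp (1 - X), Real.exp_pos _, fun g hg a b hab => ?_⟩
  rcases (fsDist_nonneg a b).eq_or_lt with h0 | h0
  · rwa [eq_of_fsDist_eq_zero h0.symm, sub_self, abs_zero]
  have h1 : X ≤ logStar (fsDist a b) := by
    rw [logStar_of_le h0 (fsDist_le_one a b)]
    have := Real.log_le_log h0 hab.le
    rw [Real.log_exp] at this
    linarith
  have h2 : c / ε + 1 ≤ logStar (fsDist a b) ^ q := by
    have := Real.rpow_le_rpow (by linarith) h1 hq.le
    rwa [hX, ← Real.rpow_mul (by positivity), one_div, inv_mul_cancel₀ hq.ne',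
      Real.rpow_one] at this
  have h3 := abs_sub_mul_logStar_le hc.le hg a b
  by_contra! h4
  have h5 : ε * (c / ε + 1) ≤ |g a - g b| * logStar (fsDist a b) ^ q :=
    mul_le_mul h4 h2 (by positivity) (abs_nonneg _)
  have e : ε * (c / ε + 1) = c + ε := by field_simp
  linarith

end

end MixedModulus

end

/-! ### Assembly of the two statements -/

theorem proposition2p4 (k : ℕ) (hk : 1 ≤ k) :
    (∃ c : ℝ, 0 < c ∧
      ∀ (u v : Cn k → ℝ) (G : Fin k → Cn k → ℂ),
        ContinuousOn u (ballC k 5) →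
        IsDel (ballC k 5) u G →
        (∀ j, MeasureTheory.MemLp (G j) 2
          (MeasureTheory.volume.restrict (ballC k 5 : Set (Cn k)))) →
        ContinuousOn v (ballC k 5) →
        IsPsh (ballC k 5) v →
        Current11.IsPositive (ddc (ballC k 5) v
          - delWedge (ballC k 5) G) →
        MeasureTheory.IntegrableOn
          (fun t : ℝ => modulus (ballC k 4 : Set (Cn k)) v t
            * Real.log (logStar t) ^ 4 * t⁻¹) (Set.Ioc 0 1) →
        ∀ r : ℝ, 0 < r → r ≤ 1 / 2 →
          modulus (ballC k 1 : Set (Cn k)) u r ≤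
            c * (∫ t in (0 : ℝ)..r ^ (1 / 2 : ℝ),
                modulus (ballC k 4 : Set (Cn k)) v t
                  * Real.log (logStar t) ^ 2 * t⁻¹) ^ (1 / 2 : ℝ)
            + c * modulus (ballC k 4 : Set (Cn k)) v r
                  ^ (1 / 3 : ℝ)
                * osc (ballC k 4 : Set (Cn k)) v
                  ^ (1 / 6 : ℝ)
                * logStar r ^ (1 / 2 : ℝ)
            + c * osc (ballC k 4 : Set (Cn k)) v
                  ^ (1 / 2 : ℝ)
                * r ^ (1 / 2 : ℝ) * logStar r ^ (1 / 2 : ℝ)) ∧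
    (∀ (d : ℕ), 2 ≤ d → ∀ (f : HolEndo k d) (p : ℝ), 3 / 2 < p →
      (∀ q : ℝ, 0 < q → q < p / 3 - 1 / 2 →
        ∃ c : ℝ, 0 < c ∧
          ∀ (S : CurrentPk k) (uS : Pk k → ℝ),
            HasDynPotential f S uS → logSeminorm p uS ≤ 1 →
            ∀ g ∈ familyF S,
              logSeminorm q g ≤ ENNReal.ofReal c) ∧
      (∀ (S : CurrentPk k) (uS : Pk k → ℝ),
        HasDynPotential f S uS → logSeminorm p uS ≤ 1 →
        ∀ ε : ℝ, 0 < ε → ∃ δ : ℝ, 0 < δ ∧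
          ∀ g ∈ familyF S, ∀ a b : Pk k,
            fsDist a b < δ → |g a - g b| < ε)) := by
  constructor
  · obtain ⟨c, hc, h⟩ := exists_modulus_le hk
    refine ⟨c, hc, fun u v G hu hG _ hv _ hpos hi r hr hr2 => ?_⟩
    obtain ⟨hosc, hmod⟩ := h u v G hu hG hv hpos hi
    have h1 := modulus_nonneg (ballC k 4 : Set (Cn k)) v r
    have h2 : 0 ≤ logStar r := zero_le_one.trans (one_le_logStar r)
    have h3 : 0 ≤ c * modulus (ballC k 4 : Set (Cn k)) v r ^ (1 / 3 : ℝ)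
        * osc (ballC k 4 : Set (Cn k)) v ^ (1 / 6 : ℝ) * logStar r ^ (1 / 2 : ℝ) := by positivity
    have h4 : 0 ≤ c * osc (ballC k 4 : Set (Cn k)) v ^ (1 / 2 : ℝ) * r ^ (1 / 2 : ℝ)
        * logStar r ^ (1 / 2 : ℝ) := by positivity
    exact (hmod r hr hr2).trans ((le_add_of_nonneg_right h3).trans (le_add_of_nonneg_right h4))
  · intro d hd f p hp
    have key : ∀ q : ℝ, 0 < q → q < p / 3 - 1 / 2 → ∃ c : ℝ, 0 < c ∧
        ∀ (S : CurrentPk k) (uS : Pk k → ℝ), HasDynPotential f S uS → logSeminorm p uS ≤ 1 →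
          ∀ g ∈ familyF S, logSeminorm q g ≤ ENNReal.ofReal c := fun q hq0 hq =>
      -- `p/3 - 1/2 ≤ (p - 1)/2` because `p` is positive.
      exists_logSeminorm_le hk hd f (by linarith) hq0 (by linarith)
    refine ⟨key, fun S uS hS huS ε hε => ?_⟩
    -- Any admissible exponent gives equicontinuity; half of the upper bound is one.
    have hq : 0 < (p / 3 - 1 / 2) / 2 := by linarith
    obtain ⟨c, hc, h⟩ := key _ hq (by linarith)
    obtain ⟨δ, hδ, hδε⟩ := exists_fsDist_lt_imp (k := k) hq hc hε
    exact ⟨δ, hδ, fun g hg => hδε g (h S uS hS huS g hg)⟩
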